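/- Call a modulus $\tau=\tau_1+i\tau_i\in\mathbb{C}$ \emph{short} if $\tau_i>0$, $|\tau|\ge 1$, $|\tau_1|\le \tfrac12$ and $\tau_i\le 33$, and let $\mathbb{T}_\tau=\mathbb{C}/(\mathbb{Z}+\mathbb{Z}\tau)$ be the corresponding flat torus, with the metric induced from the Euclidean plane. For $k\in\mathbb{Z}$ let $A_k=(k,-1)$, $B_k=(k,0)$, $C_k=(k,1)$ in the strip $\mathbb{R}\times[-1,1]$. For integers $n,d$ let $\mathcal{T}_{n,d}$ be the diplotorus triangulation: the triangulation of the torus $\mathbb{R}^2/\big(\mathbb{Z}(n,0)+\mathbb{Z}(0,2)\big)$ by the images of the triangles \[A_kA_{k+1}B_k,\quad B_kA_{k+1}B_{k+1},\quad C_kC_{k+1}B_{k-d},\quad B_{k-d}C_{k+1}B_{k+1-d}\qquad(k\in\mathbb{Z}).\] \textbf{Proposition.} There exists a finite abstract simplicial complex $K$ with exactly $2204$ triangles such that: (i) $K$ is a common refinement of $\mathcal{T}_{19,2}$, $\mathcal{T}_{19,7}$ and $\mathcal{T}_{19,13}$: there is a homeomorphism $\Phi$ from the geometric realization $|K|$ to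 the torus $\mathbb{R}^2/\big(\mathbb{Z}(19,0)+\mathbb{Z}(0,2)\big)$ which, for each $d\in\{2,7,13\}$, maps each face of $K$ linearly into a triangle of $\mathcal{T}_{19,d}$ (the same $\Phi$ for the three values of $d$); (ii) for every short modulus $\tau$ there is a topological embedding $|K|\to\mathbb{E}^3$, linear on each face of $K$ (that is, preserving barycentric coordinates), whose image, equipped with the length metric induced by $\mathbb{E}^3$ (the infimum of the Euclidean lengths of paths in the image), is isometric to $\mathbb{T}_\tau$. -/

import Mathlib

noncomputable section

namespace FlatTori

/-- The subgroup `ℤ ω₁ + ℤ ω₂` of the Euclidean plane `ℂ`. -/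
def lattice (ω₁ ω₂ : ℂ) : AddSubgroup ℂ := AddSubgroup.closure {ω₁, ω₂}

/-- The flat torus of modulus `τ`: the quotient of the Euclidean plane by the translations in
`ℤ + ℤ τ`, with the quotient topology and the quotient metric (the distance of two points is the
infimum of the Euclidean distances of their lifts). -/
abbrev FlatTorus (τ : ℂ) : Type := ℂ ⧸ lattice 1 τ

/-- The moduli of the short tori: the part of the fundamental domain of the modular group that
lies below the horizontal line at height `33`. -/
def shortModuli : Set ℂ := {τ | 0 < τ.im ∧ 1 ≤ ‖τ‖ ∧ |τ.re| ≤ 1 / 2 ∧ |τ.im| ≤ 33}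

/-- Euclidean 3-space. -/
abbrev E3 : Type := EuclideanSpace ℝ (Fin 3)

section Complexes

variable {V : Type} [Fintype V]

/-- The number of triangles of a finite simplicial complex. -/
def numTriangles (K : AbstractSimplicialComplex V) : ℕ :=
  {σ : Finset V | σ ∈ K.faces ∧ σ.card = 3}.ncard

/-- The geometric realization `|K|`: points are given by barycentric coordinates whose support
lies in a face. It carries the topology of `V → ℝ`. -/
def realization (K : AbstractSimplicialComplex V) : Set (V → ℝ) :=
  {w | w ∈ stdSimplex ℝ V ∧ ∃ σ ∈ K.faces, ∀ v, v ∉ σ → w v = 0}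

/-- The linear map `|K| → E3` determined by the images of the vertices: it is the extension that
preserves barycentric coordinates on each face. -/
def linearMapOf (K : AbstractSimplicialComplex V) (p : V → E3) : realization K → E3 :=
  fun w => ∑ v, w.1 v • p v

end Complexes

/-- The length distance in a subset `X` of Euclidean 3-space: the infimum of the Euclidean lengths
of the paths in `X` from `x` to `y` (`∞` if there is no such path of finite length). -/
def lengthDist (X : Set E3) (x y : E3) : ENNReal :=
  ⨅ (γ : ℝ → E3) (_ : ContinuousOn γ (Set.Icc 0 1) ∧ Set.MapsTo γ (Set.Icc 0 1) X ∧
    γ 0 = x ∧ γ 1 = y), eVariationOn γ (Set.Icc 0 1)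

/-- The subset `X` of Euclidean 3-space, with its length distance, is isometric to the flat torus
of modulus `τ`. -/
def IsIsometricToFlatTorus (X : Set E3) (τ : ℂ) : Prop :=
  ∃ φ : FlatTorus τ ≃ X, ∀ x y, lengthDist X (φ x) (φ y) = edist x y

/-- `K` admits a linear embedding in Euclidean 3-space whose image, with the induced length
metric, is isometric to the flat torus of modulus `τ`. -/
def AdmitsLinearEmbedding {V : Type} [Fintype V] (K : AbstractSimplicialComplex V) (τ : ℂ) :
    Prop :=
  ∃ p : V → E3, Topology.IsEmbedding (linearMapOf K p) ∧
    IsIsometricToFlatTorus (Set.range (linearMapOf K p)) τ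

/-- The point `A_k = (k, -1)` on the lower boundary of the strip `ℝ × [-1, 1]`. -/
def ptA (k : ℤ) : ℂ := ⟨k, -1⟩

/-- The point `B_k = (k, 0)` in the middle of the strip. -/
def ptB (k : ℤ) : ℂ := ⟨k, 0⟩

/-- The point `C_k = (k, 1)` on the upper boundary of the strip. -/
def ptC (k : ℤ) : ℂ := ⟨k, 1⟩

/-- The closed triangle with the given vertices. -/
def triangle (a b c : ℂ) : Set ℂ := convexHull ℝ {a, b, c}

/-- The torus obtained from the strip `ℝ × [-1, 1]` by the translation `(n, 0)` and by gluing its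
two boundaries by the translation `(0, 2)`. It contains all the triangulations `T_{n,d}`; here
`A_k` and `C_k` become one point, and so do `A_k` and `A_{k+n}`, and `B_k` and `B_{k+n}`. -/
abbrev LayoutTorus (n : ℕ) : Type := ℂ ⧸ lattice (n : ℂ) (2 * Complex.I)

/-- The triangles, in the strip, of the diplotorus triangulation `T_{n,d}`. The first two families
form the internal ploid, the last two form the external ploid, and `T_{n,d}` is the triangulation
of `LayoutTorus n` by the images of these triangles. -/
def diplotorusTriangles (d : ℤ) : Set (Set ℂ) :=
  {t | ∃ k : ℤ,
    t = triangle (ptA k) (ptA (k + 1)) (ptB k) ∨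
    t = triangle (ptB k) (ptA (k + 1)) (ptB (k + 1)) ∨
    t = triangle (ptC k) (ptC (k + 1)) (ptB (k - d)) ∨
    t = triangle (ptB (k - d)) (ptC (k + 1)) (ptB (k + 1 - d))}

/-- The homeomorphism `Φ` makes `K` a triangulation of `LayoutTorus n` that subdivides `T_{n,d}`:
each face of `K` is mapped linearly (through a lift to the plane, given by the images `q v` of its
vertices) into a triangle of `T_{n,d}`. -/
def Subdivides {V : Type} [Fintype V] (K : AbstractSimplicialComplex V) (n : ℕ) (d : ℤ)
    (Φ : realization K ≃ₜ LayoutTorus n) : Prop :=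
  ∀ σ ∈ K.faces, ∃ q : V → ℂ,
    (∀ w : realization K, (∀ v, v ∉ σ → w.1 v = 0) →
      Φ w = QuotientAddGroup.mk (∑ v, w.1 v • q v)) ∧
    ∃ t ∈ diplotorusTriangles d, ∀ v ∈ σ, q v ∈ t

/-- `K` is a common refinement of the triangulations `T_{n,d}`, `d ∈ D`, all of them drawn in the
same torus. -/
def IsCommonRefinement {V : Type} [Fintype V] (K : AbstractSimplicialComplex V) (n : ℕ)
    (D : Set ℤ) : Prop :=
  ∃ Φ : realization K ≃ₜ LayoutTorus n, ∀ d ∈ D, Subdivides K n d Φ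

end FlatTori

end

/-! ### Trigonometry of the regular 19-gon and the sector inequalities -/

noncomputable section
namespace FlatTori
open Complex ComplexConjugate

/-! A ploid joins two coaxial regular 19-gons of radius 1, at heights 0 and `h`, by 38 congruent
triangles; its twist `φ` is the angle by which the upper polygon is turned. Two ploids whose twists
differ by `2 * al * d` have the same boundary polygons, the vertices being matched with a shift of
`d`. Glued along both polygons they form a surface with the triangulation `T_{19,d}`. Each ploid has
angle `π` at each of its vertices, being made of congruent triangles in the pattern of a strip, so
the surface is flat. It unrolls onto the plane by `dev`, with period lattice generated by `38 * sin
al` and a transverse period, whose real part is `sin φ - sin φ' - 2 * d * sin al` and whose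
imaginary part is the sum of the heights of the triangles of the two ploids.

The surface is embedded for suitable twists, and this is checked level by level. A horizontal
section of a ploid is a simple polygon when `|φ| < π - al` (`sec_inj`), and the section of the
strongly twisted ploid does not meet the one of the other ploid when `|φ'| + 2 * al < φ` and `3 * al
< φ < π - al` (`sec_ne_sec`). A comparison of path lengths on a locally finite cover by isometric
pieces (`isIsometricToFlatTorus_range`) then identifies the length metric with that of the flat
torus.

With `φ = u + d * al` and `φ' = u - d * al`, the angle `u` is adjusted to the real part of the
modulus and the height `h` to its imaginary part (`isDiplotorusModulus`). The values `d = 2, 7, 13`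
together reach the short moduli with `|Re τ| ≥ 0.003`, up to reflection. The nearly rectangular ones
are reached after the change of basis `τ ↦ -1 / (τ + m)`, with `m = 1` or `m = 4`.

Finally, `diplo` is affine on every triangle of `T_{19,d}`, so any complex that subdivides this
triangulation embeds linearly on the surface (`admitsLinearEmbedding_of_subdivides`). A common
refinement is given by a table of 116 triangles, to be repeated in 19 columns. Edges crossing the
upper half strip have horizontal extent `d` or `d + 1`, hence 2, 3, 7, 8, 13 or 14. Two of their
lines meet at ordinates whose denominators divide a difference of these numbers, and `4620` is the
least common multiple of the differences: this is the scale of the integer coordinates. Triangles of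
the table and their translates are pairwise separated by linear forms, and each edge is matched by a
reversed edge. So the union of the triangles is closed, and open away from a countable set, and it
is the plane. -/

/-- The half angle `π / 19` of a side of the regular `19`-gon. -/
def al : ℝ := Real.pi / 19

/-- The unit complex number of argument `x`. -/
def cis (x : ℝ) : ℂ := ⟨Real.cos x, Real.sin x⟩

@[simp] lemma cis_re (x : ℝ) : (cis x).re = Real.cos x := rfl
@[simp] lemma cis_im (x : ℝ) : (cis x).im = Real.sin x := rfl

lemma cis_zero : cis 0 = 1 := by apply Complex.ext <;> simp

lemma cis_add (x y : ℝ) : cis (x + y) = cis x * cis y := by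
  apply Complex.ext
  · simp [Real.cos_add]
  · simp [Real.sin_add]; ring

lemma conj_cis (x : ℝ) : conj (cis x) = cis (-x) := by
  apply Complex.ext <;> simp

lemma cis_mul_cis_neg (x : ℝ) : cis x * cis (-x) = 1 := by
  rw [← cis_add, add_neg_cancel, cis_zero]

lemma cis_ne_zero (x : ℝ) : cis x ≠ 0 := fun h => by
  have := cis_mul_cis_neg x
  rw [h, zero_mul] at this
  exact zero_ne_one this

lemma normSq_cis (x : ℝ) : normSq (cis x) = 1 := by
  rw [normSq_apply]; simp only [cis_re, cis_im]; nlinarith [Real.sin_sq_add_cos_sq x]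

lemma cis_add_int_mul_two_pi (x : ℝ) (m : ℤ) : cis (x + m * (2 * Real.pi)) = cis x := by
  apply Complex.ext
  · simp
  · simp

lemma cis_eq_cis_iff {x y : ℝ} : cis x = cis y ↔ ∃ m : ℤ, x = y + m * (2 * Real.pi) := by
  constructor
  · intro h
    have h1 := congrArg re h
    have h2 := congrArg im h
    simp only [cis_re, cis_im] at h1 h2
    have h3 : Real.cos (x - y) = 1 := by
      rw [Real.cos_sub, h1, h2]; nlinarith [Real.sin_sq_add_cos_sq y]
    obtain ⟨m, hm⟩ := (Real.cos_eq_one_iff _).1 h3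
    exact ⟨m, by linarith⟩
  · rintro ⟨m, rfl⟩
    exact cis_add_int_mul_two_pi y m

lemma al_pos : 0 < al := div_pos Real.pi_pos (by norm_num)

lemma nineteen_al : 19 * al = Real.pi := by unfold al; ring

lemma sin_al_pos : 0 < Real.sin al :=
  Real.sin_pos_of_pos_of_lt_pi al_pos (by linarith [nineteen_al, al_pos])

lemma cos_al_pos : 0 < Real.cos al :=
  Real.cos_pos_of_mem_Ioo ⟨by linarith [nineteen_al, al_pos], by linarith [nineteen_al, al_pos]⟩

/-- The sign of `sin (2πm/19)` and of its successor locates `m` modulo `19`. -/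
lemma dvd_of_sin_nonpos_of_sin_succ_nonneg {m : ℤ} (h₁ : Real.sin (2 * al * m) ≤ 0)
    (h₂ : 0 ≤ Real.sin (2 * al * (m + 1 : ℤ))) : (19 : ℤ) ∣ m ∨ (19 : ℤ) ∣ m + 1 := by
  obtain ⟨q, r, hr0, hr, rfl⟩ : ∃ q r : ℤ, 0 ≤ r ∧ r < 19 ∧ m = r + q * 19 :=
    ⟨m / 19, m % 19, by omega, by omega, by omega⟩
  have e1 : Real.sin (2 * al * (r + q * 19 : ℤ)) = Real.sin (2 * al * r) := by
    rw [← Real.sin_add_int_mul_two_pi (2 * al * r) q, ← nineteen_al]; congr 1; push_cast; ring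
  have e2 : Real.sin (2 * al * (r + q * 19 + 1 : ℤ)) = Real.sin (2 * al * (r + 1)) := by
    rw [← Real.sin_add_int_mul_two_pi (2 * al * (r + 1)) q, ← nineteen_al]; congr 1; push_cast; ring
  rw [e1] at h₁
  rw [e2] at h₂
  have ha := al_pos
  have hpi := nineteen_al
  by_cases h0 : r = 0
  · left; omega
  by_cases h18 : r = 18
  · right; omega
  exfalso
  have hr1 : (1 : ℝ) ≤ r := by exact_mod_cast (by omega : (1 : ℤ) ≤ r)
  -- For `1 ≤ r ≤ 9` the angle `2 * al * r` is in `(0, π)`, against `h₁`; for `10 ≤ r ≤ 17` the next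
  -- one is in `(π, 2π)`, against `h₂`.
  by_cases h9 : r ≤ 9
  · have h9' : (r : ℝ) ≤ 9 := by exact_mod_cast h9
    have := Real.sin_pos_of_pos_of_lt_pi (x := 2 * al * r) (by positivity) (by nlinarith)
    linarith
  · have h9' : (10 : ℝ) ≤ r := by exact_mod_cast (by omega : (10 : ℤ) ≤ r)
    have h17 : (r : ℝ) ≤ 17 := by exact_mod_cast (by omega : r ≤ 17)
    have := Real.sin_neg_of_neg_of_neg_pi_lt (x := 2 * al * (r + 1) - 2 * Real.pi)
      (by nlinarith) (by nlinarith)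
    rw [Real.sin_sub_two_pi] at this
    linarith

section Sector

variable {c s C S t x y : ℝ}

/-- Here `x = s - a` and `y = s + b` for points `a`, `b` of an `A`-edge and of a `B`-edge, and `hr`
says that their distances to the axis agree. With `s` in place of `S`, the difference of the two
sides of `hr` is the product of `(1 - t) * x - t * y` by `t * (2 * s - y) + (1 - t) * (2 * s - x)`.
-/
lemma radius_order_of_le (hs : s ≤ S) (ht0 : 0 < t) (ht : t ≤ 1 / 2) (hx0 : 0 ≤ x)
    (hys : y ≤ 2 * s)
    (hr : (1 - t) ^ 2 * (x * (2 * s - x)) - t ^ 2 * (y * (2 * s - y))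
      = 2 * t * (1 - t) * S * (y - x)) : t * y ≤ (1 - t) * x := by
  by_contra! h
  have hxy : x < y := by nlinarith
  have h1 : 0 ≤ (t * (1 - t)) * ((S - s) * (y - x)) :=
    mul_nonneg (by nlinarith) (mul_nonneg (by linarith) (by linarith))
  have h3 : 0 ≤ t * ((t * y - (1 - t) * x) * (2 * s - y)) :=
    mul_nonneg ht0.le (mul_nonneg (by linarith) (by linarith))
  have h4 : 0 < (1 - t) * ((t * y - (1 - t) * x) * (2 * s - x)) :=
    mul_pos (by linarith) (mul_pos (by linarith) (by linarith))
  linarith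

/-- Same principle for a twist of the other sign: with `s` in place of `S`, the difference of the
two sides of `hr` is the product of `t * y + (1 - t) * x` by `2 * s * (1 - 2 * t) + t * y - (1 - t)
* x`. -/
lemma radius_order'_of_le (hs : s ≤ S) (ht0 : 0 < t) (ht : t ≤ 1 / 2) (hs0 : 0 < s) (hx0 : 0 ≤ x)
    (hr : (1 - t) ^ 2 * (x * (2 * s - x)) - t ^ 2 * (y * (2 * s - y))
      = 2 * t * (1 - t) * S * (x - y)) : t * y ≤ (1 - t) * x := by
  by_contra! h
  have hxy : x < y := by nlinarith
  have h1 : 0 ≤ (t * (1 - t)) * ((S - s) * (y - x)) :=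
    mul_nonneg (by nlinarith) (mul_nonneg (by linarith) (by linarith))
  have h2 : 0 ≤ s * ((1 - 2 * t) * (t * y + (1 - t) * x)) := by
    apply mul_nonneg hs0.le (mul_nonneg (by linarith) _)
    nlinarith
  have h3 : 0 < (t * y - (1 - t) * x) * (t * y + (1 - t) * x) := by
    apply mul_pos (by linarith)
    nlinarith
  linarith

lemma mul_le_half_sum (hx0 : 0 ≤ x) (hxs : x ≤ 2 * s) (hy0 : 0 ≤ y) (hys : y ≤ 2 * s) :
    x * y ≤ s * (x + y) := by
  nlinarith [mul_nonneg hx0 (by linarith : 0 ≤ 2 * s - y),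
    mul_nonneg hy0 (by linarith : 0 ≤ 2 * s - x)]

/-- The first sector inequality, for twists at least the half angle. -/
lemma sector_left_pos (hc : 0 < c) (hcs : s ^ 2 + c ^ 2 = 1)
    (hs : s ≤ S) (hK : 0 ≤ S * c + C * s) (hlt : 0 < 1 + (C * c - S * s))
    (ht0 : 0 < t) (ht1 : t < 1) (hx0 : 0 ≤ x) (hxs : x ≤ 2 * s) (hy0 : 0 ≤ y) (hys : y ≤ 2 * s)
    (hxy : 0 < x + y)
    (hr : (1 - t) ^ 2 * (x * (2 * s - x)) - t ^ 2 * (y * (2 * s - y))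
      = 2 * t * (1 - t) * S * (y - x)) :
    0 < c * ((1 - t) ^ 2 * x + t ^ 2 * y)
      + t * (1 - t) * ((x + y) * C - x * y * (S * c + C * s)) := by
  -- `(1 - t)² x + t² y` is this product plus `t (1 - t) (x + y)`, which lets `c` join `C` in `h2`.
  -- Exchanging `t` with `1 - t` and `x` with `y` reduces to `t ≤ 1 / 2`.
  have h1 : 0 ≤ (1 - 2 * t) * ((1 - t) * x - t * y) := by
    rcases le_total t (1 / 2) with h | h
    · exact mul_nonneg (by linarith) (by linarith [radius_order_of_le hs ht0 h hx0 hys hr])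
    · have := radius_order_of_le (t := 1 - t) (x := y) (y := x) hs (by linarith) (by linarith)
        hy0 hxs (by linarith)
      nlinarith
  have h2 : 0 < (x + y) * (C + c) - x * y * (S * c + C * s) := by
    have h3 : 0 < c * (1 + (C * c - S * s)) := mul_pos hc hlt
    have h4 : s * (S * c + C * s) < C + c := by
      have : s * (S * c + C * s) = C + c - c * (1 + (C * c - S * s)) := by
        linear_combination C * hcs
      linarith
    have h5 := mul_le_mul_of_nonneg_right (mul_le_half_sum hx0 hxs hy0 hys) hK
    nlinarith [mul_lt_mul_of_pos_left h4 hxy]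
  have h3 := mul_pos (mul_pos ht0 (sub_pos.2 ht1)) h2
  have h4 := mul_nonneg hc.le h1
  linarith

/-- The second sector inequality, for twists at least the half angle. -/
lemma sector_right_pos (hc : 0 < c) (hs0 : 0 < s)
    (hs : s ≤ S) (hK : 0 ≤ S * c - C * s) (hlt : 0 < C + c)
    (ht0 : 0 < t) (ht1 : t < 1) (hx0 : 0 ≤ x) (hy0 : 0 ≤ y)
    (hxy : 0 < x + y)
    (hr : (1 - t) ^ 2 * (x * (2 * s - x)) - t ^ 2 * (y * (2 * s - y))
      = 2 * t * (1 - t) * S * (x - y)) :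
    0 < c * ((1 - t) ^ 2 * x + t ^ 2 * y)
      + t * (1 - t) * ((x + y) * C + x * y * (S * c - C * s)) := by
  have h1 : 0 ≤ (1 - 2 * t) * ((1 - t) * x - t * y) := by
    rcases le_total t (1 / 2) with h | h
    · exact mul_nonneg (by linarith) (by linarith [radius_order'_of_le hs ht0 h hs0 hx0 hr])
    · have := radius_order'_of_le (t := 1 - t) (x := y) (y := x) hs (by linarith) (by linarith)
        hs0 hy0 (by linarith)
      nlinarith
  have h2 : 0 < (x + y) * (C + c) + x * y * (S * c - C * s) := by
    have := mul_nonneg (mul_nonneg hx0 hy0) hK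
    have := mul_pos hxy hlt
    linarith
  have h3 := mul_pos (mul_pos ht0 (sub_pos.2 ht1)) h2
  have h4 := mul_nonneg hc.le h1
  linarith

/-- The sector inequalities for small twists. -/
lemma sector_small_pos {K : ℝ} (hc : 0 < c) (hC : s < C) (hK : K ≤ 1)
    (ht0 : 0 < t) (ht1 : t < 1) (hx0 : 0 ≤ x) (hxs : x ≤ 2 * s) (hy0 : 0 ≤ y) (hys : y ≤ 2 * s)
    (hxy : 0 < x + y) :
    0 < c * ((1 - t) ^ 2 * x + t ^ 2 * y) + t * (1 - t) * ((x + y) * C - x * y * K) := by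
  have h1 : 0 ≤ c * ((1 - t) ^ 2 * x + t ^ 2 * y) := by positivity
  have h2 : 0 < (x + y) * C - x * y * K := by
    have := mul_le_half_sum hx0 hxs hy0 hys
    nlinarith [mul_lt_mul_of_pos_left hC hxy, mul_le_mul_of_nonneg_left hK (mul_nonneg hx0 hy0)]
  have h3 := mul_pos (mul_pos ht0 (sub_pos.2 ht1)) h2
  linarith

end Sector

lemma sin_al_lt_cos_al : Real.sin al < Real.cos al := by
  rw [← Real.cos_pi_div_two_sub]
  exact Real.cos_lt_cos_of_nonneg_of_le_pi al_pos.le (by linarith [nineteen_al, al_pos])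
    (by linarith [nineteen_al, al_pos])

/-- The quantities whose signs locate the quotient of two points of equal modulus, one on an
`A`-edge and the other on a `B`-edge. -/
def sectorLeft (φ t a b : ℝ) : ℝ :=
  Real.cos al * ((1 - t) ^ 2 * (Real.sin al - a) + t ^ 2 * (Real.sin al + b))
    + t * (1 - t) * ((Real.sin al - a + (Real.sin al + b)) * Real.cos φ
      - (Real.sin al - a) * (Real.sin al + b) * Real.sin (φ + al))

/-- The hypothesis `hr` is the equality of the distances to the axis, and `hab` excludes one of the
two common end points. Equality of distances is needed only for `|φ| ≥ al`, where it orders `t *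
(sin al + b)` and `(1 - t) * (sin al - a)`. For smaller twists `cos φ ≥ cos al > sin al` is enough.
-/
lemma sectorLeft_pos {φ t a b : ℝ} (hφ : |φ| < Real.pi - al) (ht0 : 0 < t) (ht1 : t < 1)
    (ha : |a| ≤ Real.sin al) (hb : |b| ≤ Real.sin al)
    (hr : (1 - t) ^ 2 * (Real.sin al ^ 2 - a ^ 2) - t ^ 2 * (Real.sin al ^ 2 - b ^ 2)
      = 2 * t * (1 - t) * Real.sin φ * (a + b))
    (hab : 0 < (Real.sin al - a) + (Real.sin al + b)) : 0 < sectorLeft φ t a b := by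
  have hp := nineteen_al
  have hal := al_pos
  rw [abs_lt] at hφ
  rw [abs_le] at ha hb
  unfold sectorLeft
  rcases le_or_gt al φ with h | h
  · rw [Real.sin_add]
    have hS : Real.sin al ≤ Real.sin φ := by
      rcases le_total φ (Real.pi / 2) with h2 | h2
      · exact Real.sin_le_sin_of_le_of_le_pi_div_two (by linarith) h2 h
      · rw [← Real.sin_pi_sub φ]
        exact Real.sin_le_sin_of_le_of_le_pi_div_two (by linarith) (by linarith) (by linarith)
    have hK : 0 ≤ Real.sin φ * Real.cos al + Real.cos φ * Real.sin al := by
      rw [← Real.sin_add]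
      exact Real.sin_nonneg_of_nonneg_of_le_pi (by linarith) (by linarith)
    have hlt : 0 < 1 + (Real.cos φ * Real.cos al - Real.sin φ * Real.sin al) := by
      rw [← Real.cos_add]
      have := Real.cos_lt_cos_of_nonneg_of_le_pi (x := φ + al) (y := Real.pi) (by linarith) le_rfl
        (by linarith)
      rw [Real.cos_pi] at this
      linarith
    exact sector_left_pos cos_al_pos (Real.sin_sq_add_cos_sq al) hS hK hlt ht0 ht1
      (by linarith) (by linarith) (by linarith) (by linarith) hab (by linarith)
  · rcases le_or_gt φ (-al) with h' | h'
    · have hS : Real.sin al ≤ Real.sin (-φ) := by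
        rcases le_total (-φ) (Real.pi / 2) with h2 | h2
        · exact Real.sin_le_sin_of_le_of_le_pi_div_two (by linarith) h2 (by linarith)
        · rw [← Real.sin_pi_sub (-φ)]
          exact Real.sin_le_sin_of_le_of_le_pi_div_two (by linarith) (by linarith) (by linarith)
      have hK : 0 ≤ Real.sin (-φ) * Real.cos al - Real.cos φ * Real.sin al := by
        rw [← Real.cos_neg φ, ← Real.sin_sub]
        exact Real.sin_nonneg_of_nonneg_of_le_pi (by linarith) (by linarith)
      have hlt : 0 < Real.cos φ + Real.cos al := by
        have := Real.cos_lt_cos_of_nonneg_of_le_pi (x := -φ) (y := Real.pi - al) (by linarith)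
          (by linarith) (by linarith)
        rw [Real.cos_pi_sub, Real.cos_neg] at this
        linarith
      have := sector_right_pos (x := Real.sin al - a) (y := Real.sin al + b) cos_al_pos
        sin_al_pos hS hK hlt ht0 ht1 (by linarith) (by linarith) hab
        (by rw [Real.sin_neg]; linarith)
      rw [Real.sin_add]
      rw [Real.sin_neg] at this
      linarith
    · have hC : Real.cos al ≤ Real.cos φ := by
        rw [← Real.cos_abs φ]
        exact Real.cos_le_cos_of_nonneg_of_le_pi (abs_nonneg _) (by linarith)
          (abs_le.2 ⟨h'.le, h.le⟩)
      exact sector_small_pos (s := Real.sin al) cos_al_pos (by linarith [sin_al_lt_cos_al])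
          (Real.sin_le_one _) ht0 ht1
        (by linarith) (by linarith) (by linarith) (by linarith) hab

end FlatTori
end

/-! ### Edges of a section in their own frames, and when they meet -/

noncomputable section
namespace FlatTori
open Complex ComplexConjugate

/-- A point of an `A`-edge at level `t` of a ploid of twist `φ`, in the frame of the edge. -/
def zA (φ t a : ℝ) : ℂ := ⟨(1 - t) * Real.cos al + t * Real.cos φ, (1 - t) * a + t * Real.sin φ⟩

/-- A point of a `B`-edge at level `t` of a ploid of twist `φ`, in the frame of the edge. -/
def zB (φ t b : ℝ) : ℂ := ⟨t * Real.cos al + (1 - t) * Real.cos φ, t * b - (1 - t) * Real.sin φ⟩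

lemma conj_zA (φ t a : ℝ) : conj (zA φ t a) = zB φ (1 - t) (-a) := by
  apply Complex.ext <;> simp [zA, zB] <;> ring

lemma conj_zB (φ t b : ℝ) : conj (zB φ t b) = zA φ (1 - t) (-b) := by
  apply Complex.ext <;> simp [zA, zB] <;> ring

variable {φ t a b : ℝ}

lemma sin_add_al_pos (hφ : |φ| < Real.pi - al) (h0 : 0 ≤ φ) : 0 < Real.sin (φ + al) := by
  rw [abs_lt] at hφ
  exact Real.sin_pos_of_pos_of_lt_pi (by linarith [al_pos]) (by linarith)

lemma sin_al_sub_pos (hφ : |φ| < Real.pi - al) (h0 : φ ≤ 0) : 0 < Real.sin (al - φ) := by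
  rw [abs_lt] at hφ
  exact Real.sin_pos_of_pos_of_lt_pi (by linarith [al_pos]) (by linarith)

/-- For `φ ≥ 0`, the form `re * sin al + im * cos al` vanishes at the end `a = -sin al` of the lower
edge, is nonnegative on this edge, and is positive at `cis φ`. For `φ ≤ 0` the mirror image of this
form is used. -/
lemma zA_ne_zero (hφ : |φ| < Real.pi - al) (ht0 : 0 ≤ t) (ht1 : t ≤ 1)
    (ha : |a| ≤ Real.sin al) : zA φ t a ≠ 0 := by
  intro h
  have h1 := congrArg re h
  have h2 := congrArg im h
  simp only [zA, zero_re, zero_im] at h1 h2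
  have hc := cos_al_pos
  have hs := sin_al_pos
  rw [abs_le] at ha
  have key : t = 0 := by
    by_contra hne
    have htp : 0 < t := lt_of_le_of_ne ht0 (Ne.symm hne)
    rcases le_total 0 φ with h0 | h0
    · have := mul_pos htp (sin_add_al_pos hφ h0)
      rw [Real.sin_add] at this
      have h3 := mul_nonneg (mul_nonneg (sub_nonneg.2 ht1) hc.le)
        (by linarith : 0 ≤ Real.sin al + a)
      nlinarith
    · have := mul_pos htp (sin_al_sub_pos hφ h0)
      rw [Real.sin_sub] at this
      have h3 := mul_nonneg (mul_nonneg (sub_nonneg.2 ht1) hc.le)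
        (by linarith : 0 ≤ Real.sin al - a)
      nlinarith
  rw [key] at h1
  linarith

lemma zB_ne_zero (hφ : |φ| < Real.pi - al) (ht0 : 0 ≤ t) (ht1 : t ≤ 1)
    (hb : |b| ≤ Real.sin al) : zB φ t b ≠ 0 := by
  intro h
  have := congrArg conj h
  rw [conj_zB, map_zero] at this
  exact zA_ne_zero hφ (by linarith) (by linarith) (by rwa [abs_neg]) this

/-- Points of one edge at equal distance from the axis have equal or opposite imaginary parts, since
they share their real part. In the opposite case the forms of `zA_ne_zero`, applied to one point or
to the other according to the sign of `φ`, bound the argument by `al`. -/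
lemma zA_fold (hφ : |φ| < Real.pi - al) (ht0 : 0 ≤ t) {a' : ℝ}
    (ht1 : t < 1) (ha : |a| ≤ Real.sin al)
    (ha' : |a'| ≤ Real.sin al) (hpos : 0 ≤ (zA φ t a).im) (hneg : (zA φ t a').im = -(zA φ t a).im) :
    (zA φ t a).im * Real.cos al ≤ (zA φ t a).re * Real.sin al ∧
    ((zA φ t a).im * Real.cos al = (zA φ t a).re * Real.sin al →
      t = 0 ∧ a = Real.sin al ∧ a' = -Real.sin al) := by
  simp only [zA] at *
  have hc := cos_al_pos
  have hs := sin_al_pos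
  rw [abs_le] at ha ha'
  have h3 := mul_nonneg (mul_nonneg (sub_nonneg.2 ht1.le) hc.le)
        (by linarith : 0 ≤ Real.sin al + a')
  have h4 := mul_nonneg (mul_nonneg (sub_nonneg.2 ht1.le) hc.le)
        (by linarith : 0 ≤ Real.sin al - a)
  have key : 0 ≤ t * Real.sin (|φ| + al) ∧ t * Real.sin (|φ| + al) ≤
      ((1 - t) * Real.cos al + t * Real.cos φ) * Real.sin al
        - ((1 - t) * a + t * Real.sin φ) * Real.cos al := by
    have h5 := sin_add_al_pos (φ := |φ|) (by rwa [abs_abs]) (abs_nonneg _)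
    refine ⟨by positivity, ?_⟩
    rcases le_total 0 φ with h0 | h0
    · rw [abs_of_nonneg h0, Real.sin_add]
      linear_combination h3 + Real.cos al * hneg
    · rw [abs_of_nonpos h0, Real.sin_add, Real.sin_neg, Real.cos_neg]
      linear_combination h4
  refine ⟨by linarith, fun h => ?_⟩
  have h6 : t = 0 := by
    have h5 := sin_add_al_pos (φ := |φ|) (by rwa [abs_abs]) (abs_nonneg _)
    have : t * Real.sin (|φ| + al) ≤ 0 := by linarith
    by_contra hne
    exact absurd (mul_pos (lt_of_le_of_ne ht0 (Ne.symm hne)) h5) (by linarith)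
  subst h6
  have h7 : a = Real.sin al := by
    apply mul_right_cancel₀ hc.ne'
    linarith
  exact ⟨rfl, h7, by linarith⟩

lemma zA_im_inj (ht1 : t < 1) {a' : ℝ} (h : (zA φ t a).im = (zA φ t a').im) : a = a' := by
  simp only [zA] at h
  have : (1 - t) * a = (1 - t) * a' := by linarith
  exact mul_left_cancel₀ (by linarith) this

lemma cis_eq_one_dvd {m : ℤ} (h : cis (2 * al * m) = 1) : (19 : ℤ) ∣ m := by
  rw [← cis_zero, cis_eq_cis_iff] at h
  obtain ⟨k, hk⟩ := h
  rw [← nineteen_al] at hk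
  have h2 : (2 * al) * (m : ℝ) = 2 * al * (19 * k) := by linarith
  have h3 := mul_left_cancel₀ (mul_pos two_pos al_pos).ne' h2
  exact ⟨k, by exact_mod_cast h3⟩

end FlatTori
end

noncomputable section
namespace FlatTori
open Complex ComplexConjugate

variable {φ t a b : ℝ}

lemma sin_mul_two_al_succ (m : ℤ) :
    cis (2 * al * m) * cis al * cis al = cis (2 * al * (m + 1 : ℤ)) := by
  rw [← cis_add, ← cis_add]; congr 1; push_cast; ring

/-- The rotation that takes a point to its conjugate has angle `-2 * arg`, which is between `-2 *
al` and `0` by `zA_fold`. A multiple of `2 * al` there is `0`, impossible as the point is not real,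
or `-2 * al`, the case of equality. -/
lemma zA_fold_rotation (hφ : |φ| < Real.pi - al) (ht0 : 0 ≤ t) (ht1 : t < 1) {a' : ℝ}
    (ha : |a| ≤ Real.sin al) (ha' : |a'| ≤ Real.sin al) {m : ℤ} (hpos : 0 < (zA φ t a).im)
    (hneg : (zA φ t a').im = -(zA φ t a).im)
    (h : zA φ t a * cis (2 * al * m) = zA φ t a') :
    a = Real.sin al ∧ a' = -Real.sin al := by
  obtain ⟨h1, h2⟩ := zA_fold hφ ht0 ht1 ha ha' hpos.le hneg
  have hre : (zA φ t a').re = (zA φ t a).re := rfl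
  obtain ⟨p, hp⟩ : ∃ p, p = (zA φ t a).re := ⟨_, rfl⟩
  obtain ⟨q, hq⟩ : ∃ q, q = (zA φ t a).im := ⟨_, rfl⟩
  rw [← hp, ← hq] at h1 h2
  rw [← hq] at hpos hneg
  rw [← hp] at hre
  have hc := cos_al_pos
  have hs := sin_al_pos
  have hr : 0 < p ^ 2 + q ^ 2 := by positivity
  have hp0 : 0 < p := by
    by_contra! hle
    nlinarith [mul_pos hpos hc]
  have e1 : p * Real.cos (2 * al * m) - q * Real.sin (2 * al * m) = p := by
    have := congrArg re h
    rw [mul_re, hre, ← hp, ← hq] at this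
    simpa using this
  have e2 : p * Real.sin (2 * al * m) + q * Real.cos (2 * al * m) = -q := by
    have := congrArg im h
    rw [mul_im, hneg, ← hp, ← hq] at this
    simpa using this
  have e3 : (p ^ 2 + q ^ 2) * Real.sin (2 * al * m) = -(2 * p * q) := by
    linear_combination p * e2 - q * e1
  have e4 : (p ^ 2 + q ^ 2) * Real.cos (2 * al * m) = p ^ 2 - q ^ 2 := by
    linear_combination p * e1 + q * e2
  have e5 : (p ^ 2 + q ^ 2) * Real.sin (2 * al * (m + 1 : ℤ)) =
      2 * (p * Real.cos al + q * Real.sin al) * (p * Real.sin al - q * Real.cos al) := by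
    have := congrArg im (sin_mul_two_al_succ m)
    simp only [mul_im, mul_re, cis_re, cis_im] at this
    rw [← this]
    linear_combination (Real.cos al ^ 2 - Real.sin al ^ 2) * e3 + 2 * Real.sin al * Real.cos al * e4
  have s1 : Real.sin (2 * al * m) ≤ 0 := by
    by_contra! hlt
    have := mul_pos hr hlt
    have := mul_pos hp0 hpos
    linarith
  have hlin : 0 < p * Real.cos al + q * Real.sin al := by positivity
  have s2 : 0 ≤ Real.sin (2 * al * (m + 1 : ℤ)) := by
    by_contra! hlt
    have := mul_neg_of_pos_of_neg hr hlt
    have := mul_nonneg hlin.le (sub_nonneg.2 h1)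
    nlinarith
  rcases dvd_of_sin_nonpos_of_sin_succ_nonneg s1 s2 with ⟨k, rfl⟩ | ⟨k, hk⟩
  · exfalso
    have : Real.sin (2 * al * (19 * k : ℤ)) = 0 := by
      have e : 2 * al * (19 * k : ℤ) = 0 + k * (2 * Real.pi) := by
        rw [← nineteen_al]; push_cast; ring
      rw [e, Real.sin_add_int_mul_two_pi, Real.sin_zero]
    rw [this] at e3
    have := mul_pos hp0 hpos
    linarith
  · have : Real.sin (2 * al * (m + 1 : ℤ)) = 0 := by
      rw [hk]
      have e : 2 * al * (19 * k : ℤ) = 0 + k * (2 * Real.pi) := by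
        rw [← nineteen_al]; push_cast; ring
      rw [e, Real.sin_add_int_mul_two_pi, Real.sin_zero]
    rw [this, mul_zero] at e5
    have : p * Real.sin al - q * Real.cos al = 0 := by
      rcases mul_eq_zero.1 e5.symm with h' | h'
      · linarith
      · exact h'
    exact (h2 (by linarith)).2

/-- Two `A`-edges at the same level meet only in a common end point. -/
lemma zA_rotation (hφ : |φ| < Real.pi - al) (ht0 : 0 ≤ t) (ht1 : t < 1) {a' : ℝ}
    (ha : |a| ≤ Real.sin al) (ha' : |a'| ≤ Real.sin al) {m : ℤ}
    (h : zA φ t a * cis (2 * al * m) = zA φ t a') :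
    ((19 : ℤ) ∣ m ∧ a = a') ∨ (a = Real.sin al ∧ a' = -Real.sin al) ∨
      (a = -Real.sin al ∧ a' = Real.sin al) := by
  have hn := congrArg normSq h
  rw [map_mul, normSq_cis, mul_one, normSq_apply, normSq_apply] at hn
  have hre : (zA φ t a').re = (zA φ t a).re := rfl
  rw [hre, add_right_inj, mul_self_eq_mul_self_iff] at hn
  by_cases heq : (zA φ t a).im = (zA φ t a').im
  · left
    have haa := zA_im_inj ht1 heq
    subst haa
    refine ⟨cis_eq_one_dvd ?_, rfl⟩
    exact mul_left_cancel₀ (zA_ne_zero hφ ht0 ht1.le ha) (by rw [h, mul_one])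
  · right
    have hneg := hn.resolve_left heq
    rcases lt_trichotomy (zA φ t a).im 0 with h0 | h0 | h0
    · right
      have h' : zA φ t a' * cis (2 * al * (-m : ℤ)) = zA φ t a := by
        rw [← h, mul_assoc, ← cis_add]
        rw [show 2 * al * m + 2 * al * ((-m : ℤ) : ℝ) = 0 by push_cast; ring, cis_zero, mul_one]
      exact (zA_fold_rotation hφ ht0 ht1 ha' ha (by linarith) hneg h').symm
    · exact absurd (by linarith : (zA φ t a).im = (zA φ t a').im) heq
    · left
      exact zA_fold_rotation hφ ht0 ht1 ha ha' h0 (by linarith) h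

lemma zB_rotation (hφ : |φ| < Real.pi - al) (ht0 : 0 < t) (ht1 : t ≤ 1) {b' : ℝ}
    (hb : |b| ≤ Real.sin al) (hb' : |b'| ≤ Real.sin al) {m : ℤ}
    (h : zB φ t b * cis (2 * al * m) = zB φ t b') :
    ((19 : ℤ) ∣ m ∧ b = b') ∨ (b = Real.sin al ∧ b' = -Real.sin al) ∨
      (b = -Real.sin al ∧ b' = Real.sin al) := by
  have h' := congrArg conj h
  rw [map_mul, conj_zB, conj_zB, conj_cis] at h'
  have h'' : zA φ (1 - t) (-b) * cis (2 * al * (-m : ℤ)) = zA φ (1 - t) (-b') := by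
    rw [← h']; congr 2; push_cast; ring
  rcases zA_rotation hφ (by linarith) (by linarith) (by rwa [abs_neg]) (by rwa [abs_neg]) h'' with
    ⟨hd, e⟩ | ⟨e1, e2⟩ | ⟨e1, e2⟩
  · exact Or.inl ⟨(dvd_neg).1 hd, neg_injective e⟩
  · exact Or.inr (Or.inr ⟨by linarith, by linarith⟩)
  · exact Or.inr (Or.inl ⟨by linarith, by linarith⟩)

/-- An `A`-edge and a `B`-edge at the same level meet only in a common end point. -/
lemma zA_eq_zB (hφ : |φ| < Real.pi - al) (ht0 : 0 < t) (ht1 : t < 1)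
    (ha : |a| ≤ Real.sin al) (hb : |b| ≤ Real.sin al) {m : ℤ}
    (h : zA φ t a = cis (2 * al * m + φ + al) * zB φ t b) :
    (a = Real.sin al ∧ b = -Real.sin al) ∨ (a = -Real.sin al ∧ b = Real.sin al) := by
  have hn := congrArg normSq h
  rw [map_mul, normSq_cis, one_mul] at hn
  have hR : 0 < normSq (zB φ t b) := normSq_pos.2 (zB_ne_zero hφ ht0.le ht1.le hb)
  -- Equality of the squared moduli, with the terms common to both edges removed.
  have hr : (1 - t) ^ 2 * (Real.sin al ^ 2 - a ^ 2) - t ^ 2 * (Real.sin al ^ 2 - b ^ 2)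
      = 2 * t * (1 - t) * Real.sin φ * (a + b) := by
    rw [normSq_apply, normSq_apply] at hn
    simp only [zA, zB] at hn
    linear_combination -hn + (t ^ 2 - (1 - t) ^ 2) * Real.sin_sq_add_cos_sq φ
      + ((1 - t) ^ 2 - t ^ 2) * Real.sin_sq_add_cos_sq al
  have hv : zA φ t a * conj (zB φ t b) = normSq (zB φ t b) * cis (2 * al * m + φ + al) := by
    rw [h, mul_assoc, mul_conj]; ring
  -- The quotient of the two points has argument `2 * al * m + φ + al`. Turned back by `φ + al`,
  -- then by `φ - al`, it gives the signs of the sines at `m` and at `m + 1`.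
  have hL : normSq (zB φ t b) * Real.sin (2 * al * m) = -sectorLeft φ t a b := by
    have h1 : zA φ t a * conj (zB φ t b) * cis (-(φ + al)) =
        normSq (zB φ t b) * cis (2 * al * m) := by
      rw [hv, mul_assoc, ← cis_add]; congr 2; ring
    have h2 := congrArg im h1
    rw [im_ofReal_mul, cis_im] at h2
    rw [← h2]
    simp only [mul_im, mul_re, conj_re, conj_im, zA, zB, cis_re, cis_im, sectorLeft,
      Real.cos_neg, Real.sin_neg, Real.cos_add, Real.sin_add]
    linear_combination ((1 - t) ^ 2 * Real.cos al * (a - Real.sin al)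
      - t ^ 2 * Real.cos al * (b + Real.sin al)
      + t * (1 - t) * (Real.sin φ * Real.cos al - Real.cos φ * Real.sin al)) *
        Real.sin_sq_add_cos_sq φ
      + t * (1 - t) * ((a - b) * Real.cos φ - (Real.sin φ * Real.cos al
        + Real.cos φ * Real.sin al)) * Real.sin_sq_add_cos_sq al
  have hRt : normSq (zB φ t b) * Real.sin (2 * al * (m + 1 : ℤ)) = sectorLeft (-φ) t (-a) (-b) := by
    have h1 : zA φ t a * conj (zB φ t b) * cis (-(φ - al)) =
        normSq (zB φ t b) * cis (2 * al * (m + 1 : ℤ)) := by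
      rw [hv, mul_assoc, ← cis_add]; congr 2; push_cast; ring
    have h2 := congrArg im h1
    rw [im_ofReal_mul, cis_im] at h2
    rw [← h2]
    simp only [mul_im, mul_re, conj_re, conj_im, zA, zB, cis_re, cis_im, sectorLeft,
      Real.cos_neg, Real.sin_neg, Real.cos_sub, Real.sin_sub, Real.sin_add]
    linear_combination ((1 - t) ^ 2 * Real.cos al * (a + Real.sin al)
      + t ^ 2 * Real.cos al * (Real.sin al - b)
      + t * (1 - t) * (Real.sin φ * Real.cos al + Real.cos φ * Real.sin al)) *
        Real.sin_sq_add_cos_sq φ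
      + t * (1 - t) * ((a - b) * Real.cos φ - (Real.sin φ * Real.cos al
        - Real.cos φ * Real.sin al)) * Real.sin_sq_add_cos_sq al
  rw [abs_le] at ha hb
  by_contra hcon
  have p1 : 0 < (Real.sin al - a) + (Real.sin al + b) := by
    by_contra! hle
    exact hcon (Or.inl ⟨by linarith, by linarith⟩)
  have p2 : 0 < (Real.sin al - -a) + (Real.sin al + -b) := by
    by_contra! hle
    exact hcon (Or.inr ⟨by linarith, by linarith⟩)
  have q1 := sectorLeft_pos hφ ht0 ht1 (abs_le.2 ha) (abs_le.2 hb) hr p1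
  have q2 := sectorLeft_pos (φ := -φ) (by rwa [abs_neg]) ht0 ht1 (a := -a) (b := -b)
    (by rw [abs_neg]; exact abs_le.2 ha) (by rw [abs_neg]; exact abs_le.2 hb)
    (by rw [Real.sin_neg]; linarith) p2
  -- The signs would place `m` at `0` or `-1` modulo 19, where one of the sines vanishes; the strict
  -- inequalities exclude this.
  have s1 : Real.sin (2 * al * m) < 0 := by
    by_contra! hle
    have := mul_nonneg hR.le hle
    linarith
  have s2 : 0 < Real.sin (2 * al * (m + 1 : ℤ)) := by
    by_contra! hle
    have := mul_nonpos_of_nonneg_of_nonpos hR.le hle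
    linarith
  rcases dvd_of_sin_nonpos_of_sin_succ_nonneg s1.le s2.le with ⟨k, rfl⟩ | ⟨k, hk⟩
  · have e : 2 * al * (19 * k : ℤ) = 0 + k * (2 * Real.pi) := by
      rw [← nineteen_al]; push_cast; ring
    rw [e, Real.sin_add_int_mul_two_pi, Real.sin_zero] at s1
    exact lt_irrefl _ s1
  · rw [hk] at s2
    have e : 2 * al * (19 * k : ℤ) = 0 + k * (2 * Real.pi) := by
      rw [← nineteen_al]; push_cast; ring
    rw [e, Real.sin_add_int_mul_two_pi, Real.sin_zero] at s2
    exact lt_irrefl _ s2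

end FlatTori
end

/-! ### Horizontal sections of a ploid are simple polygons -/

noncomputable section
namespace FlatTori
open Complex ComplexConjugate

/-- The point with abscissa `x` of the section at level `t` of the ploid of twist `φ`. -/
def sec (φ t x : ℝ) : ℂ :=
  cis (2 * al * ⌊x⌋) * ((1 - t : ℝ) + (t : ℝ) * cis (φ + al) + (cis (2 * al) - 1) *
    ((min (Int.fract x) (1 - t) : ℝ) + (max (Int.fract x - (1 - t)) 0 : ℝ) * cis (φ + al)))

variable {φ t x : ℝ}

/-- The parameter runs over a half-open edge, so each corner of the section belongs to one edge
only. In `sec_inj` this discards the shared end points allowed by `zA_rotation`, `zB_rotation` and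
`zA_eq_zB`. -/
lemma sec_of_lt (ht1 : t ≤ 1) (h : Int.fract x < 1 - t) :
    ∃ a, -Real.sin al ≤ a ∧ a < Real.sin al ∧
      (1 - t) * (a + Real.sin al) = 2 * Real.sin al * Int.fract x ∧
      sec φ t x = cis (2 * al * ⌊x⌋ + al) * zA φ t a := by
  have hf := Int.fract_nonneg x
  have ht : 0 < 1 - t := hf.trans_lt h
  have hs := sin_al_pos
  obtain ⟨f, hfe⟩ : ∃ f, f = Int.fract x := ⟨_, rfl⟩
  rw [← hfe] at h hf ⊢
  have ha : (1 - t) * (-Real.sin al + 2 * Real.sin al * (f / (1 - t)) + Real.sin al)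
      = 2 * Real.sin al * f := by field_simp; ring
  have h0 : 0 ≤ f / (1 - t) := by positivity
  have h1 : f / (1 - t) < 1 := (div_lt_one ht).2 h
  refine ⟨-Real.sin al + 2 * Real.sin al * (f / (1 - t)), ?_, ?_, ha, ?_⟩
  · nlinarith
  · nlinarith
  · unfold sec
    rw [cis_add (2 * al * ⌊x⌋), mul_assoc (cis (2 * al * ⌊x⌋)) (cis al), ← hfe, min_eq_left h.le,
        max_eq_right (by linarith)]
    congr 1
    obtain ⟨a, hae⟩ : ∃ a, a = -Real.sin al + 2 * Real.sin al * (f / (1 - t)) := ⟨_, rfl⟩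
    rw [← hae] at ha ⊢
    have hsc := Real.sin_sq_add_cos_sq al
    apply Complex.ext
    · simp only [zA, mul_re, mul_im, add_re, add_im, sub_re, sub_im, ofReal_re, ofReal_im, cis_re,
        cis_im, one_re, one_im, Real.cos_add, Real.cos_two_mul, Real.sin_two_mul]
      linear_combination Real.sin al * ha + (2 * f - (1 - t)) * hsc
    · simp only [zA, mul_re, mul_im, add_re, add_im, sub_re, sub_im, ofReal_re, ofReal_im, cis_re,
        cis_im, one_re, one_im, Real.sin_add, Real.cos_two_mul, Real.sin_two_mul]
      linear_combination -Real.cos al * ha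

lemma sec_of_ge (ht0 : 0 < t) (h : 1 - t ≤ Int.fract x) :
    ∃ b, -Real.sin al ≤ b ∧ b < Real.sin al ∧
      t * (b + Real.sin al) = 2 * Real.sin al * (Int.fract x - (1 - t)) ∧
      sec φ t x = cis (2 * al * ⌊x⌋ + φ + 2 * al) * zB φ t b := by
  have hf := Int.fract_lt_one x
  have hs := sin_al_pos
  obtain ⟨f, hfe⟩ : ∃ f, f = Int.fract x := ⟨_, rfl⟩
  rw [← hfe] at h hf ⊢
  have ha : t * (-Real.sin al + 2 * Real.sin al * ((f - (1 - t)) / t) + Real.sin al)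
      = 2 * Real.sin al * (f - (1 - t)) := by field_simp; ring
  have h0 : 0 ≤ (f - (1 - t)) / t := div_nonneg (by linarith) ht0.le
  have h1 : (f - (1 - t)) / t < 1 := (div_lt_one ht0).2 (by linarith)
  refine ⟨-Real.sin al + 2 * Real.sin al * ((f - (1 - t)) / t), ?_, ?_, ha, ?_⟩
  · nlinarith
  · nlinarith
  · unfold sec
    rw [show 2 * al * ⌊x⌋ + φ + 2 * al = 2 * al * ⌊x⌋ + (φ + 2 * al) by ring,
      cis_add (2 * al * ⌊x⌋), mul_assoc (cis (2 * al * ⌊x⌋)) (cis (φ + 2 * al)), ← hfe,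
      min_eq_right h,
      max_eq_left (by linarith)]
    congr 1
    obtain ⟨a, hae⟩ : ∃ a, a = -Real.sin al + 2 * Real.sin al * ((f - (1 - t)) / t) := ⟨_, rfl⟩
    rw [← hae] at ha ⊢
    have hsc := Real.sin_sq_add_cos_sq al
    have hSC := Real.sin_sq_add_cos_sq φ
    apply Complex.ext
    · simp only [zB, mul_re, mul_im, add_re, add_im, sub_re, sub_im, ofReal_re, ofReal_im, cis_re,
        cis_im, one_re, one_im, Real.cos_add, Real.sin_add, Real.cos_two_mul, Real.sin_two_mul]
      linear_combination (Real.sin φ * (Real.cos al ^ 2 - Real.sin al ^ 2)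
          + 2 * Real.cos φ * Real.sin al * Real.cos al) * ha
        - ((Real.cos φ * Real.cos al - Real.sin φ * Real.sin al) * (t - 2 * (f - (1 - t)))
            + t * (Real.cos φ * Real.cos al - Real.sin φ * a)) * hsc
        - (1 - t) * (2 * Real.cos al ^ 2 - 1) * hSC
    · simp only [zB, mul_re, mul_im, add_re, add_im, sub_re, sub_im, ofReal_re, ofReal_im, cis_re,
        cis_im, one_re, one_im, Real.cos_add, Real.sin_add, Real.cos_two_mul, Real.sin_two_mul]
      linear_combination -(Real.cos φ * (Real.cos al ^ 2 - Real.sin al ^ 2) - 2 * Real.sin φ *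
          Real.sin al * Real.cos al) * ha
        - ((Real.sin φ * Real.cos al + Real.cos φ * Real.sin al) * (t - 2 * (f - (1 - t)))
            + t * (Real.cos φ * a + Real.sin φ * Real.cos al)) * hsc
        - (1 - t) * (2 * Real.sin al * Real.cos al) * hSC

/-- The section of a ploid at a given level is a simple polygon. -/
lemma sec_inj (hφ : |φ| < Real.pi - al) (ht0 : 0 ≤ t) (ht1 : t ≤ 1) {y : ℝ}
    (h : sec φ t x = sec φ t y) : ∃ m : ℤ, x = y + 19 * m := by
  have hs := sin_al_pos
  have hfin : ∀ {m : ℤ}, (19 : ℤ) ∣ m → ⌊x⌋ = ⌊y⌋ + m → Int.fract x = Int.fract y →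
      ∃ m : ℤ, x = y + 19 * m := by
    rintro m ⟨k, rfl⟩ h1 h2
    refine ⟨k, ?_⟩
    rw [← Int.floor_add_fract x, ← Int.floor_add_fract y, h1, h2]; push_cast; ring
  rcases lt_or_ge (Int.fract x) (1 - t) with hx | hx
  · obtain ⟨a, ha1, ha2, ha3, ha⟩ := sec_of_lt (φ := φ) ht1 hx
    have ht : t < 1 := by linarith [Int.fract_nonneg x]
    rcases lt_or_ge (Int.fract y) (1 - t) with hy | hy
    · obtain ⟨b, hb1, hb2, hb3, hb⟩ := sec_of_lt (φ := φ) ht1 hy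
      have h' : zA φ t a * cis (2 * al * (⌊x⌋ - ⌊y⌋ : ℤ)) = zA φ t b := by
        apply mul_left_cancel₀ (cis_ne_zero (2 * al * ⌊y⌋ + al))
        rw [← hb, ← h, ha, mul_comm (zA φ t a), ← mul_assoc, ← cis_add]
        congr 2; push_cast; ring
      rcases zA_rotation hφ ht0 ht (abs_le.2 ⟨ha1, ha2.le⟩) (abs_le.2 ⟨hb1, hb2.le⟩) h' with
        ⟨hd, e⟩ | ⟨e1, e2⟩ | ⟨e1, e2⟩
      · refine hfin hd (by ring) ?_
        rw [e, hb3] at ha3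
        exact mul_left_cancel₀ (by positivity) ha3.symm
      · linarith
      · linarith
    · have ht0' : 0 < t := by linarith [Int.fract_lt_one y]
      obtain ⟨b, hb1, hb2, hb3, hb⟩ := sec_of_ge (φ := φ) ht0' hy
      have h' : zA φ t a = cis (2 * al * (⌊y⌋ - ⌊x⌋ : ℤ) + φ + al) * zB φ t b := by
        apply mul_left_cancel₀ (cis_ne_zero (2 * al * ⌊x⌋ + al))
        rw [← ha, h, hb, ← mul_assoc, ← cis_add]
        congr 2; push_cast; ring
      rcases zA_eq_zB hφ ht0' ht (abs_le.2 ⟨ha1, ha2.le⟩) (abs_le.2 ⟨hb1, hb2.le⟩) h' with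
        ⟨e1, e2⟩ | ⟨e1, e2⟩ <;> linarith
  · have ht0' : 0 < t := by linarith [Int.fract_lt_one x]
    obtain ⟨a, ha1, ha2, ha3, ha⟩ := sec_of_ge (φ := φ) ht0' hx
    rcases lt_or_ge (Int.fract y) (1 - t) with hy | hy
    · have ht : t < 1 := by linarith [Int.fract_nonneg y]
      obtain ⟨b, hb1, hb2, hb3, hb⟩ := sec_of_lt (φ := φ) ht1 hy
      have h' : zA φ t b = cis (2 * al * (⌊x⌋ - ⌊y⌋ : ℤ) + φ + al) * zB φ t a := by
        apply mul_left_cancel₀ (cis_ne_zero (2 * al * ⌊y⌋ + al))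
        rw [← hb, ← h, ha, ← mul_assoc, ← cis_add]
        congr 2; push_cast; ring
      rcases zA_eq_zB hφ ht0' ht (abs_le.2 ⟨hb1, hb2.le⟩) (abs_le.2 ⟨ha1, ha2.le⟩) h' with
        ⟨e1, e2⟩ | ⟨e1, e2⟩ <;> linarith
    · obtain ⟨b, hb1, hb2, hb3, hb⟩ := sec_of_ge (φ := φ) ht0' hy
      have h' : zB φ t a * cis (2 * al * (⌊x⌋ - ⌊y⌋ : ℤ)) = zB φ t b := by
        apply mul_left_cancel₀ (cis_ne_zero (2 * al * ⌊y⌋ + φ + 2 * al))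
        rw [← hb, ← h, ha, mul_comm (zB φ t a), ← mul_assoc, ← cis_add]
        congr 2; push_cast; ring
      rcases zB_rotation hφ ht0' ht1 (abs_le.2 ⟨ha1, ha2.le⟩) (abs_le.2 ⟨hb1, hb2.le⟩) h' with
        ⟨hd, e⟩ | ⟨e1, e2⟩ | ⟨e1, e2⟩
      · refine hfin hd (by ring) ?_
        rw [e, hb3] at ha3
        linarith [mul_left_cancel₀ (by positivity : (2 * Real.sin al) ≠ 0) ha3]
      · linarith
      · linarith

/-- The shape of the points of the section of a ploid at level `t`: a point of an `A`-edge or of a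
`B`-edge. -/
def IsEdgePoint (ρ φ t : ℝ) (z : ℂ) : Prop :=
  ∃ (k : ℤ) (a : ℝ), |a| ≤ Real.sin al ∧
    (z = cis (2 * al * k + al) * zA φ t a ∨ z = cis (2 * al * k + ρ) * zB φ t a)

lemma isEdgePoint_sec (φ : ℝ) (d : ℤ) (ht0 : 0 < t) (ht1 : t < 1) (x : ℝ) :
    IsEdgePoint (φ + 2 * al * d) φ t (sec φ t x) := by
  rcases lt_or_ge (Int.fract x) (1 - t) with hx | hx
  · obtain ⟨a, ha1, ha2, -, ha⟩ := sec_of_lt (φ := φ) ht1.le hx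
    exact ⟨⌊x⌋, a, abs_le.2 ⟨ha1, ha2.le⟩, Or.inl ha⟩
  · obtain ⟨a, ha1, ha2, -, ha⟩ := sec_of_ge (φ := φ) ht0 hx
    refine ⟨⌊x⌋ + 1 - d, a, abs_le.2 ⟨ha1, ha2.le⟩, Or.inr ?_⟩
    rw [ha]; congr 2; push_cast; ring

/-- A half turn about a horizontal axis exchanges the two boundary polygons. It depends on `ρ` only,
so the same half turn serves both ploids and reduces their disjointness to `t ≤ 1 / 2`. -/
lemma IsEdgePoint.reflect {ρ : ℝ} {z : ℂ} (h : IsEdgePoint ρ φ t z) :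
    IsEdgePoint ρ φ (1 - t) (cis (ρ + al) * conj z) := by
  obtain ⟨k, a, ha, h | h⟩ := h
  · refine ⟨-k, -a, by rwa [abs_neg], Or.inr ?_⟩
    rw [h, map_mul, conj_cis, conj_zA, ← mul_assoc, ← cis_add]
    congr 2; push_cast; ring
  · refine ⟨-k, -a, by rwa [abs_neg], Or.inl ?_⟩
    rw [h, map_mul, conj_cis, conj_zB, ← mul_assoc, ← cis_add]
    congr 2; push_cast; ring

end FlatTori
end

/-! ### Disjointness of the inner and outer sections -/

noncomputable section
namespace FlatTori
open Complex ComplexConjugate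

variable {φ t : ℝ}

/-- The step `2 * al` divides the circle in 19, and `χ` is within half a step of `0`, so it is the
nearest to `0` in its class. -/
lemma cos_add_two_al_mul_le {χ : ℝ} (hχ : |χ| ≤ al) (m : ℤ) :
    Real.cos (χ + 2 * al * m) ≤ Real.cos χ := by
  obtain ⟨q, r, hr0, hr, rfl⟩ : ∃ q r : ℤ, 0 ≤ r ∧ r < 19 ∧ m = r + q * 19 :=
    ⟨m / 19, m % 19, by omega, by omega, by omega⟩
  have e1 : Real.cos (χ + 2 * al * (r + q * 19 : ℤ)) = Real.cos (χ + 2 * al * r) := by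
    rw [← Real.cos_add_int_mul_two_pi (χ + 2 * al * r) q, ← nineteen_al]; congr 1; push_cast; ring
  rw [e1]
  have ha := al_pos
  have hpi := nineteen_al
  have h1 := abs_le.1 hχ
  by_cases h0 : r = 0
  · simp [h0]
  have hr1 : (1 : ℝ) ≤ r := by exact_mod_cast (by omega : (1 : ℤ) ≤ r)
  have h18 : (r : ℝ) ≤ 18 := by exact_mod_cast (by omega : r ≤ 18)
  rw [← Real.cos_abs χ]
  by_cases h9 : r ≤ 9
  · have h9' : (r : ℝ) ≤ 9 := by exact_mod_cast h9
    exact Real.cos_le_cos_of_nonneg_of_le_pi (abs_nonneg _) (by nlinarith) (by nlinarith)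
  · have h9' : (10 : ℝ) ≤ r := by exact_mod_cast (by omega : (10 : ℤ) ≤ r)
    rw [← Real.cos_two_pi_sub (χ + 2 * al * r)]
    exact Real.cos_le_cos_of_nonneg_of_le_pi (abs_nonneg _) (by nlinarith) (by nlinarith)

/-- The points of the sides of the regular `19`-gon. -/
def IsSidePoint (a : ℂ) : Prop :=
  ∃ (j : ℤ) (s : ℝ), |s| ≤ Real.sin al ∧ a = cis (2 * al * j + al) * ⟨Real.cos al, s⟩

/-- A linear form on a side is bounded by its values at the two vertices, of arguments `2 * al * j`
and `2 * al * (j + 1)`. -/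
lemma IsSidePoint.re_le {a : ℂ} (ha : IsSidePoint a) {δ M : ℝ}
    (h : ∀ j : ℤ, Real.cos (2 * al * j - δ) ≤ M) : (cis (-δ) * a).re ≤ M := by
  obtain ⟨j, s, hs, rfl⟩ := ha
  rw [← mul_assoc, ← cis_add]
  obtain ⟨ω, hω⟩ : ∃ ω, ω = -δ + (2 * al * j + al) := ⟨_, rfl⟩
  rw [← hω, mul_re, cis_re, cis_im]
  have h1 := h j
  have h2 := h (j + 1)
  rw [show 2 * al * (j : ℝ) - δ = ω - al by rw [hω]; ring, Real.cos_sub] at h1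
  rw [show 2 * al * ((j + 1 : ℤ) : ℝ) - δ = ω + al by rw [hω]; push_cast; ring, Real.cos_add] at h2
  rw [abs_le] at hs
  show Real.cos ω * Real.cos al - Real.sin ω * s ≤ M
  rcases le_total 0 (Real.sin ω) with h0 | h0
  · nlinarith
  · nlinarith

/-- A point of a section is a combination of a point of the lower `19`-gon and of a point of the
upper one, separated by a large angle. -/
lemma IsEdgePoint.exists_combination {z : ℂ} (hz : IsEdgePoint φ φ t z) (hS : 0 ≤ Real.sin φ) :
    ∃ a b : ℂ, z = (1 - t : ℝ) * a + (t : ℝ) * b ∧ IsSidePoint a ∧ normSq a ≤ 1 ∧ normSq b ≤ 1 ∧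
      (a * conj b).re ≤ Real.cos (φ - al) := by
  obtain ⟨k, s, hs, hz⟩ := hz
  have hs' := abs_le.1 hs
  have hN : normSq (⟨Real.cos al, s⟩ : ℂ) ≤ 1 := by
    rw [normSq_mk, ← Real.sin_sq_add_cos_sq al]
    nlinarith [sq_le_sq.2 (hs.trans (le_abs_self _))]
  rw [Real.cos_sub]
  -- On an `A`-edge, `b` is a vertex of the upper polygon; on a `B`-edge, `a` is a vertex of the
  -- lower one.
  rcases hz with rfl | rfl
  · refine ⟨cis (2 * al * k + al) * ⟨Real.cos al, s⟩, cis (2 * al * k + al) * cis φ, ?_,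
      ⟨k, s, hs, rfl⟩, ?_, ?_, ?_⟩
    · rw [mul_left_comm, mul_left_comm (t : ℂ), ← mul_add]
      congr 1
      apply Complex.ext <;> simp [zA]
    · rw [map_mul, normSq_cis, one_mul]; exact hN
    · rw [map_mul, normSq_cis, normSq_cis, one_mul]
    · rw [map_mul, mul_mul_mul_comm, mul_conj, normSq_cis, ofReal_one, one_mul, conj_cis]
      simp only [mul_re, cis_re, cis_im, Real.cos_neg, Real.sin_neg]
      nlinarith
  · refine ⟨cis (2 * al * k), cis (2 * al * k) * (cis φ * ⟨Real.cos al, s⟩), ?_,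
      ⟨k - 1, Real.sin al, by rw [abs_of_pos sin_al_pos], ?_⟩, ?_, ?_, ?_⟩
    · rw [cis_add, mul_assoc, mul_comm ((1 - t : ℝ) : ℂ), mul_left_comm (t : ℂ), ← mul_add]
      congr 1
      have hSC := Real.sin_sq_add_cos_sq φ
      apply Complex.ext
      · simp [zB]
        linear_combination (1 - t) * hSC
      · simp [zB]
        ring
    · change _ = _ * cis al
      rw [← cis_add]; congr 1; push_cast; ring
    · rw [normSq_cis]
    · rw [map_mul, map_mul, normSq_cis, normSq_cis, one_mul, one_mul]; exact hN
    · rw [map_mul, ← mul_assoc, mul_conj, normSq_cis, ofReal_one, one_mul, map_mul, conj_cis]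
      simp only [mul_re, cis_re, cis_im, Real.cos_neg, Real.sin_neg, conj_re, conj_im]
      nlinarith

lemma normSq_combination_le {a b : ℂ} {κ τ : ℝ} (h0 : 0 ≤ τ) (h1 : τ ≤ 1) (ha : normSq a ≤ 1)
    (hb : normSq b ≤ 1) (hab : (a * conj b).re ≤ κ) :
    normSq ((1 - τ : ℝ) * a + (τ : ℝ) * b) ≤ 1 - 2 * τ * (1 - τ) * (1 - κ) := by
  rw [normSq_apply] at *
  simp only [mul_re, mul_im, add_re, add_im, ofReal_re, ofReal_im, conj_re, conj_im] at *
  have := mul_nonneg (sq_nonneg (1 - τ)) (sub_nonneg.2 ha)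
  have := mul_nonneg (sq_nonneg τ) (sub_nonneg.2 hb)
  have := mul_nonneg (mul_nonneg h0 (sub_nonneg.2 h1)) (sub_nonneg.2 hab)
  nlinarith

/-- Both sides are affine functions of the level. They are weakly ordered at level `0`, and strictly
at level `τ`, where the modulus bounds the real part; so they are strictly ordered on `(0, τ]`. -/
lemma re_combination_lt {a b w : ℂ} {τ p0 p1 : ℝ} (hw : normSq w = 1) (ht : 0 < t) (htτ : t ≤ τ)
    (h0 : (w * a).re ≤ p0) (hp : 0 ≤ (1 - τ) * p0 + τ * p1)
    (h1 : normSq ((1 - τ : ℝ) * a + (τ : ℝ) * b) < ((1 - τ) * p0 + τ * p1) ^ 2) :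
    (w * ((1 - t : ℝ) * a + (t : ℝ) * b)).re < (1 - t) * p0 + t * p1 := by
  have hτ : 0 < τ := ht.trans_le htτ
  have h2 : (w * ((1 - τ : ℝ) * a + (τ : ℝ) * b)).re < (1 - τ) * p0 + τ * p1 := by
    apply lt_of_pow_lt_pow_left₀ 2 hp
    refine lt_of_le_of_lt ?_ h1
    have e : ∀ v, normSq v = normSq (w * v) := fun v => by rw [map_mul, hw, one_mul]
    rw [e, normSq_apply]
    nlinarith [mul_self_nonneg (w * ((1 - τ : ℝ) * a + (τ : ℝ) * b)).im]
  have key : ∀ σ : ℝ, (w * ((1 - σ : ℝ) * a + (σ : ℝ) * b)).re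
      = (1 - σ) * (w * a).re + σ * (w * b).re := by
    intro σ
    simp only [mul_re, mul_im, add_re, add_im, ofReal_re, ofReal_im]
    ring
  rw [key] at h2 ⊢
  have h3 : 0 ≤ (τ - t) * (p0 - (w * a).re) := mul_nonneg (by linarith) (by linarith)
  have h4 := mul_pos ht (sub_pos.2 h2)
  nlinarith

lemma sub_sq_le_of_abs_le {u v p q r : ℝ} (hu : |u| ≤ q) (hv : |v| = p) (hqp : q ≤ p)
    (hr : r = u + v) : (q - p) ^ 2 ≤ r ^ 2 := by
  rw [← sq_abs r, ← neg_sq, neg_sub]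
  apply pow_le_pow_left₀ (by linarith)
  have := abs_sub_abs_le_abs_sub v (-u)
  rw [abs_neg, sub_neg_eq_add, add_comm v u, ← hr] at this
  linarith

/-- The section of the inner ploid does not meet the one of the outer ploid, in the lower half. -/
lemma edgePoint_disjoint_of_le_half {φ' : ℝ} (d : ℤ) (hd : φ = φ' + 2 * al * d) (h3 : 3 * al < φ)
    (hφ : φ < Real.pi - al) (hφ' : |φ'| + 2 * al < φ) (ht0 : 0 < t) (ht : t ≤ 1 / 2) {z : ℂ}
    (hz : IsEdgePoint φ φ t z) (hz' : IsEdgePoint φ φ' t z) : False := by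
  have hal := al_pos
  have hpi := nineteen_al
  have hs := sin_al_pos
  have hc := cos_al_pos
  have habs := abs_nonneg φ'
  obtain ⟨a, b, hzab, hside, hna, hnb, hab⟩ := hz.exists_combination
    (Real.sin_nonneg_of_nonneg_of_le_pi (by linarith) (by linarith))
  have hsideβ : ∀ k : ℤ, (cis (-(2 * al * k + al)) * a).re ≤ Real.cos al := fun k => by
    refine hside.re_le fun j => ?_
    rw [← Real.cos_neg al]
    refine le_trans (le_of_eq ?_) (cos_add_two_al_mul_le (χ := -al) (by rw [abs_neg,
        abs_of_pos hal])
      (j - k))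
    congr 1; push_cast; ring
  have hR := fun {τ : ℝ} (h0 : 0 ≤ τ) (h1 : τ ≤ 1) => normSq_combination_le h0 h1 hna hnb hab
  have hcisN : ∀ x, normSq (cis x) = 1 := normSq_cis
  obtain ⟨k, s, hsa, hz'⟩ := hz'
  have hs2 := abs_le.1 hsa
  have hA : z = cis (2 * al * k + al) * zA φ' t s →
      (cis (-(2 * al * k + al)) * z).re = (1 - t) * Real.cos al + t * Real.cos φ' := by
    rintro rfl
    rw [← mul_assoc, ← cis_add, neg_add_cancel, cis_zero, one_mul]
    rfl
  have hB : z = cis (2 * al * k + φ) * zB φ' t s →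
      (cis (-(2 * al * k + φ)) * z).re = (1 - t) * Real.cos φ' + t * Real.cos al := by
    rintro rfl
    rw [← mul_assoc, ← cis_add, neg_add_cancel, cis_zero, one_mul]
    simp only [zB]; ring
  -- For a small outer twist, the line of an outer edge leaves the lower polygon on one side at
  -- level `0`, and at level `1 / 2` it avoids a disc that contains the inner section.
  -- `re_combination_lt` interpolates.
  rcases le_total |φ'| al with hsmall | hlarge
  · have hC : Real.cos al ≤ Real.cos φ' := by
      rw [← Real.cos_abs φ']
      exact Real.cos_le_cos_of_nonneg_of_le_pi habs (by linarith) hsmall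
    have h2 : Real.cos (φ - al) < Real.cos (2 * al) :=
      Real.cos_lt_cos_of_nonneg_of_le_pi (by linarith) (by linarith) (by linarith)
    rw [Real.cos_two_mul] at h2
    have hhalf := hR (τ := 1 / 2) (by norm_num) (by norm_num)
    rcases hz' with h | h
    · have := re_combination_lt (hcisN (-(2 * al * k + al))) ht0 ht (hsideβ k)
        (p1 := Real.cos φ') (by nlinarith) (lt_of_le_of_lt hhalf (by nlinarith))
      rw [← hzab, hA h] at this
      exact lt_irrefl _ this
    · have hγ : (cis (-(2 * al * k + φ)) * a).re ≤ Real.cos φ' := by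
        refine hside.re_le fun j => ?_
        refine le_trans (le_of_eq ?_) (cos_add_two_al_mul_le hsmall (d + k - j))
        rw [← Real.cos_neg, hd]
        congr 1; push_cast; ring
      have := re_combination_lt (hcisN (-(2 * al * k + φ))) ht0 ht hγ
        (p1 := Real.cos al) (by nlinarith) (lt_of_le_of_lt hhalf (by nlinarith))
      rw [← hzab, hB h] at this
      exact lt_irrefl _ this
  · obtain ⟨S, hS⟩ : ∃ S, S = Real.sin |φ'| := ⟨_, rfl⟩
    have hSs : Real.sin al ≤ S := by
      rw [hS]
      rcases le_total |φ'| (Real.pi / 2) with h2 | h2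
      · exact Real.sin_le_sin_of_le_of_le_pi_div_two (by linarith) h2 hlarge
      · rw [← Real.sin_pi_sub |φ'|]
        exact Real.sin_le_sin_of_le_of_le_pi_div_two (by linarith) (by linarith) (by linarith)
    have hSa : |Real.sin φ'| = S := by
      rw [hS]
      rcases abs_choice φ' with h | h
      · rw [h, abs_of_nonneg]; rw [h] at hS; linarith
      · rw [h, Real.sin_neg, abs_of_nonpos]; rw [h, Real.sin_neg] at hS; linarith
    have hSabs : S ^ 2 = Real.sin φ' ^ 2 := by rw [← hSa, sq_abs]
    have hSC := Real.sin_sq_add_cos_sq φ'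
    have hsc := Real.sin_sq_add_cos_sq al
    -- At a given level the corners of the outer section are farther from the axis than the bound
    -- for the inner section, because `|φ'| + al < φ - al`.
    have hκ : Real.cos (φ - al) < Real.cos φ' * Real.cos al - S * Real.sin al := by
      rw [← Real.cos_abs φ', hS, ← Real.cos_add]
      exact Real.cos_lt_cos_of_nonneg_of_le_pi (by linarith) (by linarith) (by linarith)
    have hRt := hR ht0.le (by linarith)
    rw [← hzab] at hRt
    have hlt : ∀ τ : ℝ, 0 < τ → τ < 1 → 1 - 2 * τ * (1 - τ) * (1 - Real.cos (φ - al)) <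
        1 - 2 * τ * (1 - τ) * (1 - (Real.cos φ' * Real.cos al - S * Real.sin al)) := by
      intro τ h0 h1
      have := mul_pos (mul_pos h0 (sub_pos.2 h1)) (sub_pos.2 hκ)
      nlinarith
    have hfar := lt_of_le_of_lt hRt (hlt t ht0 (by linarith))
    have habs_t : |t * s| ≤ t * Real.sin al := by
      rw [abs_mul, abs_of_pos ht0]; exact mul_le_mul_of_nonneg_left hsa ht0.le
    have habs_t' : |(1 - t) * s| ≤ (1 - t) * Real.sin al := by
      rw [abs_mul, abs_of_pos (by linarith)]; exact mul_le_mul_of_nonneg_left hsa (by linarith)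
    rcases hz' with h | h
    -- If the foot of the perpendicular from the axis to the line of the outer edge is not interior
    -- to the edge, the nearest point of the edge is a corner, and distances to the axis are
    -- compared directly.
    · rcases le_total ((1 - t) * Real.sin al) (t * S) with hfoot | hfoot
      · have hn : normSq z = normSq (zA φ' t s) := by rw [h, map_mul, hcisN, one_mul]
        have := sub_sq_le_of_abs_le (v := t * Real.sin φ') habs_t'
          (by rw [abs_mul, abs_of_pos ht0, hSa]) hfoot rfl
        rw [hn, normSq_apply] at hfar
        simp only [zA] at hfar
        have e : 1 - 2 * t * (1 - t) * (1 - (Real.cos φ' * Real.cos al - S * Real.sin al)) =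
            ((1 - t) * Real.cos al + t * Real.cos φ') ^ 2
              + ((1 - t) * Real.sin al - t * S) ^ 2 := by
          linear_combination -(1 - t) ^ 2 * hsc - t ^ 2 * hSC - t ^ 2 * hSabs
        linarith
      -- The level at which the foot reaches the corner. There the line is as far from the axis as
      -- the corner, and `re_combination_lt` carries the comparison down to `t`.
      · obtain ⟨τ, hτ⟩ : ∃ τ, τ = Real.sin al / (Real.sin al + S) := ⟨_, rfl⟩
        have hpos : 0 < Real.sin al + S := by linarith
        have hτ0 : 0 < τ := by rw [hτ]; positivity
        have hτe : (1 - τ) * Real.sin al = τ * S := by rw [hτ]; field_simp; ring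
        have hτ1 : τ < 1 := by rw [hτ, div_lt_one hpos]; linarith
        have htτ : t ≤ τ := by rw [hτ, le_div_iff₀ hpos]; linarith
        have hsq : 1 - 2 * τ * (1 - τ) * (1 - (Real.cos φ' * Real.cos al - S * Real.sin al)) =
            ((1 - τ) * Real.cos al + τ * Real.cos φ') ^ 2 := by
          linear_combination ((1 - τ) * Real.sin al - τ * S) * hτe - (1 - τ) ^ 2 * hsc
            - τ ^ 2 * hSC - τ ^ 2 * hSabs
        have hp : 0 ≤ (1 - τ) * Real.cos al + τ * Real.cos φ' := by
          have h5 : 0 < S * Real.cos al + Real.cos φ' * Real.sin al := by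
            rw [← Real.cos_abs φ', hS, ← Real.sin_add]
            exact Real.sin_pos_of_pos_of_lt_pi (by linarith) (by linarith)
          have h6 : ((1 - τ) * Real.cos al + τ * Real.cos φ') * Real.sin al =
              τ * (S * Real.cos al + Real.cos φ' * Real.sin al) := by
            linear_combination Real.cos al * hτe
          have h7 : 0 < ((1 - τ) * Real.cos al + τ * Real.cos φ') * Real.sin al := by
            rw [h6]; exact mul_pos hτ0 h5
          exact (pos_of_mul_pos_left h7 hs.le).le
        have := re_combination_lt (hcisN (-(2 * al * k + al))) ht0 htτ (hsideβ k) hp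
          (lt_of_le_of_lt (hR hτ0.le hτ1.le) ((hlt τ hτ0 hτ1).trans_eq hsq))
        rw [← hzab, hA h] at this
        exact lt_irrefl _ this
    -- For `t ≤ 1 / 2`, the inequality `sin al ≤ S` keeps the foot away from the interior of every
    -- `B`-edge.
    · have hn : normSq z = normSq (zB φ' t s) := by rw [h, map_mul, hcisN, one_mul]
      have := sub_sq_le_of_abs_le (v := -((1 - t) * Real.sin φ')) habs_t
        (by rw [abs_neg, abs_mul, abs_of_pos (by linarith : 0 < 1 - t), hSa])
        (mul_le_mul (by linarith) hSs hs.le (by linarith)) rfl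
      rw [hn, normSq_apply] at hfar
      simp only [zB] at hfar
      have e : 1 - 2 * t * (1 - t) * (1 - (Real.cos φ' * Real.cos al - S * Real.sin al)) =
          (t * Real.cos al + (1 - t) * Real.cos φ') ^ 2
            + (t * Real.sin al - (1 - t) * S) ^ 2 := by
        linear_combination -t ^ 2 * hsc - (1 - t) ^ 2 * hSC - (1 - t) ^ 2 * hSabs
      linarith

/-- The section of the inner ploid does not meet the one of the outer ploid. -/
lemma sec_ne_sec {φ' : ℝ} (d : ℤ) (hd : φ = φ' + 2 * al * d) (h3 : 3 * al < φ)
    (hφ : φ < Real.pi - al) (hφ' : |φ'| + 2 * al < φ) (ht0 : 0 < t) (ht1 : t < 1) (x y : ℝ) :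
    sec φ t x ≠ sec φ' t y := by
  intro h
  have h1 := isEdgePoint_sec φ 0 ht0 ht1 x
  have h2 := isEdgePoint_sec φ' d ht0 ht1 y
  rw [← hd, ← h] at h2
  rw [Int.cast_zero, mul_zero, add_zero] at h1
  rcases le_total t (1 / 2) with ht | ht
  · exact edgePoint_disjoint_of_le_half d hd h3 hφ hφ' ht0 ht h1 h2
  · exact edgePoint_disjoint_of_le_half d hd h3 hφ hφ' (by linarith) (by linarith)
      h1.reflect h2.reflect

end FlatTori
end

/-! ### Length metric of a piecewise isometric surface -/

noncomputable section
namespace FlatTori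
open Set

/-- If finitely many closed sets cover an interval and `g` does not expand more than `f` on each of
them, then `f` is at least as long as the distance of the end points of `g`. -/
lemma edist_le_eVariationOn_of_cover {E E' : Type*} [PseudoEMetricSpace E] [PseudoEMetricSpace E']
    (f : ℝ → E) (g : ℝ → E') {ι : Type*} [DecidableEq ι] (S : ι → Set ℝ) (hS : ∀ i,
        IsClosed (S i)) (b : ℝ)
    (J : Finset ι) : ∀ a : ℝ, a ≤ b → Icc a b ⊆ ⋃ i ∈ J, S i →
      (∀ i ∈ J, ∀ s ∈ S i ∩ Icc a b, ∀ t ∈ S i ∩ Icc a b, edist (g s) (g t) ≤ edist (f s) (f t)) →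
      edist (g a) (g b) ≤ eVariationOn f (Icc a b) := by
  induction J using Finset.strongInduction with
  | H J ih =>
    intro a hab hcov hle
    obtain ⟨i, hi, hai⟩ : ∃ i ∈ J, a ∈ S i := by simpa using hcov (left_mem_Icc.2 hab)
    have hK : IsCompact (S i ∩ Icc a b) := isCompact_Icc.inter_left (hS i)
    have hne : (S i ∩ Icc a b).Nonempty := ⟨a, hai, left_mem_Icc.2 hab⟩
    -- The last time spent in `S i`. After it the other sets cover, and being closed they also cover
    -- `c`, so the induction continues on `[c, b]` with `i` erased.
    obtain ⟨c, hc⟩ : ∃ c, c = sSup (S i ∩ Icc a b) := ⟨_, rfl⟩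
    have hcm : c ∈ S i ∩ Icc a b := hc ▸ hK.sSup_mem hne
    have h1 : edist (g a) (g c) ≤ eVariationOn f (Icc a c) :=
      (hle i hi a ⟨hai, left_mem_Icc.2 hab⟩ c hcm).trans
        (eVariationOn.edist_le f (left_mem_Icc.2 hcm.2.1) (right_mem_Icc.2 hcm.2.1))
    have h2 : edist (g c) (g b) ≤ eVariationOn f (Icc c b) := by
      rcases hcm.2.2.eq_or_lt with h | h
      · rw [h, edist_self]; exact zero_le
      · refine ih (J.erase i) (Finset.erase_ssubset hi) c hcm.2.2 ?_ ?_
        · rw [← closure_Ioc h.ne]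
          refine closure_minimal ?_ (isClosed_biUnion_finset fun j _ => hS j)
          intro t ht
          obtain ⟨j, hj, htj⟩ : ∃ j ∈ J, t ∈ S j := by
            simpa using hcov ⟨hcm.2.1.trans ht.1.le, ht.2⟩
          refine mem_biUnion (Finset.mem_coe.2 (Finset.mem_erase.2 ⟨?_, hj⟩)) htj
          rintro rfl
          have := le_csSup hK.bddAbove ⟨htj, hcm.2.1.trans ht.1.le, ht.2⟩
          rw [← hc] at this
          exact absurd ht.1 (not_lt.2 this)
        · intro j hj s hs t ht
          exact hle j (Finset.mem_of_mem_erase hj) s ⟨hs.1, hcm.2.1.trans hs.2.1, hs.2.2⟩ t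
            ⟨ht.1, hcm.2.1.trans ht.2.1, ht.2.2⟩
    calc edist (g a) (g b) ≤ edist (g a) (g c) + edist (g c) (g b) := edist_triangle _ _ _
      _ ≤ _ := add_le_add h1 h2
      _ = _ := by
        have := eVariationOn.Icc_add_Icc f (s := univ) hcm.2.1 hcm.2.2 (mem_univ c)
        simpa using this

variable {τ : ℂ} {F : ℂ → E3} {G : ℂ → ℂ} {ι : Type} {T : ι → Set ℂ}

/-- The straight segment of the plane, rolled onto the surface, is a path of the right length. It
crosses finitely many closed pieces on which `f` is isometric, so its image is Lipschitz with
constant `dist a b`. -/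
lemma lengthDist_le_norm_sub {f : ℂ → E3} (hf : ∀ z, f (G z) = F z)
    (hiso : ∀ i, ∀ z ∈ T i, ∀ z' ∈ T i, dist (F z) (F z') = dist (G z) (G z'))
    (hGclosed : ∀ i, IsClosed (G '' T i)) (hGs : Function.Surjective G)
    (hfin : ∀ R : ℝ, ∃ J : Finset ι, ∀ z, ‖G z‖ ≤ R → ∃ i ∈ J, z ∈ T i) (a b : ℂ) :
    lengthDist (range F) (f a) (f b) ≤ edist a b := by
  classical
  obtain ⟨c, hc⟩ : ∃ c : ℝ → ℂ, c = fun t : ℝ => AffineMap.lineMap a b t := ⟨_, rfl⟩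
  have hcc : Continuous c := by rw [hc]; exact AffineMap.lineMap_continuous
  have hcd : ∀ s t, edist (c s) (c t) = ENNReal.ofReal (|s - t| * dist a b) := by
    intro s t
    rw [hc, edist_dist]
    simp only [dist_lineMap_lineMap, Real.dist_eq]
  obtain ⟨R, hR⟩ : ∃ R : ℝ, ∀ t ∈ Icc (0 : ℝ) 1, ‖c t‖ ≤ R :=
    isCompact_Icc.exists_bound_of_continuousOn hcc.continuousOn
  obtain ⟨J, hJ⟩ := hfin R
  have hle : ∀ s ∈ Icc (0 : ℝ) 1, ∀ t ∈ Icc (0 : ℝ) 1, s ≤ t →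
      edist (f (c s)) (f (c t)) ≤ ENNReal.ofReal (dist a b) * edist s t := by
    intro s hs t ht hst
    have hmono : MonotoneOn (fun u : ℝ => u * dist a b) univ := fun x _ y _ hxy =>
      mul_le_mul_of_nonneg_right hxy dist_nonneg
    have h1 := edist_le_eVariationOn_of_cover (fun u : ℝ => u * dist a b) (fun u => f (c u))
      (fun i => c ⁻¹' (G '' T i)) (fun i => (hGclosed i).preimage hcc) t J s hst ?_ ?_
    · have h2 := hmono.eVariationOn_eq (mem_univ s) (mem_univ t)
      rw [univ_inter] at h2
      rw [h2] at h1
      refine h1.trans (le_of_eq ?_)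
      rw [edist_dist s t, ← ENNReal.ofReal_mul dist_nonneg, Real.dist_eq, abs_sub_comm,
        abs_of_nonneg (by linarith)]
      congr 1; ring
    · intro u hu
      obtain ⟨z, hz⟩ := hGs (c u)
      obtain ⟨i, hi, hzi⟩ := hJ z (hz ▸ hR u ⟨hs.1.trans hu.1, hu.2.trans ht.2⟩)
      exact mem_biUnion (Finset.mem_coe.2 hi) ⟨z, hzi, hz⟩
    · rintro i - u ⟨⟨z, hz, hzu⟩, -⟩ v ⟨⟨z', hz', hzv⟩, -⟩
      rw [← hzu, ← hzv, hf, hf, edist_dist, hiso i z hz z' hz', ← edist_dist, hzu, hzv, hcd,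
        edist_dist, Real.dist_eq, ← sub_mul, abs_mul, abs_of_nonneg (dist_nonneg (x := a))]
  have hlip : LipschitzOnWith (nndist a b) (fun t => f (c t)) (Icc 0 1) := by
    intro s hs t ht
    have e : ((nndist a b : NNReal) : ENNReal) = ENNReal.ofReal (dist a b) := by
      rw [← edist_nndist, edist_dist]
    rw [e]
    rcases le_total s t with h | h
    · exact hle s hs t ht h
    · rw [edist_comm, edist_comm s t]; exact hle t ht s hs h
  have hvar : eVariationOn (fun t => f (c t)) (Icc 0 1) ≤ edist a b := by
    have h1 := hlip.comp_eVariationOn_le (g := id) (s := Icc (0 : ℝ) 1) (fun x hx => hx)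
    have h2 := (monotoneOn_id (s := (univ : Set ℝ))).eVariationOn_eq (mem_univ 0) (mem_univ 1)
    rw [univ_inter] at h2
    rw [h2, ← edist_nndist] at h1
    simpa using h1
  have hmem : ∀ w, f w ∈ range F := fun w => by
    obtain ⟨z, rfl⟩ := hGs w
    exact ⟨z, (hf z).symm⟩
  refine iInf₂_le_of_le (fun t => f (c t)) ⟨hlip.continuousOn, fun t _ => hmem _, ?_, ?_⟩ hvar
  · simp [hc]
  · simp [hc]

/-- A map `F` from the plane to space, isometric on each piece of a locally finite closed cover when
the plane is developed by `G`, and injective modulo the lattice, realizes the flat torus. -/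
theorem isIsometricToFlatTorus_range (hGs : Function.Surjective G)
    (hF : ∀ z z', F z = F z' ↔ G z - G z' ∈ lattice 1 τ)
    (hiso : ∀ i, ∀ z ∈ T i, ∀ z' ∈ T i, dist (F z) (F z') = dist (G z) (G z'))
    (hGclosed : ∀ i, IsClosed (G '' T i)) (hFclosed : ∀ i, IsClosed (F '' T i))
    (hfin : ∀ R : ℝ, ∃ J : Finset ι, ∀ z, ‖G z‖ ≤ R → ∃ i ∈ J, z ∈ T i)
    (hJ : ∃ J : Finset ι, ∀ z, ∃ i ∈ J, ∃ z' ∈ T i, F z' = F z) :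
    IsIsometricToFlatTorus (range F) τ := by
  classical
  obtain ⟨G', hG'⟩ := hGs.hasRightInverse
  have hfG : ∀ z, F (G' (G z)) = F z := fun z => by
    rw [hF, hG' (G z), sub_self]; exact zero_mem _
  have hmk : ∀ a b : ℂ, (a : FlatTorus τ) = b ↔ F (G' a) = F (G' b) := fun a b => by
    rw [hF, hG' a, hG' b, QuotientAddGroup.eq, ← neg_mem_iff]
    congr! 1; ring
  let f : FlatTorus τ → range F := Quotient.lift (fun w : ℂ => ⟨F (G' w), mem_range_self _⟩)
    (fun a b hab => Subtype.ext ((hmk a b).1 (Quotient.sound hab)))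
  have hfmk : ∀ w : ℂ, (f (w : FlatTorus τ) : E3) = F (G' w) := fun w => rfl
  have hbij : Function.Bijective f := by
    constructor
    · intro x y hxy
      obtain ⟨a, rfl⟩ := QuotientAddGroup.mk_surjective x
      obtain ⟨b, rfl⟩ := QuotientAddGroup.mk_surjective y
      rw [hmk, ← hfmk, ← hfmk, hxy]
    · rintro ⟨_, z, rfl⟩
      exact ⟨(G z : FlatTorus τ), Subtype.ext (hfG z)⟩
  refine ⟨Equiv.ofBijective f hbij, fun x y => le_antisymm ?_ ?_⟩
  -- Upper bound: lifts of the two points are chosen whose difference realizes the quotient norm up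
  -- to `ε`, and the segment between them is rolled onto the surface.
  · refine ENNReal.le_of_forall_pos_le_add fun ε hε _ => ?_
    obtain ⟨m, hm, hmε⟩ := QuotientAddGroup.exists_norm_mk_lt (x - y)
      (ε := (ε : ℝ)) (NNReal.coe_pos.2 hε)
    obtain ⟨b, rfl⟩ := QuotientAddGroup.mk_surjective y
    obtain rfl : x = ((m + b : ℂ) : FlatTorus τ) := by
      rw [QuotientAddGroup.mk_add, hm]; abel
    simp only [Equiv.ofBijective_apply]
    rw [hfmk, hfmk]
    refine (lengthDist_le_norm_sub (f := fun w => F (G' w)) hfG hiso hGclosed hGs hfin _ _).trans ?_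
    rw [edist_dist, edist_dist, dist_eq_norm, dist_eq_norm, add_sub_cancel_right,
      ← ENNReal.ofReal_coe_nnreal]
    exact (ENNReal.ofReal_le_ofReal hmε.le).trans ENNReal.ofReal_add_le
  -- Lower bound: a path of the surface is read in the torus as `g`. On each piece `g` does not
  -- expand `γ`, since the quotient map is 1-Lipschitz; continuity of `g` plays no role.
  · refine le_iInf₂ fun γ hγ => ?_
    obtain ⟨hcont, hmaps, h0, h1⟩ := hγ
    obtain ⟨J, hJ⟩ := hJ
    obtain ⟨g, hg⟩ : ∃ g : ℝ → FlatTorus τ, ∀ t ∈ Icc (0 : ℝ) 1, (f (g t) : E3) = γ t := by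
      have : ∀ t : ℝ, ∃ x : FlatTorus τ, t ∈ Icc (0 : ℝ) 1 → (f x : E3) = γ t := fun t => by
        by_cases ht : t ∈ Icc (0 : ℝ) 1
        · obtain ⟨x, hx⟩ := hbij.2 ⟨γ t, hmaps ht⟩
          exact ⟨x, fun _ => by rw [hx]⟩
        · exact ⟨0, fun h => absurd h ht⟩
      choose g hg using this
      exact ⟨g, hg⟩
    have hginv : ∀ t ∈ Icc (0 : ℝ) 1, ∀ z, γ t = F z → g t = (G z : FlatTorus τ) := by
      intro t ht z hz
      apply hbij.1
      apply Subtype.ext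
      rw [hg t ht, hz, hfmk, hfG]
    have hgx : g 0 = x := hbij.1 (Subtype.ext (by rw [hg 0 (by simp), h0]; rfl))
    have hgy : g 1 = y := hbij.1 (Subtype.ext (by rw [hg 1 (by simp), h1]; rfl))
    rw [← hgx, ← hgy]
    refine edist_le_eVariationOn_of_cover γ g (fun i => Icc 0 1 ∩ γ ⁻¹' (F '' T i))
      (fun i => hcont.preimage_isClosed_of_isClosed isClosed_Icc (hFclosed i)) 1 J 0 zero_le_one
      ?_ ?_
    · intro t ht
      obtain ⟨z, hz⟩ := hmaps ht
      obtain ⟨i, hi, z', hz', e⟩ := hJ z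
      exact mem_biUnion (Finset.mem_coe.2 hi) ⟨ht, z', hz', e.trans hz⟩
    · rintro i - s ⟨⟨hs, z, hz, hzs⟩, -⟩ t ⟨⟨ht, z', hz', hzt⟩, -⟩
      rw [hginv s hs z hzs.symm, hginv t ht z' hzt.symm, ← hzs, ← hzt, edist_dist, edist_dist,
        hiso i z hz z' hz']
      apply ENNReal.ofReal_le_ofReal
      rw [dist_eq_norm, dist_eq_norm, ← QuotientAddGroup.mk_sub]
      exact QuotientAddGroup.norm_mk_le_norm

end FlatTori
end

/-! ### Tiles, reduction modulo the periods, and seams of the sections -/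

noncomputable section
namespace FlatTori
open Set

section Triangles

lemma mem_triangle_iff {a b c z : ℂ} : z ∈ triangle a b c ↔
    ∃ x y w : ℝ, 0 ≤ x ∧ 0 ≤ y ∧ 0 ≤ w ∧ x + y + w = 1 ∧ z = x * a + y * b + w * c := by
  constructor
  · intro h
    refine convexHull_min (t := {z : ℂ | ∃ x y w : ℝ, 0 ≤ x ∧ 0 ≤ y ∧ 0 ≤ w ∧ x + y + w = 1 ∧
      z = x * a + y * b + w * c}) ?_ ?_ h
    · rintro z (rfl | rfl | rfl)
      · exact ⟨1, 0, 0, by simp⟩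
      · exact ⟨0, 1, 0, by simp⟩
      · exact ⟨0, 0, 1, by simp⟩
    · rintro _ ⟨x, y, w, hx, hy, hw, h1, rfl⟩ _ ⟨x', y', w', hx', hy', hw', h1', rfl⟩ s t hs ht hst
      refine ⟨s * x + t * x', s * y + t * y', s * w + t * w', by positivity, by positivity,
        by positivity, ?_, ?_⟩
      · linear_combination s * h1 + t * h1' + hst
      · simp only [Complex.real_smul]; push_cast; ring
  · rintro ⟨x, y, w, hx, hy, hw, h1, rfl⟩
    have hc := convex_convexHull ℝ ({a, b, c} : Set ℂ)
    have ha : a ∈ convexHull ℝ ({a, b, c} : Set ℂ) := subset_convexHull ℝ _ (by simp)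
    have hb : b ∈ convexHull ℝ ({a, b, c} : Set ℂ) := subset_convexHull ℝ _ (by simp)
    have hcc : c ∈ convexHull ℝ ({a, b, c} : Set ℂ) := subset_convexHull ℝ _ (by simp)
    have := hc.sum_mem (t := Finset.univ) (w := ![x, y, w]) (z := ![a, b, c]) ?_ ?_ ?_
    · simpa [Fin.sum_univ_three, triangle] using this
    · intro i _; fin_cases i <;> assumption
    · simpa [Fin.sum_univ_three] using h1
    · intro i _; fin_cases i <;> assumption

lemma isCompact_triangle (a b c : ℂ) : IsCompact (triangle a b c) :=
  (Set.toFinite _).isCompact_convexHull (𝕜 := ℝ)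

/-- The four families of triangles of a diplotorus triangulation. -/
def tile (d : ℤ) (i : Fin 4) (k : ℤ) : Set ℂ :=
  ![triangle (ptA k) (ptA (k + 1)) (ptB k), triangle (ptB k) (ptA (k + 1)) (ptB (k + 1)),
    triangle (ptC k) (ptC (k + 1)) (ptB (k - d)),
    triangle (ptB (k - d)) (ptC (k + 1)) (ptB (k + 1 - d))] i

lemma exists_eq_tile {d : ℤ} {t : Set ℂ} (h : t ∈ diplotorusTriangles d) :
    ∃ i k, t = tile d i k := by
  obtain ⟨k, h | h | h | h⟩ := h
  · exact ⟨0, k, h⟩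
  · exact ⟨1, k, h⟩
  · exact ⟨2, k, h⟩
  · exact ⟨3, k, h⟩

lemma isCompact_tile (d : ℤ) (i : Fin 4) (k : ℤ) : IsCompact (tile d i k) := by
  fin_cases i <;> exact isCompact_triangle _ _ _

lemma mem_tile_zero {d k : ℤ} {z : ℂ} : z ∈ tile d 0 k ↔
    -1 ≤ z.im ∧ z.im ≤ 0 ∧ k ≤ z.re ∧ z.re ≤ k - z.im := by
  change z ∈ triangle _ _ _ ↔ _
  rw [mem_triangle_iff]
  constructor
  · rintro ⟨x, y, w, hx, hy, hw, h1, rfl⟩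
    simp [ptA, ptB]
    obtain rfl : x = 1 - y - w := by linarith
    refine ⟨?_, ?_, ?_, ?_⟩ <;> nlinarith
  · rintro ⟨h1, h2, h3, h4⟩
    refine ⟨-z.im - (z.re - k), z.re - k, 1 + z.im, by linarith, by linarith, by linarith,
      by ring, ?_⟩
    apply Complex.ext <;> simp [ptA, ptB] <;> ring

lemma mem_tile_one {d k : ℤ} {z : ℂ} : z ∈ tile d 1 k ↔
    -1 ≤ z.im ∧ z.im ≤ 0 ∧ k - z.im ≤ z.re ∧ z.re ≤ k + 1 := by
  change z ∈ triangle _ _ _ ↔ _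
  rw [mem_triangle_iff]
  constructor
  · rintro ⟨x, y, w, hx, hy, hw, h1, rfl⟩
    simp [ptA, ptB]
    obtain rfl : x = 1 - y - w := by linarith
    refine ⟨?_, ?_, ?_, ?_⟩ <;> nlinarith
  · rintro ⟨h1, h2, h3, h4⟩
    refine ⟨1 - (z.re - k), -z.im, z.re - k + z.im, by linarith, by linarith, by linarith,
      by ring, ?_⟩
    apply Complex.ext <;> simp [ptA, ptB] <;> ring

/-- The shear `z.re + (1 - z.im) * d` fixes the upper boundary and sends `B_{k-d}` to abscissa `k`.
In these coordinates the external ploid has the same pattern as the internal one. -/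
lemma mem_tile_two {d k : ℤ} {z : ℂ} : z ∈ tile d 2 k ↔
    0 ≤ z.im ∧ z.im ≤ 1 ∧ k ≤ z.re + (1 - z.im) * d ∧ z.re + (1 - z.im) * d ≤ k + z.im := by
  change z ∈ triangle _ _ _ ↔ _
  rw [mem_triangle_iff]
  constructor
  · rintro ⟨x, y, w, hx, hy, hw, h1, rfl⟩
    simp [ptC, ptB]
    obtain rfl : x = 1 - y - w := by linarith
    refine ⟨?_, ?_, ?_, ?_⟩ <;> nlinarith
  · rintro ⟨h1, h2, h3, h4⟩
    refine ⟨z.im - (z.re + (1 - z.im) * d - k), z.re + (1 - z.im) * d - k, 1 - z.im, by linarith,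
      by linarith, by linarith, by ring, ?_⟩
    apply Complex.ext <;> simp [ptC, ptB] <;> ring

lemma mem_tile_three {d k : ℤ} {z : ℂ} : z ∈ tile d 3 k ↔
    0 ≤ z.im ∧ z.im ≤ 1 ∧ k + z.im ≤ z.re + (1 - z.im) * d ∧ z.re + (1 - z.im) * d ≤ k + 1 := by
  change z ∈ triangle _ _ _ ↔ _
  rw [mem_triangle_iff]
  constructor
  · rintro ⟨x, y, w, hx, hy, hw, h1, rfl⟩
    simp [ptC, ptB]
    obtain rfl : x = 1 - y - w := by linarith
    refine ⟨?_, ?_, ?_, ?_⟩ <;> nlinarith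
  · rintro ⟨h1, h2, h3, h4⟩
    refine ⟨1 - (z.re + (1 - z.im) * d - k), z.im, z.re + (1 - z.im) * d - k - z.im, by linarith,
      by linarith, by linarith, by ring, ?_⟩
    apply Complex.ext <;> simp [ptC, ptB] <;> ring

lemma mem_lattice_iff {a b z : ℂ} : z ∈ lattice a b ↔ ∃ m n : ℤ, z = m * a + n * b := by
  unfold lattice
  rw [AddSubgroup.mem_closure_pair]
  constructor
  · rintro ⟨m, n, rfl⟩; exact ⟨m, n, by simp⟩
  · rintro ⟨m, n, rfl⟩; exact ⟨m, n, by simp⟩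

end Triangles

section Reduction

/-- The representative of an ordinate in `[-1, 1)`, modulo `2`. -/
def yred (y : ℝ) : ℝ := 2 * Int.fract ((y + 1) / 2) - 1

lemma yred_mem (y : ℝ) : yred y ∈ Ico (-1 : ℝ) 1 := by
  have h1 := Int.fract_nonneg ((y + 1) / 2)
  have h2 := Int.fract_lt_one ((y + 1) / 2)
  constructor <;> unfold yred <;> linarith

lemma yred_add (y : ℝ) : yred y + 2 * ⌊(y + 1) / 2⌋ = y := by
  have := Int.floor_add_fract ((y + 1) / 2)
  unfold yred; linarith

lemma floor_of_mem {y : ℝ} (n : ℤ) (hy : y ∈ Ico (-1 : ℝ) 1) : ⌊(y + 2 * n + 1) / 2⌋ = n := by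
  rw [Int.floor_eq_iff]
  constructor <;> linarith [hy.1, hy.2]

lemma yred_of_mem {y : ℝ} (n : ℤ) (hy : y ∈ Ico (-1 : ℝ) 1) : yred (y + 2 * n) = y := by
  have := yred_add (y + 2 * n)
  rw [floor_of_mem n hy] at this
  linarith

lemma yred_add_two_mul (y : ℝ) (n : ℤ) : yred (y + 2 * n) = yred y := by
  conv_lhs => rw [← yred_add y, add_assoc, ← mul_add, ← Int.cast_add]
  exact yred_of_mem _ (yred_mem y)

lemma floor_add_two_mul (y : ℝ) (n : ℤ) : ⌊(y + 2 * n + 1) / 2⌋ = ⌊(y + 1) / 2⌋ + n := by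
  rw [← Int.floor_add_intCast]; congr 1; ring

end Reduction

lemma sec_zero (φ φ' x : ℝ) : sec φ 0 x = sec φ' 0 x := by
  have : max (Int.fract x - 1) 0 = 0 := max_eq_right (by linarith [Int.fract_lt_one x])
  simp [sec, this]

/-- With `sec_zero`, this glues the two ploids along both polygons: lowering the twist by `2 * al *
d` is compensated by a shift of `d` sides on the upper polygon, and the lower polygon does not see
the twist. -/
lemma sec_one_shift (φ : ℝ) (d : ℤ) (x : ℝ) :
    sec (φ - 2 * al * d) 1 (x + d) = sec φ 1 x := by
  unfold sec
  have h1 : min (Int.fract x) 0 = 0 := min_eq_right (Int.fract_nonneg x)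
  have h2 : max (Int.fract x) 0 = Int.fract x := max_eq_left (Int.fract_nonneg x)
  rw [Int.fract_add_intCast, Int.floor_add_intCast]
  have e1 : cis (2 * al * (⌊x⌋ + d : ℤ)) * cis (φ - 2 * al * d + al)
      = cis (2 * al * ⌊x⌋) * cis (φ + al) := by
    rw [← cis_add, ← cis_add]; congr 1; push_cast; ring
  simp only [sub_self, h1, sub_zero, h2, Complex.ofReal_zero, Complex.ofReal_one, one_mul,
    zero_add]
  linear_combination (1 + (cis (2 * al) - 1) * (Int.fract x : ℝ)) * e1

lemma sec_add_nineteen (φ t x : ℝ) (m : ℤ) : sec φ t (x + 19 * m) = sec φ t x := by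
  have e : x + 19 * (m : ℝ) = x + ((19 * m : ℤ) : ℝ) := by push_cast; ring
  unfold sec
  rw [e, Int.fract_add_intCast, Int.floor_add_intCast]
  have : cis (2 * al * (⌊x⌋ + 19 * m : ℤ)) = cis (2 * al * ⌊x⌋) := by
    rw [← cis_add_int_mul_two_pi (2 * al * ⌊x⌋) m, ← nineteen_al]; congr 1; push_cast; ring
  rw [this]

lemma sec_succ (φ t : ℝ) (k : ℤ) (ht1 : t ≤ 1) :
    sec φ t (k + 1) = cis (2 * al * k) * (cis (2 * al) * ((1 - t : ℝ) + (t : ℝ) * cis (φ + al)))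
        := by
  unfold sec
  have e : (k : ℝ) + 1 = ((k + 1 : ℤ) : ℝ) := by push_cast; ring
  rw [e, Int.fract_intCast, Int.floor_intCast, min_eq_left (by linarith),
      max_eq_right (by linarith),
    ← mul_assoc, ← cis_add]
  simp only [Complex.ofReal_zero, zero_mul, add_zero, mul_zero]
  congr 2; push_cast; ring

/-- The section of a ploid is affine on each triangle of the first kind. -/
lemma sec_eq_of_le {φ t x : ℝ} {k : ℤ} (ht0 : 0 ≤ t) (ht1 : t ≤ 1) (h1 : k ≤ x)
    (h2 : x ≤ k + (1 - t)) : sec φ t x = cis (2 * al * k) *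
      ((1 - t : ℝ) + (t : ℝ) * cis (φ + al) + (cis (2 * al) - 1) * (x - k : ℝ)) := by
  rcases (show x ≤ k + 1 by linarith).eq_or_lt with h | h
  · obtain rfl : t = 0 := by linarith
    rw [h, sec_succ _ _ _ ht1]
    simp
  · have hfl : ⌊x⌋ = k := Int.floor_eq_iff.2 ⟨h1, h⟩
    have hfr : Int.fract x = x - k := by rw [Int.fract, hfl]
    unfold sec
    rw [hfr, hfl, min_eq_left (by linarith), max_eq_right (by linarith)]
    simp

/-- The section of a ploid is affine on each triangle of the second kind. -/
lemma sec_eq_of_ge {φ t x : ℝ} {k : ℤ} (ht1 : t ≤ 1) (h1 : k + (1 - t) ≤ x)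
    (h2 : x ≤ k + 1) : sec φ t x = cis (2 * al * k) *
      (cis (2 * al) * (1 - t : ℝ) + (t : ℝ) * cis (φ + al)
        + (cis (2 * al) - 1) * cis (φ + al) * (x - k - (1 - t) : ℝ)) := by
  rcases h2.eq_or_lt with h | h
  · rw [h, sec_succ _ _ _ ht1]
    push_cast; ring
  · have hfl : ⌊x⌋ = k := Int.floor_eq_iff.2 ⟨by linarith, h⟩
    have hfr : Int.fract x = x - k := by rw [Int.fract, hfl]
    unfold sec
    rw [hfr, hfl, min_eq_right (by linarith), max_eq_left (by linarith)]
    push_cast; ring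

end FlatTori
end

/-! ### Ploids in space and their intrinsic metric -/

noncomputable section
namespace FlatTori
open Set

/-- The point of space above the point `w` of the plane, at height `z`. -/
def toE3 (w : ℂ) (z : ℝ) : E3 := !₂[w.re, w.im, z]

lemma toE3_injective {w w' : ℂ} {z z' : ℝ} (h : toE3 w z = toE3 w' z') : w = w' ∧ z = z' := by
  have h0 := congrFun (congrArg WithLp.ofLp h) 0
  have h1 := congrFun (congrArg WithLp.ofLp h) 1
  have h2 := congrFun (congrArg WithLp.ofLp h) 2
  simp [toE3] at h0 h1 h2
  exact ⟨Complex.ext h0 h1, h2⟩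

lemma toE3_add (w w' : ℂ) (z z' : ℝ) : toE3 (w + w') (z + z') = toE3 w z + toE3 w' z' := by
  ext i; fin_cases i <;> simp [toE3]

lemma toE3_smul (x : ℝ) (w : ℂ) (z : ℝ) : toE3 (x * w) (x * z) = x • toE3 w z := by
  ext i; fin_cases i <;> simp [toE3]

lemma norm_sq_toE3 (w : ℂ) (z : ℝ) : ‖toE3 w z‖ ^ 2 = Complex.normSq w + z ^ 2 := by
  rw [EuclideanSpace.norm_sq_eq, Complex.normSq_apply]
  simp [toE3, Fin.sum_univ_three]; ring

lemma normSq_real_combination (x t : ℝ) (p q : ℂ) :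
    Complex.normSq (x * p + t * q) = x ^ 2 * Complex.normSq p
      + 2 * x * t * (p * (starRingEnd ℂ) q).re + t ^ 2 * Complex.normSq q := by
  simp only [Complex.normSq_apply, Complex.add_re, Complex.add_im, Complex.mul_re, Complex.mul_im,
    Complex.ofReal_re, Complex.ofReal_im, Complex.conj_re, Complex.conj_im]
  ring

lemma normSq_cis_two_al_sub_one : Complex.normSq (cis (2 * al) - 1) = 4 * Real.sin al ^ 2 := by
  simp only [Complex.normSq_apply, Complex.sub_re, Complex.sub_im, cis_re, cis_im, Complex.one_re,
    Complex.one_im, Real.cos_two_mul, Real.sin_two_mul]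
  linear_combination 4 * (Real.cos al ^ 2 - 1) * Real.sin_sq_add_cos_sq al

lemma normSq_cis_add_al_sub_one (φ : ℝ) : Complex.normSq (cis (φ + al) - 1) =
    (Real.sin al + Real.sin φ) ^ 2 + (Real.cos al - Real.cos φ) ^ 2 := by
  simp only [Complex.normSq_apply, Complex.sub_re, Complex.sub_im, cis_re, cis_im, Complex.one_re,
    Complex.one_im]
  linear_combination Real.sin_sq_add_cos_sq (φ + al) - Real.sin_sq_add_cos_sq al
    - Real.sin_sq_add_cos_sq φ - 2 * Real.cos_add φ al

lemma re_cis_two_al_sub_one_mul (φ : ℝ) :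
    ((cis (2 * al) - 1) * (starRingEnd ℂ) (cis (φ + al) - 1)).re =
      2 * Real.sin al * (Real.sin al + Real.sin φ) := by
  simp only [Complex.sub_re, Complex.sub_im, cis_re, cis_im, Complex.one_re, Complex.mul_re,
    Complex.conj_re, Complex.conj_im, Complex.one_im, Real.cos_two_mul, Real.sin_two_mul,
    Real.sin_add, Real.cos_add]
  linear_combination (2 * Real.cos φ * Real.cos al - 2) * Real.sin_sq_add_cos_sq al

section Ploid

variable (φ h : ℝ)

/-- The height of the triangles of a ploid of twist `φ` and height `h`. -/
def triHeight : ℝ := √(h ^ 2 + (Real.cos al - Real.cos φ) ^ 2)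

lemma triHeight_sq : triHeight φ h ^ 2 = h ^ 2 + (Real.cos al - Real.cos φ) ^ 2 :=
  Real.sq_sqrt (by positivity)

lemma triHeight_pos {φ h : ℝ} (hh : 0 < h) : 0 < triHeight φ h := Real.sqrt_pos.2 (by positivity)

/-- The ploid of twist `φ` and height `h`, as a map on the strip. -/
def ploid (t x : ℝ) : E3 := toE3 (sec φ t x) (h * t)

variable {φ h}

/-- The ploid is affine and isometric on the triangles of the first kind. -/
lemma ploid_first (k : ℤ) : ∃ P0 P1 P2 : E3,
    (∀ t x : ℝ, 0 ≤ t → t ≤ 1 → k ≤ x → x ≤ k + (1 - t) → ploid φ h t x = P0 + x • P1 + t • P2) ∧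
    ∀ x t : ℝ, ‖x • P1 + t • P2‖ ^ 2 =
      (x * (2 * Real.sin al) + t * (Real.sin al + Real.sin φ)) ^ 2 + (t * triHeight φ h) ^ 2 := by
  refine ⟨toE3 (cis (2 * al * k) * (1 - (cis (2 * al) - 1) * (k : ℝ))) 0,
    toE3 (cis (2 * al * k) * (cis (2 * al) - 1)) 0,
    toE3 (cis (2 * al * k) * (cis (φ + al) - 1)) h, ?_, ?_⟩
  · intro t x h0 h1 h2 h3
    rw [ploid, sec_eq_of_le h0 h1 h2 h3, ← toE3_smul, ← toE3_smul, ← toE3_add, ← toE3_add]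
    congr 1
    · push_cast; ring
    · ring
  · intro x t
    rw [← toE3_smul, ← toE3_smul, ← toE3_add, norm_sq_toE3, mul_pow t, triHeight_sq]
    rw [normSq_real_combination, map_mul, map_mul, normSq_cis, map_mul, mul_mul_mul_comm,
      Complex.mul_conj, normSq_cis, Complex.ofReal_one, one_mul, one_mul,
      one_mul, re_cis_two_al_sub_one_mul,
      normSq_cis_two_al_sub_one, normSq_cis_add_al_sub_one]
    ring

/-- The ploid is affine and isometric on the triangles of the second kind. -/
lemma ploid_second (k : ℤ) : ∃ P0 P1 P2 : E3,
    (∀ t x : ℝ, t ≤ 1 → k + (1 - t) ≤ x → x ≤ k + 1 → ploid φ h t x = P0 + x • P1 + t • P2) ∧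
    ∀ x t : ℝ, ‖x • P1 + t • P2‖ ^ 2 =
      (x * (2 * Real.sin al) + t * (Real.sin al + Real.sin φ)) ^ 2 + (t * triHeight φ h) ^ 2 := by
  refine ⟨toE3 (cis (2 * al * k) * (cis (2 * al) - (cis (2 * al) - 1) * cis (φ + al) * (k
      + 1 : ℝ))) 0,
    toE3 (cis (2 * al * k) * ((cis (2 * al) - 1) * cis (φ + al))) 0,
    toE3 (cis (2 * al * k) * (cis (2 * al) * (cis (φ + al) - 1))) h, ?_, ?_⟩
  · intro t x h1 h2 h3
    rw [ploid, sec_eq_of_ge h1 h2 h3, ← toE3_smul, ← toE3_smul, ← toE3_add, ← toE3_add]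
    congr 1
    · push_cast; ring
    · ring
  · intro x t
    rw [← toE3_smul, ← toE3_smul, ← toE3_add, norm_sq_toE3, mul_pow t, triHeight_sq]
    -- The two kinds of triangles are congruent: up to conjugation the mixed term is that of the
    -- first kind, so its real part is the same.
    have e : cis (2 * al * k) * ((cis (2 * al) - 1) * cis (φ + al)) *
        (starRingEnd ℂ) (cis (2 * al * k) * (cis (2 * al) * (cis (φ + al) - 1))) =
        (starRingEnd ℂ) ((cis (2 * al) - 1) * (starRingEnd ℂ) (cis (φ + al) - 1)) := by
      simp only [map_mul, map_sub, map_one, conj_cis, neg_neg]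
      have h1 := cis_mul_cis_neg (2 * al * k)
      have h2 := cis_mul_cis_neg (2 * al)
      have h3 := cis_mul_cis_neg (φ + al)
      linear_combination ((cis (2 * al) - 1) * cis (φ + al) * cis (-(2 * al)) *
        (cis (-(φ + al)) - 1)) * h1 + cis (φ + al) * (cis (-(φ + al)) - 1) * h2
        + (1 - cis (-(2 * al))) * h3
    rw [normSq_real_combination, e, Complex.conj_re, map_mul, map_mul, map_mul, map_mul, normSq_cis,
      normSq_cis, normSq_cis, re_cis_two_al_sub_one_mul, normSq_cis_two_al_sub_one,
      normSq_cis_add_al_sub_one]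
    ring

end Ploid

end FlatTori
end

/-! ### The diplotorus and its development -/

noncomputable section
namespace FlatTori
open Set

section Diplotorus

variable (φ φ' h : ℝ) (d : ℤ)

/-- The diplotorus with inner twist `φ`, outer twist `φ'` and height `h`, as a doubly periodic map
on the plane of the layout. -/
def diplo (z : ℂ) : E3 :=
  if yred z.im ≤ 0 then ploid φ h (1 + yred z.im) z.re
  else ploid φ' h (1 - yred z.im) (z.re + (1 - yred z.im) * d)

/-- The development of the inner ploid, in the transverse direction. -/
def devInner : ℂ := ⟨Real.sin al + Real.sin φ, triHeight φ h⟩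

/-- The development of the outer ploid, in the transverse direction. -/
def devOuter : ℂ := ⟨-Real.sin φ' - Real.sin al - 2 * Real.sin al * d, triHeight φ' h⟩

/-- The transverse period of the development of the diplotorus. -/
def devPeriod : ℂ := devInner φ h + devOuter φ' h d

/-- The development of the diplotorus in the plane. -/
def dev (z : ℂ) : ℂ :=
  (2 * Real.sin al * z.re : ℝ) + (⌊(z.im + 1) / 2⌋ : ℤ) * devPeriod φ φ' h d +
    if yred z.im ≤ 0 then (1 + yred z.im : ℝ) * devInner φ h
    else devInner φ h + (yred z.im : ℝ) * devOuter φ' h d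

variable {φ φ' h d}

lemma diplo_add (z : ℂ) (m n : ℤ) :
    diplo φ φ' h d (z + (m * (19 : ℕ) + n * (2 * Complex.I))) = diplo φ φ' h d z := by
  have h1 : (z + (m * (19 : ℕ) + n * (2 * Complex.I)) : ℂ).re = z.re + 19 * m := by simp; ring
  have h2 : (z + (m * (19 : ℕ) + n * (2 * Complex.I)) : ℂ).im = z.im + 2 * n := by simp; ring
  unfold diplo ploid
  rw [h1, h2, yred_add_two_mul, sec_add_nineteen, add_right_comm, sec_add_nineteen]

lemma dev_add (z : ℂ) (m n : ℤ) : dev φ φ' h d (z + (m * (19 : ℕ) + n * (2 * Complex.I))) =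
    dev φ φ' h d z + (m * (38 * Real.sin al : ℝ) + n * devPeriod φ φ' h d) := by
  have h1 : (z + (m * (19 : ℕ) + n * (2 * Complex.I)) : ℂ).re = z.re + 19 * m := by simp; ring
  have h2 : (z + (m * (19 : ℕ) + n * (2 * Complex.I)) : ℂ).im = z.im + 2 * n := by simp; ring
  unfold dev
  rw [h1, h2, yred_add_two_mul, floor_add_two_mul]
  push_cast; ring

lemma diplo_of_nonpos {z : ℂ} (h1 : -1 ≤ z.im) (h2 : z.im ≤ 0) :
    diplo φ φ' h d z = ploid φ h (1 + z.im) z.re := by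
  have := yred_of_mem 0 (y := z.im) ⟨h1, by linarith⟩
  rw [Int.cast_zero, mul_zero, add_zero] at this
  rw [diplo, this, if_pos h2]

/-- At ordinate `0`, and at ordinate `1` after reduction to `-1`, the definition uses the internal
ploid. The two formulas agree at these seams by `sec_one_shift` and `sec_zero`. -/
lemma diplo_of_nonneg (hφ : φ' = φ - 2 * al * d) {z : ℂ} (h1 : 0 ≤ z.im) (h2 : z.im ≤ 1) :
    diplo φ φ' h d z = ploid φ' h (1 - z.im) (z.re + (1 - z.im) * d) := by
  rcases h2.eq_or_lt with h2 | h2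
  · have := yred_of_mem 1 (y := -1) ⟨le_rfl, by norm_num⟩
    norm_num at this
    rw [diplo, h2, this, if_pos (by norm_num)]
    simp only [ploid, add_neg_cancel, sub_self, zero_mul, add_zero, sec_zero φ φ']
  · have := yred_of_mem 0 (y := z.im) ⟨by linarith, h2⟩
    rw [Int.cast_zero, mul_zero, add_zero] at this
    rcases h1.eq_or_lt with h1 | h1
    · rw [← h1] at this
      rw [diplo, ← h1, this, if_pos le_rfl]
      simp only [ploid, add_zero, sub_zero, one_mul, hφ, sec_one_shift]
    · rw [diplo, this, if_neg (by linarith)]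

lemma dev_of_nonpos {z : ℂ} (h1 : -1 ≤ z.im) (h2 : z.im ≤ 0) :
    dev φ φ' h d z = (2 * Real.sin al * z.re : ℝ) + (1 + z.im : ℝ) * devInner φ h := by
  have h3 := yred_of_mem 0 (y := z.im) ⟨h1, by linarith⟩
  have h4 := floor_of_mem 0 (y := z.im) ⟨h1, by linarith⟩
  rw [Int.cast_zero, mul_zero, add_zero] at h3 h4
  rw [dev, h3, h4, if_pos h2]
  simp

lemma dev_of_nonneg {z : ℂ} (h1 : 0 ≤ z.im) (h2 : z.im ≤ 1) :
    dev φ φ' h d z =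
      (2 * Real.sin al * z.re : ℝ) + devInner φ h + (z.im : ℝ) * devOuter φ' h d := by
  rcases h2.eq_or_lt with h2 | h2
  · have h3 := yred_of_mem 1 (y := -1) ⟨le_rfl, by norm_num⟩
    have h4 := floor_of_mem 1 (y := -1) ⟨le_rfl, by norm_num⟩
    norm_num at h3 h4
    rw [dev, h2, h3, if_pos (by norm_num), devPeriod]
    norm_num
    ring
  · have h3 := yred_of_mem 0 (y := z.im) ⟨by linarith, h2⟩
    have h4 := floor_of_mem 0 (y := z.im) ⟨by linarith, h2⟩
    rw [Int.cast_zero, mul_zero, add_zero] at h3 h4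
    rw [dev, h3, h4]
    rcases h1.eq_or_lt with h1 | h1
    · rw [← h1, if_pos le_rfl]; simp
    · rw [if_neg (by linarith)]; simp; ring

/-- On each triangle, the diplotorus and its development are affine, with the same metric. -/
lemma exists_affine_tile (hφ : φ' = φ - 2 * al * d) (i : Fin 4) (k : ℤ) :
    ∃ (P0 P1 P2 : E3) (Q0 Q1 Q2 : ℂ),
      (∀ z ∈ tile d i k, diplo φ φ' h d z = P0 + z.re • P1 + z.im • P2) ∧
      (∀ z ∈ tile d i k, dev φ φ' h d z = Q0 + z.re • Q1 + z.im • Q2) ∧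
      ∀ x y : ℝ, ‖x • P1 + y • P2‖ = ‖x • Q1 + y • Q2‖ := by
  have hinner : ∀ {P1 P2 : E3}, (∀ x t : ℝ, ‖x • P1 + t • P2‖ ^ 2 =
      (x * (2 * Real.sin al) + t * (Real.sin al + Real.sin φ)) ^ 2 + (t * triHeight φ h) ^ 2) →
      ∀ x y : ℝ, ‖x • P1 + y • P2‖ = ‖x • ((2 * Real.sin al : ℝ) : ℂ) + y • devInner φ h‖ := by
    intro P1 P2 hP x y
    rw [← sq_eq_sq₀ (norm_nonneg _) (norm_nonneg _), hP, Complex.sq_norm, Complex.normSq_apply]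
    simp [devInner, -Complex.ofReal_sin]
    ring
  -- The external ploid is traversed from its top level down and sheared by `d`, so its transverse
  -- vector is `-(P2 + d • P1)`.
  have houter : ∀ {P1 P2 : E3}, (∀ x t : ℝ, ‖x • P1 + t • P2‖ ^ 2 =
      (x * (2 * Real.sin al) + t * (Real.sin al + Real.sin φ')) ^ 2 + (t * triHeight φ' h) ^ 2) →
      ∀ x y : ℝ, ‖x • P1 + y • -(P2 + (d : ℝ) • P1)‖ =
        ‖x • ((2 * Real.sin al : ℝ) : ℂ) + y • devOuter φ' h d‖ := by
    intro P1 P2 hP x y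
    have e : x • P1 + y • -(P2 + (d : ℝ) • P1) = (x - y * d) • P1 + (-y) • P2 := by module
    rw [e, ← sq_eq_sq₀ (norm_nonneg _) (norm_nonneg _), hP, Complex.sq_norm, Complex.normSq_apply]
    simp [devOuter, -Complex.ofReal_sin]
    ring
  have hdi : ∀ z : ℂ, ((2 * Real.sin al * z.re : ℝ) : ℂ) + (1 + z.im : ℝ) * devInner φ h =
      devInner φ h + z.re • ((2 * Real.sin al : ℝ) : ℂ) + z.im • devInner φ h := fun z => by
    simp only [Complex.real_smul]; push_cast; ring
  have hdo : ∀ z : ℂ, ((2 * Real.sin al * z.re : ℝ) : ℂ) + devInner φ h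
      + (z.im : ℝ) * devOuter φ' h d =
      devInner φ h + z.re • ((2 * Real.sin al : ℝ) : ℂ) + z.im • devOuter φ' h d := fun z => by
    simp only [Complex.real_smul]; push_cast; ring
  fin_cases i
  · obtain ⟨P0, P1, P2, hP, hN⟩ := ploid_first (φ := φ) (h := h) k
    refine ⟨P0 + P2, P1, P2, devInner φ h, _, _, fun z hz => ?_, fun z hz => ?_, hinner hN⟩
    · obtain ⟨h1, h2, h3, h4⟩ := mem_tile_zero.1 hz
      rw [diplo_of_nonpos h1 h2, hP _ _ (by linarith) (by linarith) h3 (by linarith)]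
      module
    · obtain ⟨h1, h2, h3, h4⟩ := mem_tile_zero.1 hz
      rw [dev_of_nonpos h1 h2]; exact hdi z
  · obtain ⟨P0, P1, P2, hP, hN⟩ := ploid_second (φ := φ) (h := h) k
    refine ⟨P0 + P2, P1, P2, devInner φ h, _, _, fun z hz => ?_, fun z hz => ?_, hinner hN⟩
    · obtain ⟨h1, h2, h3, h4⟩ := mem_tile_one.1 hz
      rw [diplo_of_nonpos h1 h2, hP _ _ (by linarith) (by linarith) (by linarith)]
      module
    · obtain ⟨h1, h2, h3, h4⟩ := mem_tile_one.1 hz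
      rw [dev_of_nonpos h1 h2]; exact hdi z
  · obtain ⟨P0, P1, P2, hP, hN⟩ := ploid_first (φ := φ') (h := h) k
    refine ⟨P0 + P2 + (d : ℝ) • P1, P1, -(P2 + (d : ℝ) • P1), devInner φ h, _, _, fun z hz => ?_,
      fun z hz => ?_, houter hN⟩
    · obtain ⟨h1, h2, h3, h4⟩ := mem_tile_two.1 hz
      rw [diplo_of_nonneg hφ h1 h2, hP _ _ (by linarith) (by linarith) h3 (by linarith)]
      module
    · obtain ⟨h1, h2, h3, h4⟩ := mem_tile_two.1 hz
      rw [dev_of_nonneg h1 h2]; exact hdo z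
  · obtain ⟨P0, P1, P2, hP, hN⟩ := ploid_second (φ := φ') (h := h) k
    refine ⟨P0 + P2 + (d : ℝ) • P1, P1, -(P2 + (d : ℝ) • P1), devInner φ h, _, _, fun z hz => ?_,
      fun z hz => ?_, houter hN⟩
    · obtain ⟨h1, h2, h3, h4⟩ := mem_tile_three.1 hz
      rw [diplo_of_nonneg hφ h1 h2, hP _ _ (by linarith) (by linarith) (by linarith)]
      module
    · obtain ⟨h1, h2, h3, h4⟩ := mem_tile_three.1 hz
      rw [dev_of_nonneg h1 h2]; exact hdo z

/-- The diplotorus is embedded. -/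
lemma diplo_eq_iff (hφ' : φ' = φ - 2 * al * d) (hh : 0 < h) (h3 : 3 * al < φ)
    (hφ : φ < Real.pi - al) (hlt : |φ'| + 2 * al < φ) {z z' : ℂ} :
    diplo φ φ' h d z = diplo φ φ' h d z' ↔
      ∃ m n : ℤ, z = z' + (m * (19 : ℕ) + n * (2 * Complex.I)) := by
  constructor
  · intro heq
    have hal := al_pos
    have habs : |φ| < Real.pi - al := by rwa [abs_of_pos (by linarith)]
    have habs' : |φ'| < Real.pi - al := by linarith
    have hy := yred_mem z.im
    have hy' := yred_mem z'.im
    have hz := yred_add z.im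
    have hz' := yred_add z'.im
    have hfin : yred z.im = yred z'.im → (∃ m : ℤ, z.re = z'.re + 19 * m) →
        ∃ m n : ℤ, z = z' + (m * (19 : ℕ) + n * (2 * Complex.I)) := by
      rintro e ⟨m, hm⟩
      refine ⟨m, ⌊(z.im + 1) / 2⌋ - ⌊(z'.im + 1) / 2⌋, ?_⟩
      apply Complex.ext
      · simp; linarith
      · simp; linarith
    unfold diplo at heq
    -- Equal heights mean equal levels. On the same ploid the sections are simple; on different
    -- ploids the level is strictly between `0` and `1`, where the sections are disjoint.
    rcases le_or_gt (yred z.im) 0 with h1 | h1 <;> rcases le_or_gt (yred z'.im) 0 with h2 | h2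
    · rw [if_pos h1, if_pos h2] at heq
      obtain ⟨e1, e2⟩ := toE3_injective heq
      have e3 : yred z.im = yred z'.im := by linarith [mul_left_cancel₀ hh.ne' e2]
      rw [e3] at e1
      exact hfin e3 (sec_inj habs (by linarith [hy'.1]) (by linarith) e1)
    · rw [if_pos h1, if_neg (not_le.2 h2)] at heq
      obtain ⟨e1, e2⟩ := toE3_injective heq
      rw [mul_left_cancel₀ hh.ne' e2] at e1
      exact absurd e1 (sec_ne_sec d (by linarith) h3 hφ hlt (by linarith [hy'.2]) (by linarith) _ _)
    · rw [if_neg (not_le.2 h1), if_pos h2] at heq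
      obtain ⟨e1, e2⟩ := toE3_injective heq
      rw [mul_left_cancel₀ hh.ne' e2] at e1
      exact absurd e1.symm (sec_ne_sec d (by linarith) h3 hφ hlt
        (by linarith [hy.2, mul_left_cancel₀ hh.ne' e2])
        (by linarith [mul_left_cancel₀ hh.ne' e2]) _ _)
    · rw [if_neg (not_le.2 h1), if_neg (not_le.2 h2)] at heq
      obtain ⟨e1, e2⟩ := toE3_injective heq
      have e3 : yred z.im = yred z'.im := by linarith [mul_left_cancel₀ hh.ne' e2]
      rw [e3] at e1
      obtain ⟨m, hm⟩ := sec_inj habs' (by linarith [hy'.2]) (by linarith) e1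
      exact hfin e3 ⟨m, by linarith⟩
  · rintro ⟨m, n, rfl⟩
    exact diplo_add z' m n

lemma dev_im (z : ℂ) : (dev φ φ' h d z).im =
    ⌊(z.im + 1) / 2⌋ * (triHeight φ h + triHeight φ' h) +
      if yred z.im ≤ 0 then (1 + yred z.im) * triHeight φ h
      else triHeight φ h + yred z.im * triHeight φ' h := by
  unfold dev
  split_ifs <;> simp [devPeriod, devInner, devOuter, -Complex.ofReal_sin]

lemma dev_re (z : ℂ) : (dev φ φ' h d z).re = 2 * Real.sin al * z.re +
    (⌊(z.im + 1) / 2⌋ * (devPeriod φ φ' h d).re +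
      if yred z.im ≤ 0 then (1 + yred z.im) * (devInner φ h).re
      else (devInner φ h).re + yred z.im * (devOuter φ' h d).re) := by
  unfold dev
  split_ifs <;> simp [devPeriod, devInner, devOuter, -Complex.ofReal_sin] <;> ring

lemma dev_offset_mem (hh : 0 < h) (z : ℂ) :
    (if yred z.im ≤ 0 then (1 + yred z.im) * triHeight φ h
      else triHeight φ h + yred z.im * triHeight φ' h) ∈
    Ico 0 (triHeight φ h + triHeight φ' h) := by
  have h1 := triHeight_pos (φ := φ) hh
  have h2 := triHeight_pos (φ := φ') hh
  have hy := yred_mem z.im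
  split_ifs with hle
  · constructor
    · exact mul_nonneg (by linarith [hy.1]) h1.le
    · nlinarith [hy.1]
  · constructor
    · nlinarith
    · nlinarith [hy.2]

/-- Within one period the ordinate of the development stays in `[0, H)`, where `H` is the sum of the
two triangle heights. So the number of transverse periods can be read from it, which makes `dev`
invertible and proper. -/
lemma floor_dev_im (hh : 0 < h) (z : ℂ) :
    ⌊(dev φ φ' h d z).im / (triHeight φ h + triHeight φ' h)⌋ = ⌊(z.im + 1) / 2⌋ := by
  have h1 := triHeight_pos (φ := φ) hh
  have h2 := triHeight_pos (φ := φ') hh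
  have hm := dev_offset_mem (φ := φ) (φ' := φ') hh z
  rw [Int.floor_eq_iff, le_div_iff₀ (by positivity), div_lt_iff₀ (by positivity), dev_im]
  constructor
  · linarith [hm.1]
  · linarith [hm.2]

lemma dev_injective (hh : 0 < h) : Function.Injective (dev φ φ' h d) := by
  intro z z' heq
  have h1 := triHeight_pos (φ := φ) hh
  have h2 := triHeight_pos (φ := φ') hh
  have hfl := floor_dev_im (φ := φ) (φ' := φ') (d := d) hh z
  rw [heq, floor_dev_im hh] at hfl
  have him := congrArg Complex.im heq
  rw [dev_im, dev_im, hfl, add_right_inj] at him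
  have hy : yred z.im = yred z'.im := by
    split_ifs at him with a b b
    · linarith [mul_right_cancel₀ h1.ne' him]
    · nlinarith
    · nlinarith
    · exact mul_right_cancel₀ h2.ne' (by linarith)
  have him2 : z.im = z'.im := by rw [← yred_add z.im, ← yred_add z'.im, hy, hfl]
  have hre := congrArg Complex.re heq
  rw [dev_re, dev_re, hfl, hy, add_left_inj] at hre
  exact Complex.ext (mul_left_cancel₀ (mul_pos two_pos sin_al_pos).ne' hre) him2

lemma dev_surjective (hh : 0 < h) : Function.Surjective (dev φ φ' h d) := by
  intro v
  have h1 := triHeight_pos (φ := φ) hh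
  have h2 := triHeight_pos (φ := φ') hh
  obtain ⟨n, r, hr0, hr1, hv⟩ : ∃ (n : ℤ) (r : ℝ), 0 ≤ r ∧ r < triHeight φ h + triHeight φ' h ∧
      v.im = n * (triHeight φ h + triHeight φ' h) + r := by
    refine ⟨⌊v.im / (triHeight φ h + triHeight φ' h)⌋,
      Int.fract (v.im / (triHeight φ h + triHeight φ' h)) * (triHeight φ h + triHeight φ' h),
      mul_nonneg (Int.fract_nonneg _) (by positivity), ?_, ?_⟩
    · have := mul_lt_mul_of_pos_right (Int.fract_lt_one (v.im / (triHeight φ h + triHeight φ' h)))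
        (by positivity : 0 < triHeight φ h + triHeight φ' h)
      linarith
    · rw [← add_mul, Int.floor_add_fract, div_mul_cancel₀ _ (by positivity)]
  obtain ⟨y, hy, hyr⟩ : ∃ y ∈ Ico (-1 : ℝ) 1, (if y ≤ 0 then (1 + y) * triHeight φ h
      else triHeight φ h + y * triHeight φ' h) = r := by
    rcases le_or_gt r (triHeight φ h) with hle | hlt
    · refine ⟨r / triHeight φ h - 1, ⟨?_, ?_⟩, ?_⟩
      · have : 0 ≤ r / triHeight φ h := by positivity
        linarith
      · have := (div_le_one h1).2 hle
        linarith
      · rw [if_pos (by have := (div_le_one h1).2 hle; linarith)]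
        field_simp; ring
    · have hpos : 0 < (r - triHeight φ h) / triHeight φ' h := div_pos (by linarith) h2
      refine ⟨(r - triHeight φ h) / triHeight φ' h, ⟨by linarith, ?_⟩, ?_⟩
      · rw [div_lt_one h2]; linarith
      · rw [if_neg (by linarith)]
        field_simp; ring
  obtain ⟨c, hc⟩ : ∃ c : ℝ, c = n * (devPeriod φ φ' h d).re +
      if y ≤ 0 then (1 + y) * (devInner φ h).re
      else (devInner φ h).re + y * (devOuter φ' h d).re := ⟨_, rfl⟩
  refine ⟨⟨(v.re - c) / (2 * Real.sin al), y + 2 * n⟩, ?_⟩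
  have hs := sin_al_pos
  apply Complex.ext
  · rw [dev_re]
    simp only [yred_of_mem n hy, floor_of_mem n hy]
    rw [← hc]; field_simp; ring
  · rw [dev_im]
    simp only [yred_of_mem n hy, floor_of_mem n hy, hyr, hv]

end Diplotorus

end FlatTori
end

/-! ### From a subdivision of the layout to a linear embedding in space -/

noncomputable section
namespace FlatTori
open Set

section Realization

variable {V : Type} [Fintype V] (K : AbstractSimplicialComplex V)

lemma isCompact_realization : IsCompact (realization K) := by
  have h : realization K = stdSimplex ℝ V ∩ ⋃ σ ∈ K.faces, {w : V → ℝ | ∀ v, v ∉ σ → w v = 0} := by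
    ext w; simp [realization]
  rw [h]
  refine (isCompact_stdSimplex ℝ V).inter_right ?_
  refine (Set.toFinite K.faces).isClosed_biUnion fun σ _ => ?_
  simp only [Set.ofPred_forall]
  exact isClosed_iInter fun v => isClosed_iInter fun _ =>
    isClosed_eq (continuous_apply v) continuous_const

instance : CompactSpace (realization K) := isCompact_iff_compactSpace.1 (isCompact_realization K)

lemma continuous_linearMapOf (p : V → E3) : Continuous (linearMapOf K p) :=
  continuous_finsetSum _ fun v _ =>
    ((continuous_apply v).comp continuous_subtype_val).smul continuous_const

/-- The point of the realization at a vertex. -/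
def vertexPoint [DecidableEq V] (v : V) : realization K :=
  ⟨Pi.single v 1, single_mem_stdSimplex ℝ v, {v}, K.singleton_mem v, fun u hu => by
    rw [Finset.mem_singleton] at hu; exact Pi.single_eq_of_ne hu 1⟩

end Realization

lemma sum_smul_eq_sum_face {V E : Type*} [Fintype V] [AddCommGroup E] [Module ℝ E] {σ : Finset V}
    {w : V → ℝ} (hσ : ∀ v, v ∉ σ → w v = 0) (g : V → E) :
    ∑ v, w v • g v = ∑ v ∈ σ, w v • g v :=
  (Finset.sum_subset (Finset.subset_univ σ) fun v _ hv => by rw [hσ v hv, zero_smul]).symm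

/-- A combination of points of a tile, with weights supported on these points. -/
lemma affine_sum {V E : Type*} [Fintype V] [AddCommGroup E] [Module ℝ E] {f : ℂ → E} {T : Set ℂ}
    (hT : Convex ℝ T) {P0 P1 P2 : E} (hf : ∀ z ∈ T, f z = P0 + z.re • P1 + z.im • P2)
    {σ : Finset V} {w : V → ℝ} (hw : w ∈ stdSimplex ℝ V) (hσ : ∀ v, v ∉ σ → w v = 0) {q : V → ℂ}
    (hq : ∀ v ∈ σ, q v ∈ T) {p : V → E} (hp : ∀ v ∈ σ, p v = f (q v)) :
    ∑ v, w v • p v = f (∑ v, w v • q v) := by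
  have h1 : ∑ v ∈ σ, w v = 1 := by
    rw [← hw.2]
    exact Finset.sum_subset (Finset.subset_univ σ) fun v _ hv => hσ v hv
  have hmem : ∑ v ∈ σ, w v • q v ∈ T := hT.sum_mem (fun v _ => hw.1 v) h1 hq
  rw [sum_smul_eq_sum_face hσ p, sum_smul_eq_sum_face hσ q, hf _ hmem, Complex.re_sum,
      Complex.im_sum, Finset.sum_smul, Finset.sum_smul]
  have h2 : P0 = ∑ v ∈ σ, w v • P0 := by rw [← Finset.sum_smul, h1, one_smul]
  conv_rhs => rw [h2]
  rw [← Finset.sum_add_distrib, ← Finset.sum_add_distrib]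
  refine Finset.sum_congr rfl fun v hv => ?_
  rw [hp v hv, hf _ (hq v hv)]
  simp only [Complex.real_smul, Complex.mul_re, Complex.mul_im, Complex.ofReal_re,
    Complex.ofReal_im, zero_mul, sub_zero, add_zero]
  module

lemma convex_tile (d : ℤ) (i : Fin 4) (k : ℤ) : Convex ℝ (tile d i k) := by
  fin_cases i <;> exact convex_convexHull _ _

/-- Every point is in a translate of a tile, whose indices are controlled. -/
lemma exists_mem_tile (d : ℤ) (z : ℂ) (h1 : -1 ≤ z.im) (h2 : z.im ≤ 1) :
    ∃ i k, z ∈ tile d i k ∧ |(k : ℝ)| ≤ |z.re| + |(d : ℝ)| + 1 := by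
  rcases le_total z.im 0 with h | h
  · have e1 := Int.floor_le z.re
    have e2 := Int.lt_floor_add_one z.re
    have hk : |(⌊z.re⌋ : ℝ)| ≤ |z.re| + |(d : ℝ)| + 1 := by
      have := abs_nonneg (d : ℝ)
      rw [abs_le]
      constructor <;> cases abs_cases z.re <;> linarith
    rcases le_total z.re (⌊z.re⌋ - z.im) with h3 | h3
    · exact ⟨0, ⌊z.re⌋, mem_tile_zero.2 ⟨h1, h, e1, h3⟩, hk⟩
    · exact ⟨1, ⌊z.re⌋, mem_tile_one.2 ⟨h1, h, h3, e2.le⟩, hk⟩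
  · obtain ⟨x, hx⟩ : ∃ x, x = z.re + (1 - z.im) * d := ⟨_, rfl⟩
    have e1 := Int.floor_le x
    have e2 := Int.lt_floor_add_one x
    have hd : |x| ≤ |z.re| + |(d : ℝ)| := by
      rw [hx]
      refine (abs_add_le _ _).trans (add_le_add le_rfl ?_)
      rw [abs_mul, abs_of_nonneg (by linarith)]
      exact mul_le_of_le_one_left (abs_nonneg _) (by linarith)
    have hk : |(⌊x⌋ : ℝ)| ≤ |z.re| + |(d : ℝ)| + 1 := by
      refine le_trans ?_ (add_le_add hd le_rfl)
      rw [abs_le]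
      constructor <;> cases abs_cases x <;> linarith
    rcases le_total x (⌊x⌋ + z.im) with h3 | h3
    · exact ⟨2, ⌊x⌋, mem_tile_two.2 ⟨h, h2, hx ▸ e1, hx ▸ h3⟩, hk⟩
    · exact ⟨3, ⌊x⌋, mem_tile_three.2 ⟨h, h2, hx ▸ h3, hx ▸ e2.le⟩, hk⟩

lemma tile_add_nineteen {d : ℤ} {i : Fin 4} {k m : ℤ} {z : ℂ} (hz : z ∈ tile d i k) :
    z + (m * (19 : ℕ) + (0 : ℤ) * (2 * Complex.I)) ∈ tile d i (k + 19 * m) := by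
  have h1 : (z + (m * (19 : ℕ) + (0 : ℤ) * (2 * Complex.I)) : ℂ).re = z.re + 19 * m := by
    simp; ring
  have h2 : (z + (m * (19 : ℕ) + (0 : ℤ) * (2 * Complex.I)) : ℂ).im = z.im := by simp
  have e : ((k + 19 * m : ℤ) : ℝ) = k + 19 * m := by push_cast; ring
  fin_cases i
  · have := mem_tile_zero.1 hz
    refine mem_tile_zero.2 ?_
    rw [h1, h2, e]; exact ⟨this.1, this.2.1, by linarith, by linarith⟩
  · have := mem_tile_one.1 hz
    refine mem_tile_one.2 ?_
    rw [h1, h2, e]; exact ⟨this.1, this.2.1, by linarith, by linarith⟩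
  · have := mem_tile_two.1 hz
    refine mem_tile_two.2 ?_
    rw [h1, h2, e]; exact ⟨this.1, this.2.1, by linarith, by linarith⟩
  · have := mem_tile_three.1 hz
    refine mem_tile_three.2 ?_
    rw [h1, h2, e]; exact ⟨this.1, this.2.1, by linarith, by linarith⟩

section Isometry

variable {φ φ' h : ℝ} {d : ℤ}

/-- The translates of the tiles. -/
def tileLift (d : ℤ) (i : Fin 4 × ℤ × ℤ) : Set ℂ :=
  (fun z : ℂ => z + ((0 : ℤ) * (19 : ℕ) + i.2.2 * (2 * Complex.I))) '' tile d i.1 i.2.1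

lemma mem_tileLift_of_reduced {i : Fin 4} {k : ℤ} {z : ℂ}
    (h : (⟨z.re, yred z.im⟩ : ℂ) ∈ tile d i k) :
    z ∈ tileLift d (i, k, ⌊(z.im + 1) / 2⌋) := by
  refine ⟨_, h, ?_⟩
  apply Complex.ext
  · simp
  · simp; linarith [yred_add z.im]

/-- Properness of the development: a bounded region of the plane meets the developments of finitely
many tiles. -/
lemma exists_bound_of_norm_dev_le (hh : 0 < h) (R : ℝ) :
    ∃ N : ℝ, ∀ z, ‖dev φ φ' h d z‖ ≤ R → |(⌊(z.im + 1) / 2⌋ : ℝ)| ≤ N ∧ |z.re| ≤ N := by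
  have h1 := triHeight_pos (φ := φ) hh
  have h2 := triHeight_pos (φ := φ') hh
  have hs := sin_al_pos
  obtain ⟨H, hH⟩ : ∃ H, H = triHeight φ h + triHeight φ' h := ⟨_, rfl⟩
  have hHp : 0 < H := by linarith
  obtain ⟨M, hM⟩ : ∃ M, M = R / H + 1 := ⟨_, rfl⟩
  refine ⟨max M ((R + M * |(devPeriod φ φ' h d).re| + (|(devInner φ h).re|
    + |(devOuter φ' h d).re|)) / (2 * Real.sin al)), fun z hz => ?_⟩
  have hn : |(⌊(z.im + 1) / 2⌋ : ℝ)| ≤ M := by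
    rw [← floor_dev_im (φ := φ) (φ' := φ') (d := d) hh z, ← hH, hM]
    have e1 := Int.floor_le ((dev φ φ' h d z).im / H)
    have e2 := Int.lt_floor_add_one ((dev φ φ' h d z).im / H)
    have e3 : |(dev φ φ' h d z).im / H| ≤ R / H := by
      rw [abs_div, abs_of_pos hHp]
      exact div_le_div_of_nonneg_right ((Complex.abs_im_le_norm _).trans hz) hHp.le
    rw [abs_le] at e3 ⊢
    constructor <;> linarith
  refine ⟨hn.trans (le_max_left _ _), le_trans ?_ (le_max_right _ _)⟩
  rw [le_div_iff₀ (by positivity)]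
  have hre := (Complex.abs_re_le_norm _).trans hz
  rw [dev_re] at hre
  have hy := yred_mem z.im
  have h3 : |(if yred z.im ≤ 0 then (1 + yred z.im) * (devInner φ h).re
      else (devInner φ h).re + yred z.im * (devOuter φ' h d).re)| ≤
      |(devInner φ h).re| + |(devOuter φ' h d).re| := by
    split_ifs with hle
    · rw [abs_mul, abs_of_nonneg (by linarith [hy.1])]
      have := mul_le_of_le_one_left (abs_nonneg (devInner φ h).re)
        (by linarith : 1 + yred z.im ≤ 1)
      linarith [abs_nonneg (devOuter φ' h d).re]
    · refine (abs_add_le _ _).trans (add_le_add le_rfl ?_)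
      rw [abs_mul, abs_of_nonneg (by linarith)]
      exact mul_le_of_le_one_left (abs_nonneg _) hy.2.le
  have h4 : |⌊(z.im + 1) / 2⌋ * (devPeriod φ φ' h d).re| ≤ M * |(devPeriod φ φ' h d).re| := by
    rw [abs_mul]; exact mul_le_mul_of_nonneg_right hn (abs_nonneg _)
  have h5 : |z.re| * (2 * Real.sin al) = |2 * Real.sin al * z.re| := by
    rw [abs_mul, abs_of_pos (by positivity : 0 < 2 * Real.sin al)]; ring
  rw [h5]
  rw [abs_le] at *
  constructor <;> linarith

/-- The surface of an embedded diplotorus, rescaled, is isometric to the flat torus whose lattice is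
similar to the one of the development. -/
lemma isIsometricToFlatTorus_diplo (hφ' : φ' = φ - 2 * al * d) (hh : 0 < h) (h3 : 3 * al < φ)
    (hφ : φ < Real.pi - al) (hlt : |φ'| + 2 * al < φ) {τ : ℂ} {r : ℝ} (hr : 0 < r)
    (L : ℂ ≃ₗ[ℝ] ℂ) (hL : ∀ z, ‖L z‖ = r * ‖z‖)
    (hτ : ∀ z, z ∈ lattice (38 * Real.sin al : ℝ) (devPeriod φ φ' h d) ↔ L z ∈ lattice 1 τ) :
    IsIsometricToFlatTorus (range fun z => r • diplo φ φ' h d z) τ := by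
  have hdevadd : ∀ (z : ℂ) (n : ℤ), dev φ φ' h d (z + ((0 : ℤ) * (19 : ℕ) + n * (2 * Complex.I))) =
      dev φ φ' h d z + n * devPeriod φ φ' h d := fun z n => by rw [dev_add]; simp
  have hcont : ∀ i, IsCompact (tileLift d i) := fun i =>
    (isCompact_tile d i.1 i.2.1).image (continuous_id.add continuous_const)
  have haff : ∀ i : Fin 4 × ℤ × ℤ, ∃ (P0 P1 P2 : E3) (Q0 Q1 Q2 : ℂ),
      (∀ z ∈ tileLift d i, diplo φ φ' h d z = P0 + z.re • P1 + z.im • P2) ∧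
      (∀ z ∈ tileLift d i, dev φ φ' h d z = Q0 + z.re • Q1 + z.im • Q2) ∧
      ∀ x y : ℝ, ‖x • P1 + y • P2‖ = ‖x • Q1 + y • Q2‖ := by
    rintro ⟨i, k, n⟩
    obtain ⟨P0, P1, P2, Q0, Q1, Q2, hP, hQ, hn⟩ := exists_affine_tile (h := h) hφ' i k
    refine ⟨P0 - (2 * n : ℝ) • P2, P1, P2, Q0 + n * devPeriod φ φ' h d - (2 * n : ℝ) • Q2, Q1, Q2,
      ?_, ?_, hn⟩
    · rintro _ ⟨z, hz, rfl⟩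
      simp only
      rw [diplo_add, hP z hz]
      simp
      module
    · rintro _ ⟨z, hz, rfl⟩
      simp only
      rw [hdevadd, hQ z hz]
      simp
      ring
  have hclosed : ∀ {E : Type} [NormedAddCommGroup E] [NormedSpace ℝ E] {f : ℂ → E} {i}
      {P0 P1 P2 : E}, (∀ z ∈ tileLift d i, f z = P0 + z.re • P1 + z.im • P2) →
      IsClosed (f '' tileLift d i) := by
    intro E _ _ f i P0 P1 P2 hf
    refine ((hcont i).image_of_continuousOn ?_).isClosed
    have : Continuous fun z : ℂ => P0 + z.re • P1 + z.im • P2 := by fun_prop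
    exact this.continuousOn.congr hf
  refine isIsometricToFlatTorus_range (G := fun z => L (dev φ φ' h d z)) (T := tileLift d)
    (L.surjective.comp (dev_surjective hh)) ?_ ?_ ?_ ?_ ?_ ?_
  · intro z z'
    rw [← map_sub, ← hτ, mem_lattice_iff, smul_right_inj hr.ne',
      diplo_eq_iff hφ' hh h3 hφ hlt]
    constructor
    · rintro ⟨m, n, rfl⟩
      exact ⟨m, n, by rw [dev_add]; ring⟩
    · rintro ⟨m, n, he⟩
      refine ⟨m, n, dev_injective (φ := φ) (φ' := φ') (d := d) hh ?_⟩
      rw [dev_add, ← he]; ring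
  · intro i z hz z' hz'
    obtain ⟨P0, P1, P2, Q0, Q1, Q2, hP, hQ, hn⟩ := haff i
    rw [dist_eq_norm, dist_eq_norm, ← smul_sub, norm_smul, ← map_sub, hL, Real.norm_of_nonneg hr.le,
      hP z hz, hP z' hz', hQ z hz, hQ z' hz']
    have e1 : P0 + z.re • P1 + z.im • P2 - (P0 + z'.re • P1 + z'.im • P2) =
      (z.re - z'.re) • P1 + (z.im - z'.im) • P2 := by module
    have e2 : Q0 + z.re • Q1 + z.im • Q2 - (Q0 + z'.re • Q1 + z'.im • Q2) =
      (z.re - z'.re) • Q1 + (z.im - z'.im) • Q2 := by module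
    rw [e1, e2, hn]
  · intro i
    obtain ⟨P0, P1, P2, Q0, Q1, Q2, hP, hQ, hn⟩ := haff i
    refine hclosed (P0 := L Q0) (P1 := L Q1) (P2 := L Q2) fun z hz => ?_
    rw [hQ z hz]; simp only [map_add, map_smul]
  · intro i
    obtain ⟨P0, P1, P2, Q0, Q1, Q2, hP, hQ, hn⟩ := haff i
    refine hclosed (P0 := r • P0) (P1 := r • P1) (P2 := r • P2) fun z hz => ?_
    rw [hP z hz]; module
  · intro R
    obtain ⟨N, hN⟩ := exists_bound_of_norm_dev_le (φ := φ) (φ' := φ') (d := d) hh (R / r)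
    obtain ⟨M, hM⟩ := exists_nat_ge (N + |(d : ℝ)| + 1)
    refine ⟨Finset.univ ×ˢ Finset.Icc (-(M : ℤ)) M ×ˢ Finset.Icc (-(M : ℤ)) M, fun z hz => ?_⟩
    rw [hL, mul_comm, ← le_div_iff₀ hr] at hz
    obtain ⟨h1, h2⟩ := hN z hz
    have hy := yred_mem z.im
    obtain ⟨i, k, hik, hk⟩ := exists_mem_tile d ⟨z.re, yred z.im⟩ hy.1 hy.2.le
    refine ⟨(i, k, ⌊(z.im + 1) / 2⌋), ?_, mem_tileLift_of_reduced hik⟩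
    have hk' : |(k : ℝ)| ≤ M := by simp only at hk; linarith
    have hn' : |(⌊(z.im + 1) / 2⌋ : ℝ)| ≤ M := by linarith [abs_nonneg (d : ℝ)]
    simp only [Finset.mem_product, Finset.mem_univ, true_and, Finset.mem_Icc, ← abs_le]
    exact ⟨by exact_mod_cast hk', by exact_mod_cast hn'⟩
  -- Modulo the periods, 19 tiles of each family, without vertical translation, give the whole
  -- surface.
  · refine ⟨Finset.univ ×ˢ Finset.Icc 0 18 ×ˢ {0}, fun z => ?_⟩
    have hy := yred_mem z.im
    obtain ⟨i, k, hik, hk⟩ := exists_mem_tile d ⟨z.re, yred z.im⟩ hy.1 hy.2.le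
    have h1 := tile_add_nineteen (m := -(k / 19)) hik
    refine ⟨(i, k + 19 * -(k / 19), 0), ?_, _, ⟨_, h1, rfl⟩, ?_⟩
    · simp only [Finset.mem_product, Finset.mem_univ, true_and, Finset.mem_Icc,
        Finset.mem_singleton, and_true]
      omega
    · rw [diplo_add, diplo_add, smul_right_inj hr.ne', diplo_eq_iff hφ' hh h3 hφ hlt]
      refine ⟨0, -⌊(z.im + 1) / 2⌋, ?_⟩
      apply Complex.ext
      · simp
      · simp; linarith [yred_add z.im]

end Isometry

/-- If a complex subdivides the triangulation of a diplotorus, it embeds linearly on it. -/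
theorem admitsLinearEmbedding_of_subdivides {V : Type} [Fintype V] {K : AbstractSimplicialComplex V}
    {d : ℤ} {Φ : realization K ≃ₜ LayoutTorus 19} (hsub : Subdivides K 19 d Φ) {φ φ' h : ℝ}
    (hφ' : φ' = φ - 2 * al * d) (hh : 0 < h) (h3 : 3 * al < φ)
    (hφ : φ < Real.pi - al) (hlt : |φ'| + 2 * al < φ) {τ : ℂ} {r : ℝ} (hr : 0 < r)
    (L : ℂ ≃ₗ[ℝ] ℂ) (hL : ∀ z, ‖L z‖ = r * ‖z‖)
    (hτ : ∀ z, z ∈ lattice (38 * Real.sin al : ℝ) (devPeriod φ φ' h d) ↔ L z ∈ lattice 1 τ) :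
    AdmitsLinearEmbedding K τ := by
  classical
  have hmk : ∀ z z' : ℂ, (z : LayoutTorus 19) = z' ↔ diplo φ φ' h d z = diplo φ φ' h d z' := by
    intro z z'
    rw [QuotientAddGroup.eq, mem_lattice_iff, eq_comm (a := diplo φ φ' h d z),
      diplo_eq_iff hφ' hh h3 hφ hlt]
    simp only [neg_add_eq_iff_eq_add]
  obtain ⟨f, hf⟩ : ∃ f : LayoutTorus 19 → E3, ∀ z : ℂ, f z = diplo φ φ' h d z :=
    ⟨fun x => diplo φ φ' h d x.out, fun z => (hmk _ _).1 (QuotientAddGroup.out_eq' _)⟩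
  have hfinj : Function.Injective f := by
    intro x y hxy
    obtain ⟨a, rfl⟩ := QuotientAddGroup.mk_surjective x
    obtain ⟨b, rfl⟩ := QuotientAddGroup.mk_surjective y
    rwa [hf, hf, ← hmk] at hxy
  obtain ⟨p, hp⟩ : ∃ p : V → E3, p = fun v => r • f (Φ (vertexPoint K v)) := ⟨_, rfl⟩
  -- A face is drawn linearly inside one tile, on which `diplo` is affine. So the right side is
  -- linear on the face, and it agrees with the left side at the vertices.
  have key : ∀ w, linearMapOf K p w = r • f (Φ w) := by
    intro w
    obtain ⟨hw, σ, hσ, hwσ⟩ := w.2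
    obtain ⟨q, hq, t, ht, hqt⟩ := hsub σ hσ
    obtain ⟨i, k, rfl⟩ := exists_eq_tile ht
    obtain ⟨P0, P1, P2, -, -, -, hP, -⟩ := exists_affine_tile (h := h) hφ' i k
    have hv : ∀ v ∈ σ, f (Φ (vertexPoint K v)) = diplo φ φ' h d (q v) := by
      intro v hv
      rw [hq (vertexPoint K v) (fun u hu => by
        show (Pi.single v (1 : ℝ) : V → ℝ) u = 0
        exact Pi.single_eq_of_ne (ne_of_mem_of_not_mem hv hu).symm _), hf]
      congr 1
      simp [vertexPoint, Pi.single_apply, ite_smul]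
    rw [hq w hwσ, hf, ← affine_sum (convex_tile d i k) hP hw hwσ hqt hv, Finset.smul_sum]
    unfold linearMapOf
    refine Finset.sum_congr rfl fun v _ => ?_
    rw [hp, smul_comm]
  refine ⟨p, ?_, ?_⟩
  · refine ((continuous_linearMapOf K p).isClosedEmbedding ?_).isEmbedding
    intro w w' hww
    rw [key, key, smul_right_inj hr.ne'] at hww
    exact Φ.injective (hfinj hww)
  · have : range (linearMapOf K p) = range fun z => r • diplo φ φ' h d z := by
      ext x
      constructor
      · rintro ⟨w, rfl⟩
        obtain ⟨z, hz⟩ := QuotientAddGroup.mk_surjective (Φ w)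
        exact ⟨z, by rw [key, ← hz, hf]⟩
      · rintro ⟨z, rfl⟩
        exact ⟨Φ.symm z, by rw [key, Φ.apply_symm_apply, hf]⟩
    rw [this]
    exact isIsometricToFlatTorus_diplo hφ' hh h3 hφ hlt hr L hL hτ

end FlatTori
end

/-! ### Realizing every short modulus -/

noncomputable section
namespace FlatTori
open Set

/-! ### Numerical bounds -/

lemma abs_mul_sub_mul_le {a b p q e f : ℝ} (ha : |a - p| ≤ e) (hb : |b - q| ≤ f) (hb1 : |b| ≤ 1)
    (hp : |p| ≤ 1) : |a * b - p * q| ≤ e + f := by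
  have : a * b - p * q = (a - p) * b + p * (b - q) := by ring
  rw [this]
  refine (abs_add_le _ _).trans ?_
  rw [abs_mul, abs_mul]
  have h1 := mul_le_of_le_one_right (abs_nonneg (a - p)) hb1
  have h2 := mul_le_of_le_one_left (abs_nonneg (b - q)) hp
  linarith

/-- Controlled error in the addition formulas: starting from Taylor bounds at `al`, it yields the
sines and cosines of the needed multiples. -/
lemma abs_cos_add_sub_le {x y c s c' s' e f : ℝ} (hx : |Real.cos x - c| ≤ e ∧ |Real.sin x - s| ≤ e)
    (hy : |Real.cos y - c'| ≤ f ∧ |Real.sin y - s'| ≤ f) (hc : |c| ≤ 1) (hs : |s| ≤ 1) :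
    |Real.cos (x + y) - (c * c' - s * s')| ≤ 2 * (e + f) ∧
    |Real.sin (x + y) - (s * c' + c * s')| ≤ 2 * (e + f) := by
  rw [Real.cos_add, Real.sin_add]
  have h1 := abs_mul_sub_mul_le hx.1 hy.1 (Real.abs_cos_le_one y) hc
  have h2 := abs_mul_sub_mul_le hx.2 hy.2 (Real.abs_sin_le_one y) hs
  have h3 := abs_mul_sub_mul_le hx.2 hy.1 (Real.abs_cos_le_one y) hs
  have h4 := abs_mul_sub_mul_le hx.1 hy.2 (Real.abs_sin_le_one y) hc
  simp only [abs_le] at *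
  exact ⟨⟨by linarith, by linarith⟩, by linarith, by linarith⟩

lemma trig_al : |Real.cos al - 0.98633| ≤ 0.00005 ∧ |Real.sin al - 0.1646| ≤ 0.00005 := by
  have h1 := Real.pi_gt_d4
  have h2 := Real.pi_lt_d4
  have h3 := nineteen_al
  have e1 : 0.165339 ≤ al := by linarith
  have e2 : al ≤ 0.165348 := by linarith
  have e0 : 0 ≤ al := by linarith
  have ha : |al| ≤ 1 := by rw [abs_of_nonneg e0]; linarith
  have hc := Real.cos_bound ha
  have hs := Real.sin_bound ha
  rw [abs_of_nonneg e0] at hc hs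
  have q1 : al ^ 2 ≤ 0.165348 ^ 2 := pow_le_pow_left₀ e0 e2 2
  have q2 : 0.165339 ^ 2 ≤ al ^ 2 := pow_le_pow_left₀ (by norm_num) e1 2
  have q3 : al ^ 3 ≤ 0.165348 ^ 3 := pow_le_pow_left₀ e0 e2 3
  have q4 : 0.165339 ^ 3 ≤ al ^ 3 := pow_le_pow_left₀ (by norm_num) e1 3
  have q5 : al ^ 4 ≤ 0.165348 ^ 4 := pow_le_pow_left₀ e0 e2 4
  have q6 : al ^ 5 ≤ 0.165348 ^ 5 := pow_le_pow_left₀ e0 e2 5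
  simp only [abs_le] at *
  norm_num at q1 q2 q3 q4 q5 q6 ⊢
  refine ⟨⟨?_, ?_⟩, ?_, ?_⟩ <;> linarith

lemma trig_weaken {x c s c' s' e e' : ℝ} (h : |Real.cos x - c| ≤ e ∧ |Real.sin x - s| ≤ e)
    (hc : |c - c'| ≤ e' - e) (hs : |s - s'| ≤ e' - e) :
    |Real.cos x - c'| ≤ e' ∧ |Real.sin x - s'| ≤ e' := by
  simp only [abs_le] at *
  exact ⟨⟨by linarith, by linarith⟩, by linarith, by linarith⟩

lemma trig_two_al :
    |Real.cos (2 * al) - 0.94575| ≤ 0.00021 ∧ |Real.sin (2 * al) - 0.3247| ≤ 0.00021 := by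
  rw [show 2 * al = al + al by ring]
  refine trig_weaken (abs_cos_add_sub_le trig_al trig_al ?_ ?_) ?_ ?_ <;>
  · rw [abs_le]; norm_num

lemma trig_three_al :
    |Real.cos (3 * al) - 0.87938| ≤ 0.00054 ∧ |Real.sin (3 * al) - 0.47593| ≤ 0.00054 := by
  rw [show 3 * al = 2 * al + al by ring]
  refine trig_weaken (abs_cos_add_sub_le trig_two_al trig_al ?_ ?_) ?_ ?_ <;>
  · rw [abs_le]; norm_num

lemma trig_four_al :
    |Real.cos (4 * al) - 0.78901| ≤ 0.00085 ∧ |Real.sin (4 * al) - 0.61417| ≤ 0.00085 := by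
  rw [show 4 * al = 2 * al + 2 * al by ring]
  refine trig_weaken (abs_cos_add_sub_le trig_two_al trig_two_al ?_ ?_) ?_ ?_ <;>
  · rw [abs_le]; norm_num

lemma trig_five_al :
    |Real.cos (5 * al) - 0.67713| ≤ 0.00181 ∧ |Real.sin (5 * al) - 0.73565| ≤ 0.00181 := by
  rw [show 5 * al = 4 * al + al by ring]
  refine trig_weaken (abs_cos_add_sub_le trig_four_al trig_al ?_ ?_) ?_ ?_ <;>
  · rw [abs_le]; norm_num

lemma trig_six_al :
    |Real.cos (6 * al) - 0.54679| ≤ 0.00213 ∧ |Real.sin (6 * al) - 0.83704| ≤ 0.00213 := by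
  rw [show 6 * al = 4 * al + 2 * al by ring]
  refine trig_weaken (abs_cos_add_sub_le trig_four_al trig_two_al ?_ ?_) ?_ ?_ <;>
  · rw [abs_le]; norm_num

lemma trig_seven_al :
    |Real.cos (7 * al) - 0.40154| ≤ 0.00437 ∧ |Real.sin (7 * al) - 0.9156| ≤ 0.00437 := by
  rw [show 7 * al = 6 * al + al by ring]
  refine trig_weaken (abs_cos_add_sub_le trig_six_al trig_al ?_ ?_) ?_ ?_ <;>
  · rw [abs_le]; norm_num

lemma trig_eight_al :
    |Real.cos (8 * al) - 0.24533| ≤ 0.00341 ∧ |Real.sin (8 * al) - 0.96917| ≤ 0.00341 := by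
  rw [show 8 * al = 4 * al + 4 * al by ring]
  refine trig_weaken (abs_cos_add_sub_le trig_four_al trig_four_al ?_ ?_) ?_ ?_ <;>
  · rw [abs_le]; norm_num

/-! ### The moduli of the embedded diplotori -/

/-- The modulus `σ` is the one of the development of an embedded diplotorus. -/
def IsDiplotorusModulus (d : ℤ) (σ : ℂ) : Prop :=
  ∃ φ φ' h : ℝ, φ' = φ - 2 * al * d ∧ 0 < h ∧ 3 * al < φ ∧ φ < Real.pi - al ∧
    |φ'| + 2 * al < φ ∧ devPeriod φ φ' h d = (38 * Real.sin al : ℝ) * σ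

/-- The twists are `u + d * al` and `u - d * al`. The real part of the period fixes `cos u`; `h1`
and `h2` say that `al < u < (18 - d) * al`, which gives all the conditions of embedding. The
imaginary part grows with the height, and `h3`, `h4` say that it is too small at height `0`. -/
lemma isDiplotorusModulus {d : ℤ} (hd : 2 ≤ d) {x y : ℝ} (hy : 0 < y) (hA : 0 < Real.sin (d * al))
    (h1 : (d - 19 * x) * Real.sin al < Real.sin (d * al) * Real.cos al)
    (h2 : Real.sin (d * al) * Real.cos ((18 - d) * al) < (d - 19 * x) * Real.sin al)
    (h18 : 0 ≤ (18 - d) * al)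
    (h3 : Real.sin (d * al) * Real.cos al - Real.cos (d * al) * ((d - 19 * x) * Real.sin al) <
      19 * Real.sin al * y * Real.sin (d * al))
    (h4 : Real.sin (d * al) ^ 2 < Real.sin al ^ 2 * (361 * y ^ 2 + (d - 19 * x) ^ 2)) :
    IsDiplotorusModulus d ⟨-x, y⟩ := by
  have hal := al_pos
  have hs := sin_al_pos
  have hpi := nineteen_al
  have hd' : (2 : ℝ) ≤ d := by exact_mod_cast hd
  obtain ⟨k, hk⟩ : ∃ k, k = (d - 19 * x) * Real.sin al / Real.sin (d * al) := ⟨_, rfl⟩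
  have hkA : Real.sin (d * al) * k = (d - 19 * x) * Real.sin al := by rw [hk]; field_simp
  have hk1 : k < Real.cos al := by rwa [hk, div_lt_iff₀' hA]
  have hk2 : Real.cos ((18 - d) * al) < k := by rwa [hk, lt_div_iff₀' hA]
  obtain ⟨u, hu⟩ : ∃ u, u = Real.arccos k := ⟨_, rfl⟩
  have hcu : Real.cos u = k := by
    rw [hu]
    exact Real.cos_arccos ((Real.neg_one_le_cos _).trans hk2.le) (hk1.le.trans (Real.cos_le_one _))
  have hu0 : 0 ≤ u := hu ▸ Real.arccos_nonneg k
  have hupi : u ≤ Real.pi := hu ▸ Real.arccos_le_pi k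
  have hu1 : al < u := by
    by_contra! h
    have := Real.cos_le_cos_of_nonneg_of_le_pi hu0 (by linarith) h
    linarith
  have hu2 : u < (18 - d) * al := by
    by_contra! h
    have := Real.cos_le_cos_of_nonneg_of_le_pi h18 hupi h
    linarith
  obtain ⟨φ, hφ⟩ : ∃ φ, φ = d * al + u := ⟨_, rfl⟩
  obtain ⟨φ', hφ'⟩ : ∃ φ', φ' = u - d * al := ⟨_, rfl⟩
  have hdal : 2 * al ≤ d * al := mul_le_mul_of_nonneg_right hd' hal.le
  have hcos : Real.cos φ + Real.cos φ' = 2 * Real.cos (d * al) * k := by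
    rw [hφ, hφ', Real.cos_add, Real.cos_sub, hcu]; ring
  have hcos' : Real.cos φ' - Real.cos φ = 2 * Real.sin (d * al) * Real.sin u := by
    rw [hφ, hφ', Real.cos_add, Real.cos_sub]; ring
  have hsin : Real.sin φ - Real.sin φ' = 2 * Real.sin (d * al) * k := by
    rw [hφ, hφ', Real.sin_add, Real.sin_sub, hcu]; ring
  have hφc : Real.cos φ < Real.cos al := by
    apply Real.cos_lt_cos_of_nonneg_of_le_pi hal.le <;> linarith
  have hsu : Real.sin (d * al) * Real.sin u < 19 * Real.sin al * y := by
    refine lt_of_pow_lt_pow_left₀ 2 (by positivity) ?_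
    have e1 : Real.sin u ^ 2 = 1 - k ^ 2 := by rw [Real.sin_sq, hcu]
    have e2 : (Real.sin (d * al) * k) ^ 2 = ((d - 19 * x) * Real.sin al) ^ 2 := by rw [hkA]
    rw [mul_pow, e1]
    nlinarith
  -- The sum is `|cos al - cos φ| + |cos al - cos φ'|`. When `cos φ' ≤ cos al` the bound is `h3`,
  -- otherwise it is `h4` in the form `hsu`.
  have hlow : triHeight φ 0 + triHeight φ' 0 < 38 * Real.sin al * y := by
    unfold triHeight
    simp only [ne_eq, OfNat.ofNat_ne_zero, not_false_eq_true, zero_pow, zero_add,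
        Real.sqrt_sq_eq_abs]
    rw [abs_of_pos (sub_pos.2 hφc)]
    have h5 : Real.cos al - Real.cos (d * al) * k < 19 * Real.sin al * y := by
      rw [← mul_lt_mul_iff_left₀ hA]
      rw [← hkA] at h3
      linarith
    cases abs_cases (Real.cos al - Real.cos φ') <;> linarith
  have hcont : Continuous fun h => triHeight φ h + triHeight φ' h := by
    unfold triHeight; fun_prop
  have hhigh : 38 * Real.sin al * y ≤
      triHeight φ (38 * Real.sin al * y) + triHeight φ' (38 * Real.sin al * y) := by
    have e1 : 38 * Real.sin al * y ≤ triHeight φ (38 * Real.sin al * y) :=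
      Real.le_sqrt_of_sq_le (by nlinarith)
    have e2 : 0 ≤ triHeight φ' (38 * Real.sin al * y) := Real.sqrt_nonneg _
    linarith
  obtain ⟨h, ⟨hh0, -⟩, hh⟩ := intermediate_value_Icc (by positivity : 0 ≤ 38 * Real.sin al * y)
    hcont.continuousOn ⟨hlow.le, hhigh⟩
  simp only at hh
  have hh1 : 0 < h := by
    rcases hh0.lt_or_eq with h0 | h0
    · exact h0
    · rw [← h0] at hh; exact absurd hh hlow.ne
  refine ⟨φ, φ', h, by rw [hφ, hφ']; ring, hh1, by linarith, by linarith, ?_, ?_⟩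
  · rw [← lt_sub_iff_add_lt, abs_lt]; constructor <;> linarith
  · apply Complex.ext
    · simp only [Complex.re_ofReal_mul, devPeriod, devInner, devOuter, Complex.add_re]
      linarith
    · simp only [Complex.im_ofReal_mul, devPeriod, devInner, devOuter, Complex.add_im]
      linarith

/-- A similarity of the plane turns an embedding for the modulus `σ` into one for the modulus
`τ`. -/
lemma IsDiplotorusModulus.admitsLinearEmbedding {V : Type} [Fintype V] {K :
    AbstractSimplicialComplex V}
    {d : ℤ} {Φ : realization K ≃ₜ LayoutTorus 19} (hsub : Subdivides K 19 d Φ) {τ σ : ℂ}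
    (hσ : IsDiplotorusModulus d σ) {ρ : ℝ} (hρ : 0 < ρ)
    (L : ℂ ≃ₗ[ℝ] ℂ) (hL : ∀ z, ‖L z‖ = ρ * ‖z‖) (hτ : lattice (L 1) (L σ) = lattice 1 τ) :
    AdmitsLinearEmbedding K τ := by
  obtain ⟨φ, φ', h, hφ', hh, h3, hφ, hlt, hσ⟩ := hσ
  have hs := sin_al_pos
  obtain ⟨a, ha⟩ : ∃ a, a = 38 * Real.sin al := ⟨_, rfl⟩
  have ha0 : 0 < a := by rw [ha]; positivity
  refine admitsLinearEmbedding_of_subdivides hsub hφ' hh h3 hφ hlt (r := ρ * a⁻¹) (by positivity)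
    ((LinearEquiv.smulOfNeZero ℝ ℂ a⁻¹ (inv_ne_zero ha0.ne')).trans L) (fun z => ?_) fun z => ?_
  · simp [hL, abs_of_pos ha0, mul_assoc]
  · rw [← hτ, mem_lattice_iff, mem_lattice_iff, hσ, ← ha]
    have e : ∀ m n : ℤ, m * L 1 + n * L σ = L (m * 1 + n * σ) := fun m n => by
      rw [map_add]
      congr 1
      · rw [← zsmul_eq_mul, ← zsmul_eq_mul, map_zsmul]
      · rw [← zsmul_eq_mul, ← zsmul_eq_mul, map_zsmul]
    simp only [e, LinearEquiv.trans_apply, L.injective.eq_iff, LinearEquiv.smulOfNeZero_apply]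
    refine exists_congr fun m => exists_congr fun n => ?_
    rw [inv_smul_eq_iff₀ ha0.ne', Complex.real_smul]
    constructor <;> rintro rfl <;> ring

/-- The threshold `0.003` comes from `al < u`, which here reads `19 * x > 2 * sin al ^ 2`, that is
`x > 0.0028...`. The last two hypotheses are rounded forms of the two conditions on the height. -/
lemma isDiplotorusModulus_two {x y : ℝ} (hx0 : 0.003 ≤ x) (hx1 : x ≤ 0.085) (hy : 0 < y)
    (h : 0.0546 + 18.02 * x ≤ 6.16 * y) (h' : 76 * x ≤ 361 * (x ^ 2 + y ^ 2)) :
    IsDiplotorusModulus 2 ⟨-x, y⟩ := by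
  have t1 := trig_al
  have t2 := trig_two_al
  have t3 := trig_three_al
  simp only [abs_le] at t1 t2 t3
  obtain ⟨⟨c0, c1⟩, s0, s1⟩ := t1
  have hcs := Real.sin_sq_add_cos_sq al
  have hc2 : Real.cos al ^ 2 ≤ 0.98638 ^ 2 := pow_le_pow_left₀ (by linarith) (by linarith) 2
  have hc2' : 0.98628 ^ 2 ≤ Real.cos al ^ 2 := pow_le_pow_left₀ (by norm_num) (by linarith) 2
  have hsc : 0.16455 * 0.98628 ≤ Real.sin al * Real.cos al :=
    mul_le_mul (by linarith) (by linarith) (by norm_num) (by linarith)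
  have hs : 0 < Real.sin al := sin_al_pos
  refine isDiplotorusModulus le_rfl hy ?_ ?_ ?_ ?_ ?_ ?_ <;> push_cast
  · linarith
  · rw [Real.sin_two_mul]
    have : 2 - 19 * x < 2 * Real.cos al ^ 2 := by norm_num at hc2'; linarith
    nlinarith
  · rw [show (18 - 2) * al = Real.pi - 3 * al by linarith [nineteen_al], Real.cos_pi_sub]
    have e1 : 0 < (2 - 19 * x) * Real.sin al := mul_pos (by linarith) hs
    have e2 : 0 < Real.sin (2 * al) * Real.cos (3 * al) := mul_pos (by linarith) (by linarith)
    linarith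
  · linarith [al_pos]
  · have e1 : Real.cos (2 * al) * x ≤ 0.946 * x := mul_le_mul_of_nonneg_right (by linarith)
      (by linarith)
    have e2 := mul_le_mul_of_nonneg_right hsc hy.le
    have e3 : 2 * Real.cos al ^ 2 - Real.cos (2 * al) * (2 - 19 * x) <
        38 * (Real.sin al * Real.cos al) * y := by
      have := Real.cos_two_mul al
      norm_num at hc2' e2
      linarith
    have e4 := mul_lt_mul_of_pos_left e3 hs
    rw [Real.sin_two_mul]
    linarith
  · rw [Real.sin_two_mul]
    have e1 : 4 * Real.cos al ^ 2 < 361 * y ^ 2 + (2 - 19 * x) ^ 2 := by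
      norm_num at hc2
      linarith
    have e2 := mul_lt_mul_of_pos_left e1 (pow_pos hs 2)
    linarith

lemma isDiplotorusModulus_seven {x y : ℝ} (hx0 : 0.085 ≤ x) (hx1 : x ≤ 0.43) (hy : 0 < y)
    (h : 0.451 + 1.27 * x ≤ 2.847 * y) (h' : 266 * x ≤ 361 * (x ^ 2 + y ^ 2) + 17.5) :
    IsDiplotorusModulus 7 ⟨-x, y⟩ := by
  have t1 := trig_al
  have t7 := trig_seven_al
  have t8 := trig_eight_al
  simp only [abs_le] at t1 t7 t8
  obtain ⟨⟨c0, c1⟩, s0, s1⟩ := t1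
  obtain ⟨⟨a0, a1⟩, b0, b1⟩ := t7
  have hs : 0 < Real.sin al := sin_al_pos
  have hAc : 0.91123 * 0.98628 ≤ Real.sin (7 * al) * Real.cos al :=
    mul_le_mul (by linarith) (by linarith) (by norm_num) (by linarith)
  have hAc' : Real.sin (7 * al) * Real.cos al ≤ 0.91997 * 0.98638 :=
    mul_le_mul (by linarith) (by linarith) (by linarith) (by norm_num)
  have hsA : 0.16455 * 0.91123 ≤ Real.sin al * Real.sin (7 * al) :=
    mul_le_mul (by linarith) (by linarith) (by norm_num) (by linarith)
  have hcs : 0.39717 * 0.16455 ≤ Real.cos (7 * al) * Real.sin al :=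
    mul_le_mul (by linarith) (by linarith) (by norm_num) (by linarith)
  have hcs' : Real.cos (7 * al) * Real.sin al ≤ 0.40591 * 0.16465 :=
    mul_le_mul (by linarith) (by linarith) (by linarith) (by norm_num)
  refine isDiplotorusModulus (by norm_num) hy ?_ ?_ ?_ ?_ ?_ ?_ <;> push_cast
  · linarith
  · have : (7 - 19 * x) * Real.sin al ≤ 5.385 * 0.16465 :=
      mul_le_mul (by linarith) (by linarith) hs.le (by norm_num)
    norm_num at *
    linarith
  · rw [show (18 - 7) * al = Real.pi - 8 * al by linarith [nineteen_al], Real.cos_pi_sub]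
    have e1 : 0.91123 * 0.24192 ≤ Real.sin (7 * al) * Real.cos (8 * al) :=
      mul_le_mul (by linarith) (by linarith) (by norm_num) (by linarith)
    have e2 : (19 * x - 7) * Real.sin al ≤ 1.17 * Real.sin al :=
      mul_le_mul_of_nonneg_right (by linarith) hs.le
    norm_num at *
    linarith
  · linarith [al_pos]
  · have e1 := mul_le_mul_of_nonneg_right hcs' (by linarith : 0 ≤ x)
    have e2 := mul_le_mul_of_nonneg_right hsA hy.le
    norm_num at *
    linarith
  · have e1 : Real.sin (7 * al) ^ 2 ≤ 0.91997 ^ 2 := pow_le_pow_left₀ (by linarith) (by linarith) 2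
    have e2 : 0.16455 ^ 2 ≤ Real.sin al ^ 2 := pow_le_pow_left₀ (by norm_num) (by linarith) 2
    have e3 : 0.16455 ^ 2 * 31.5 ≤ Real.sin al ^ 2 * (361 * y ^ 2 + (7 - 19 * x) ^ 2) :=
      mul_le_mul e2 (by linarith) (by norm_num) (by positivity)
    norm_num at *
    linarith

lemma isDiplotorusModulus_thirteen {x y : ℝ} (hx0 : 0.43 ≤ x) (hx1 : x ≤ 0.5) (hy : 0 < y)
    (h : 2.0028 - 1.717 * x ≤ 2.61 * y) (h' : 494 * x ≤ 361 * (x ^ 2 + y ^ 2) + 142) :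
    IsDiplotorusModulus 13 ⟨-x, y⟩ := by
  have t1 := trig_al
  have t5 := trig_five_al
  have t6 := trig_six_al
  simp only [abs_le] at t1 t5 t6
  obtain ⟨⟨c0, c1⟩, s0, s1⟩ := t1
  obtain ⟨⟨a0, a1⟩, b0, b1⟩ := t6
  have hs : 0 < Real.sin al := sin_al_pos
  have hsin : Real.sin (13 * al) = Real.sin (6 * al) := by
    rw [show 13 * al = Real.pi - 6 * al by linarith [nineteen_al], Real.sin_pi_sub]
  have hcos : Real.cos (13 * al) = -Real.cos (6 * al) := by
    rw [show 13 * al = Real.pi - 6 * al by linarith [nineteen_al], Real.cos_pi_sub]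
  have hAc : 0.83491 * 0.98628 ≤ Real.sin (6 * al) * Real.cos al :=
    mul_le_mul (by linarith) (by linarith) (by norm_num) (by linarith)
  have hAc' : Real.sin (6 * al) * Real.cos al ≤ 0.83917 * 0.98638 :=
    mul_le_mul (by linarith) (by linarith) (by linarith) (by norm_num)
  have hsA : 0.16455 * 0.83491 ≤ Real.sin al * Real.sin (6 * al) :=
    mul_le_mul (by linarith) (by linarith) (by norm_num) (by linarith)
  have hcs' : Real.cos (6 * al) * Real.sin al ≤ 0.54892 * 0.16465 :=
    mul_le_mul (by linarith) (by linarith) (by linarith) (by norm_num)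
  refine isDiplotorusModulus (by norm_num) hy ?_ ?_ ?_ ?_ ?_ ?_ <;> push_cast <;>
    try simp only [hsin, hcos]
  · linarith
  · have : (13 - 19 * x) * Real.sin al ≤ 4.83 * 0.16465 :=
      mul_le_mul (by linarith) (by linarith) hs.le (by norm_num)
    norm_num at *
    linarith
  · rw [show (18 - 13 : ℝ) = 5 by norm_num]
    have e1 : Real.sin (6 * al) * Real.cos (5 * al) ≤ 0.83917 * 0.67894 :=
      mul_le_mul (by linarith) (by linarith) (by linarith) (by norm_num)
    have e2 : 3.5 * Real.sin al ≤ (13 - 19 * x) * Real.sin al :=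
      mul_le_mul_of_nonneg_right (by linarith) hs.le
    norm_num at *
    linarith
  · linarith [al_pos]
  · have e1 := mul_le_mul_of_nonneg_right hcs' (by linarith : 0 ≤ 13 - 19 * x)
    have e2 := mul_le_mul_of_nonneg_right hsA hy.le
    norm_num at *
    linarith
  · have e1 : Real.sin (6 * al) ^ 2 ≤ 0.83917 ^ 2 := pow_le_pow_left₀ (by linarith) (by linarith) 2
    have e2 : 0.16455 ^ 2 ≤ Real.sin al ^ 2 := pow_le_pow_left₀ (by norm_num) (by linarith) 2
    have e3 : 0.16455 ^ 2 * 27 ≤ Real.sin al ^ 2 * (361 * y ^ 2 + (13 - 19 * x) ^ 2) :=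
      mul_le_mul e2 (by linarith) (by norm_num) (by positivity)
    norm_num at *
    linarith

/-- The conditions `h1` and `h2` of `isDiplotorusModulus` confine `x` to about `(0.0029, 0.197)` for
`d = 2`, `(0.080, 0.440)` for `d = 7` and `(0.420, 0.503)` for `d = 13`. These intervals overlap,
and the thresholds `0.085` and `0.43` are taken in the overlaps. -/
lemma exists_isDiplotorusModulus_of_large {x y : ℝ} (hx0 : 0.003 ≤ x) (hx1 : x ≤ 1 / 2)
    (hy : 0 < y) (hxy : 1 ≤ x ^ 2 + y ^ 2) :
    ∃ d ∈ ({2, 7, 13} : Set ℤ), IsDiplotorusModulus d ⟨-x, y⟩ := by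
  have hy1 : 0.86 ≤ y := by
    by_contra! h
    have := mul_self_le_mul_self hy.le h.le
    have := mul_self_le_mul_self (by linarith) hx1
    norm_num at *
    linarith
  rcases le_total x 0.085 with h1 | h1
  · exact ⟨2, by simp, isDiplotorusModulus_two hx0 h1 hy (by linarith) (by linarith)⟩
  rcases le_total x 0.43 with h2 | h2
  · exact ⟨7, by simp, isDiplotorusModulus_seven h1 h2 hy (by linarith) (by linarith)⟩
  · exact ⟨13, by simp, isDiplotorusModulus_thirteen h2 (by linarith) hy (by linarith)
      (by linarith)⟩

/-- A nearly rectangular torus is described by another basis, of modulus `-1 / (τ + m)`, with real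
part about `-m / (m ^ 2 + y ^ 2)`. For `m = 1` this is large enough as long as `y ≤ 16`; for taller
tori `m = 4` keeps it above `0.003` in absolute value up to `y = 33`. -/
lemma exists_isDiplotorusModulus_inv {m : ℤ} {x y : ℝ}
    (hm : m = 1 ∧ y ≤ 16 ∨ m = 4 ∧ 16 ≤ y) (hx : |x| ≤ 0.003)
    (hy : 0 < y) (hy' : y ≤ 33) (hxy : 1 ≤ x ^ 2 + y ^ 2) :
    ∃ d ∈ ({2, 7, 13} : Set ℤ), IsDiplotorusModulus d (-(⟨x + m, y⟩ : ℂ)⁻¹) := by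
  rw [abs_le] at hx
  obtain ⟨M, hM⟩ : ∃ M, M = x + m := ⟨_, rfl⟩
  obtain ⟨N, hN⟩ : ∃ N, N = M ^ 2 + y ^ 2 := ⟨_, rfl⟩
  have hN0 : 0 < N := by rw [hN]; positivity
  obtain ⟨a, ha⟩ : ∃ a, a = M / N := ⟨_, rfl⟩
  obtain ⟨b, hb⟩ : ∃ b, b = y / N := ⟨_, rfl⟩
  have e : -(⟨x + m, y⟩ : ℂ)⁻¹ = ⟨-a, b⟩ := by
    apply Complex.ext <;> simp [Complex.inv_re, Complex.inv_im, Complex.normSq_apply] <;>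
      rw [← hM]
    · rw [ha, hN, sq, sq]
    · rw [hb, hN, sq, sq, neg_div, neg_neg]
  rw [e]
  have haN : a * N = M := by rw [ha]; field_simp
  have hbN : b * N = y := by rw [hb]; field_simp
  have hab : (a ^ 2 + b ^ 2) * N = 1 := by
    have : (a ^ 2 + b ^ 2) * N * N = N := by
      calc (a ^ 2 + b ^ 2) * N * N = (a * N) ^ 2 + (b * N) ^ 2 := by ring
        _ = N := by rw [haN, hbN, hN]
    exact mul_right_cancel₀ hN0.ne' (by rw [this, one_mul])
  have hb0 : 0 < b := by rw [hb]; positivity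
  have hy1 : 0.99 ≤ y := by
    by_contra! h
    have h1 := mul_self_le_mul_self hy.le h.le
    have h2 := mul_nonneg (sub_nonneg.2 hx.1) (sub_nonneg.2 hx.2)
    norm_num at h1 h2
    linarith
  -- Multiplied by `N`, the linear and quadratic conditions on `(a, b)` all become linear in `N`,
  -- `M` and `y`, because `(a ^ 2 + b ^ 2) * N = 1`.
  have hle : ∀ {p q r : ℝ}, p * N + q * M ≤ r * y → p + q * a ≤ r * b := fun {p q r} h => by
    refine le_of_mul_le_mul_right (a := N) ?_ hN0
    rw [← haN, ← hbN] at h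
    linarith
  have hle' : ∀ {p q : ℝ}, q * M ≤ 361 + p * N → q * a ≤ 361 * (a ^ 2 + b ^ 2) + p
      := fun {p q} h => by
    refine le_of_mul_le_mul_right (a := N) ?_ hN0
    rw [← haN] at h
    linarith
  have hge : ∀ {p : ℝ}, p * N ≤ M → p ≤ a := fun {p} h => by
    rw [← haN] at h; exact le_of_mul_le_mul_right h hN0
  have hge' : ∀ {p : ℝ}, M ≤ p * N → a ≤ p := fun {p} h => by
    rw [← haN] at h; exact le_of_mul_le_mul_right h hN0
  rcases hm with ⟨rfl, hy2⟩ | ⟨rfl, hy2⟩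
  · have hM1 : 0.997 ≤ M := by rw [hM]; push_cast; linarith
    have hM2 : M ≤ 1.003 := by rw [hM]; push_cast; linarith
    have hMs : M ^ 2 ≤ 1.003 ^ 2 := pow_le_pow_left₀ (by linarith) hM2 2
    have hMs' : 0.997 ^ 2 ≤ M ^ 2 := pow_le_pow_left₀ (by norm_num) hM1 2
    norm_num at hMs hMs'
    -- Each slab for `a` confines `y` to an interval, on which the remaining inequality, quadratic
    -- in `y`, follows from the product of the distances of `y` to the two ends.
    rcases le_total a 0.085 with h1 | h1
    · have hNM : M ≤ 0.085 * N := by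
        rw [← haN]; exact mul_le_mul_of_nonneg_right h1 hN0.le
      have hy3 : 3.2 ≤ y := by
        by_contra! h
        have := mul_self_le_mul_self hy.le h.le
        linarith
      have hq := mul_nonneg (sub_nonneg.2 hy3) (sub_nonneg.2 hy2)
      refine ⟨2, by simp, isDiplotorusModulus_two (hge ?_) h1 hb0 (hle ?_) ?_⟩
      · linarith
      · linarith
      · have := hle' (p := 0) (q := 76) (by linarith)
        linarith
    have hNM : 0.085 * N ≤ M := by
      rw [← haN]; exact mul_le_mul_of_nonneg_right h1 hN0.le
    have hy3 : y ≤ 3.4 := by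
      by_contra! h
      have := mul_self_le_mul_self (by norm_num) h.le
      linarith
    rcases le_total a 0.43 with h2 | h2
    · have hNM' : M ≤ 0.43 * N := by
        rw [← haN]; exact mul_le_mul_of_nonneg_right h2 hN0.le
      have hy4 : 1.14 ≤ y := by
        by_contra! h
        have := mul_self_le_mul_self hy.le h.le
        linarith
      have hq := mul_nonneg (sub_nonneg.2 hy4) (sub_nonneg.2 hy3)
      refine ⟨7, by simp, isDiplotorusModulus_seven h1 h2 hb0 (hle ?_) (hle' ?_)⟩
      · linarith
      · linarith
    · have hNM' : 0.43 * N ≤ M := by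
        rw [← haN]; exact mul_le_mul_of_nonneg_right h2 hN0.le
      have hy4 : y ≤ 1.158 := by
        by_contra! h
        have := mul_self_le_mul_self (by norm_num) h.le
        linarith
      have hq := mul_nonneg (sub_nonneg.2 hy1) (sub_nonneg.2 hy4)
      have hNM2 : M ≤ 0.5 * N := by
        rw [hN, hM]; push_cast; linarith
      refine ⟨13, by simp, isDiplotorusModulus_thirteen h2 (hge' hNM2) hb0 ?_ (hle' ?_)⟩
      · have := hle (p := 2.0028) (q := -1.717) (r := 2.61) (by linarith)
        linarith
      · linarith
  · have hM1 : 3.997 ≤ M := by rw [hM]; push_cast; linarith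
    have hM2 : M ≤ 4.003 := by rw [hM]; push_cast; linarith
    have hMs : M ^ 2 ≤ 4.003 ^ 2 := pow_le_pow_left₀ (by linarith) hM2 2
    norm_num at hMs
    have hq := mul_nonneg (sub_nonneg.2 hy2) (sub_nonneg.2 hy')
    have hq2 := mul_self_le_mul_self (by norm_num) hy2
    have hq3 := sq_nonneg M
    refine ⟨2, by simp, isDiplotorusModulus_two (hge ?_) (hge' ?_) hb0 (hle ?_) ?_⟩
    · linarith
    · linarith
    · linarith
    · have := hle' (p := 0) (q := 76) (by linarith)
      linarith

lemma lattice_eq_of_mem {a b a' b' : ℂ} (h1 : a ∈ lattice a' b') (h2 : b ∈ lattice a' b')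
    (h3 : a' ∈ lattice a b) (h4 : b' ∈ lattice a b) : lattice a b = lattice a' b' := by
  apply le_antisymm <;> refine (AddSubgroup.closure_le _).2 ?_ <;> rintro z
      (rfl | rfl) <;> assumption

/-- Every short torus is the image of an embedding of a diplotorus, linear on a complex that
subdivides the three triangulations. -/
theorem admitsLinearEmbedding_of_short {V : Type} [Fintype V] {K : AbstractSimplicialComplex V}
    {Φ : realization K ≃ₜ LayoutTorus 19}
    (hK : ∀ d ∈ ({2, 7, 13} : Set ℤ), Subdivides K 19 d Φ) {τ : ℂ} (hτ : τ ∈ shortModuli) :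
    AdmitsLinearEmbedding K τ := by
  obtain ⟨h0, h1, h2, h3⟩ := hτ
  rw [abs_of_pos h0] at h3
  have hn : 1 ≤ τ.re ^ 2 + τ.im ^ 2 := by
    have := one_le_pow₀ h1 (n := 2)
    rwa [Complex.sq_norm, Complex.normSq_apply, ← sq, ← sq] at this
  have hmem : ∀ {a b : ℂ} (m n : ℤ), m * a + n * b ∈ lattice a b := fun m n =>
    mem_lattice_iff.2 ⟨m, n, rfl⟩
  rcases le_total 0.003 |τ.re| with h | h
  · obtain ⟨d, hd, hm⟩ := exists_isDiplotorusModulus_of_large h h2 h0 (by rwa [sq_abs])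
    rcases le_total τ.re 0 with h4 | h4
    · refine hm.admitsLinearEmbedding (hK d hd) one_pos (LinearEquiv.refl ℝ ℂ) (by simp) ?_
      rw [abs_of_nonpos h4, neg_neg]
      rfl
    -- Conjugation reverses the orientation of the torus and preserves its metric, so the sign of
    -- the real part is immaterial.
    · refine hm.admitsLinearEmbedding (hK d hd) one_pos Complex.conjAe.toLinearEquiv (by simp) ?_
      have e1 : Complex.conjAe.toLinearEquiv (⟨-|τ.re|, τ.im⟩ : ℂ) = -τ := by
        rw [abs_of_nonneg h4]
        apply Complex.ext <;> simp
      have e2 : Complex.conjAe.toLinearEquiv (1 : ℂ) = 1 := by simp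
      rw [e1, e2]
      apply lattice_eq_of_mem
      · simpa using hmem (a := 1) (b := τ) 1 0
      · simpa using hmem (a := 1) (b := τ) 0 (-1)
      · simpa using hmem (a := 1) (b := -τ) 1 0
      · simpa using hmem (a := 1) (b := -τ) 0 (-1)
  · obtain ⟨m, hm1⟩ : ∃ m : ℤ, m = 1 ∧ τ.im ≤ 16 ∨ m = 4 ∧ 16 ≤ τ.im := by
      rcases le_total τ.im 16 with h5 | h5
      · exact ⟨1, Or.inl ⟨rfl, h5⟩⟩
      · exact ⟨4, Or.inr ⟨rfl, h5⟩⟩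
    obtain ⟨d, hd, hm⟩ := exists_isDiplotorusModulus_inv hm1 h h0 h3 hn
    have e : (⟨τ.re + m, τ.im⟩ : ℂ) = τ + m := by apply Complex.ext <;> simp
    rw [e] at hm
    have hne : τ + m ≠ 0 := fun h6 => by
      have := congrArg Complex.im h6
      simp at this
      linarith
    -- Multiplication by `τ + m` carries the basis `1, -1 / (τ + m)` to `τ + m, -1`, a basis of the
    -- lattice of `τ`.
    refine hm.admitsLinearEmbedding (hK d hd) (norm_pos_iff.2 hne)
      (LinearEquiv.smulOfNeZero ℂ ℂ (τ + m) hne |>.restrictScalars ℝ) (by simp) ?_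
    simp only [LinearEquiv.restrictScalars_apply, LinearEquiv.smulOfNeZero_apply, smul_eq_mul,
      mul_one, mul_neg, mul_inv_cancel₀ hne]
    apply lattice_eq_of_mem
    · simpa [add_comm] using hmem (a := 1) (b := τ) m 1
    · simpa using hmem (a := 1) (b := τ) (-1) 0
    · simpa using hmem (a := τ + m) (b := -1) 0 (-1)
    · simpa using hmem (a := τ + m) (b := -1) 1 m

end FlatTori
end

/-! ### The table of triangles and its finite verifications -/

noncomputable section
namespace FlatTori
open Set

/-- A triangle with natural coordinates. The strip `ℝ × [-1, 1]` is drawn at scale `4620`, with its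
lower boundary on the horizontal axis. -/
abbrev Tri : Type := (ℕ × ℕ) × (ℕ × ℕ) × (ℕ × ℕ)

/-- The triangles of the common refinement, up to translation, with positive orientation. -/
def triTable : List Tri :=
  [((0, 0), (4620, 0), (0, 4620)), ((0, 4620), (4620, 0), (4620, 4620)),
    ((0, 4620), (5460, 5040), (6160, 5390)), ((0, 4620), (1260, 5040), (770, 5005)),
    ((0, 4620), (5390, 5005), (5460, 5040)), ((0, 4620), (4620, 5280), (1260, 5040)),
    ((0, 4620), (4620, 4620), (5390, 5005)), ((0, 4620), (6160, 5390), (4620, 5280)),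
    ((770, 5005), (1260, 5040), (840, 5040)), ((1260, 5040), (1386, 5082), (840, 5040)),
    ((840, 5040), (1386, 5082), (1540, 5390)), ((1260, 5040), (4620, 5280), (1386, 5082)),
    ((1386, 5082), (2520, 5460), (1540, 5390)), ((4620, 5280), (5390, 5390), (1386, 5082)),
    ((1386, 5082), (5390, 5390), (6468, 5544)), ((1386, 5082), (6468, 5544), (6930, 5775)),
    ((1386, 5082), (6930, 5775), (2520, 5460)), ((0, 5280), (1540, 5390), (770, 5390)),
    ((770, 5390), (1680, 5460), (1848, 5544)), ((1540, 5390), (1680, 5460), (770, 5390)),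
    ((1540, 5390), (2520, 5460), (2772, 5544)), ((1540, 5390), (2772, 5544), (1680, 5460)),
    ((1680, 5460), (2772, 5544), (1848, 5544)), ((2520, 5460), (6930, 5775), (7140, 5880)),
    ((2520, 5460), (7140, 5880), (2772, 5544)), ((1848, 5544), (3465, 5775), (2310, 5775)),
    ((2772, 5544), (3465, 5775), (1848, 5544)), ((2772, 5544), (7140, 5880), (7700, 6160)),
    ((2772, 5544), (7700, 6160), (3465, 5775)), ((3465, 5775), (3780, 5880), (2310, 5775)),
    ((2310, 5775), (3780, 5880), (2520, 5880)), ((3465, 5775), (4620, 5940), (3780, 5880)),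
    ((7700, 6160), (4620, 5940), (3465, 5775)), ((2520, 5880), (4158, 6006), (3080, 6160)),
    ((3780, 5880), (4158, 6006), (2520, 5880)), ((3780, 5880), (4620, 5940), (4158, 6006)),
    ((0, 5940), (3080, 6160), (1540, 6160)), ((4620, 5940), (6160, 6160), (4158, 6006)),
    ((4158, 6006), (5040, 6300), (3080, 6160)), ((4158, 6006), (6160, 6160), (8316, 6468)),
    ((4158, 6006), (8316, 6468), (8470, 6545)), ((4158, 6006), (8470, 6545), (5040, 6300)),
    ((1540, 6160), (3360, 6300), (3696, 6468)), ((3080, 6160), (3360, 6300), (1540, 6160)),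
    ((3080, 6160), (5040, 6300), (5544, 6468)), ((3080, 6160), (5544, 6468), (3360, 6300)),
    ((420, 6300), (3850, 6545), (4200, 6720)), ((420, 6300), (4200, 6720), (924, 6468)),
    ((3360, 6300), (5544, 6468), (3696, 6468)), ((924, 6468), (1680, 6720), (0, 6600)),
    ((924, 6468), (4620, 6930), (1680, 6720)), ((924, 6468), (4200, 6720), (4620, 6930)),
    ((3696, 6468), (4620, 6600), (3850, 6545)), ((5544, 6468), (4620, 6600), (3696, 6468)),
    ((3850, 6545), (4620, 6600), (6930, 6930)), ((3850, 6545), (6930, 6930), (4200, 6720)),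
    ((0, 6600), (1680, 6720), (2310, 6930)), ((1680, 6720), (4620, 6930), (2310, 6930)),
    ((4200, 6720), (6930, 6930), (4620, 6930)), ((0, 6930), (2940, 7140), (3696, 7392)),
    ((0, 6930), (3696, 7392), (420, 7140)), ((2310, 6930), (2940, 7140), (0, 6930)),
    ((2310, 6930), (4620, 7260), (2940, 7140)), ((4620, 6930), (5040, 7140), (2310, 6930)),
    ((2310, 6930), (5040, 7140), (5390, 7315)), ((2310, 6930), (5390, 7315), (4620, 7260)),
    ((420, 7140), (3696, 7392), (4200, 7560)), ((420, 7140), (4200, 7560), (770, 7315)),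
    ((2940, 7140), (4620, 7260), (3696, 7392)), ((0, 7260), (770, 7315), (924, 7392)),
    ((4620, 7260), (5544, 7392), (3696, 7392)), ((770, 7315), (4200, 7560), (5082, 7854)),
    ((770, 7315), (5082, 7854), (924, 7392)), ((924, 7392), (3080, 7700), (1260, 7560)),
    ((5082, 7854), (3080, 7700), (924, 7392)), ((3696, 7392), (5880, 7560), (6160, 7700)),
    ((3696, 7392), (6160, 7700), (4200, 7560)), ((5544, 7392), (5880, 7560), (3696, 7392)),
    ((1260, 7560), (3080, 7700), (1540, 7700)), ((4200, 7560), (6160, 7700), (5082, 7854)),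
    ((1540, 7700), (2100, 7980), (462, 7854)), ((1540, 7700), (6468, 8316), (2100, 7980)),
    ((3080, 7700), (4620, 7920), (1540, 7700)), ((1540, 7700), (4620, 7920), (5775, 8085)),
    ((1540, 7700), (5775, 8085), (6468, 8316)), ((3080, 7700), (5082, 7854), (4620, 7920)),
    ((462, 7854), (840, 7980), (0, 7920)), ((462, 7854), (2100, 7980), (840, 7980)),
    ((0, 7920), (840, 7980), (1155, 8085)), ((2100, 7980), (2310, 8085), (840, 7980)),
    ((840, 7980), (2310, 8085), (1155, 8085)), ((2100, 7980), (6468, 8316), (6720, 8400)),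
    ((2100, 7980), (6720, 8400), (2310, 8085)), ((1155, 8085), (2772, 8316), (1848, 8316)),
    ((2310, 8085), (2772, 8316), (1155, 8085)), ((2310, 8085), (6720, 8400), (7854, 8778)),
    ((2310, 8085), (7854, 8778), (2772, 8316)), ((1848, 8316), (2940, 8400), (3080, 8470)),
    ((1848, 8316), (3080, 8470), (2100, 8400)), ((2772, 8316), (2940, 8400), (1848, 8316)),
    ((2772, 8316), (3850, 8470), (2940, 8400)), ((7854, 8778), (3850, 8470), (2772, 8316)),
    ((2100, 8400), (3080, 8470), (3234, 8778)), ((2940, 8400), (3850, 8470), (3080, 8470)),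
    ((3080, 8470), (4620, 8580), (9240, 9240)), ((3080, 8470), (9240, 9240), (3780, 8820)),
    ((3850, 8470), (4620, 8580), (3080, 8470)), ((3080, 8470), (3780, 8820), (3234, 8778)),
    ((3850, 8470), (7854, 8778), (4620, 8580)), ((0, 8580), (3360, 8820), (4620, 9240)),
    ((3234, 8778), (3360, 8820), (0, 8580)), ((3234, 8778), (3780, 8820), (3360, 8820)),
    ((3360, 8820), (3850, 8855), (4620, 9240)), ((3780, 8820), (3850, 8855), (3360, 8820)),
    ((3780, 8820), (9240, 9240), (3850, 8855)), ((3850, 8855), (9240, 9240), (4620, 9240))]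

namespace Tri

/-- The vertices of a triangle. -/
def corner (T : Tri) : Fin 3 → ℕ × ℕ := ![T.1, T.2.1, T.2.2]

def natMin (a b : ℕ) : ℕ := bif Nat.ble a b then a else b

def natMax (a b : ℕ) : ℕ := bif Nat.ble a b then b else a

def xMin (T : Tri) : ℕ := natMin T.1.1 (natMin T.2.1.1 T.2.2.1)

def xMax (T : Tri) : ℕ := natMax T.1.1 (natMax T.2.1.1 T.2.2.1)

def yMin (T : Tri) : ℕ := natMin T.1.2 (natMin T.2.1.2 T.2.2.2)

def yMax (T : Tri) : ℕ := natMax T.1.2 (natMax T.2.1.2 T.2.2.2)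

/-- The bounding boxes of `T`, translated by `(9240, 0)`, and of `T'`, translated by `s`, are
disjoint. -/
def far (s : ℕ × ℕ) (T T' : Tri) : Bool :=
  Nat.ble (Nat.succ (yMax T)) (yMin T' + s.2) || (Nat.ble (Nat.succ (xMax T + 9240)) (xMin T'
      + s.1) ||
    (Nat.ble (Nat.succ (xMax T' + s.1)) (xMin T + 9240) ||
      Nat.ble (Nat.succ (yMax T' + s.2)) (yMin T)))

/-- The linear form with coefficients `n` is smaller at `p` than at `q`. -/
def smaller (n p q : ℤ × ℤ) : Bool := decide (n.1 * p.1 + n.2 * p.2 < n.1 * q.1 + n.2 * q.2)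

def translate (T : Tri) (s : ℕ × ℕ) : List (ℤ × ℤ) :=
  [((T.1.1 + s.1 : ℕ), (T.1.2 + s.2 : ℕ)), ((T.2.1.1 + s.1 : ℕ), (T.2.1.2 + s.2 : ℕ)),
    ((T.2.2.1 + s.1 : ℕ), (T.2.2.2 + s.2 : ℕ))]

/-- The linear form with coefficients `n` separates `B` from `A`, except for common points. -/
def separates (n : ℤ × ℤ) (A B : List (ℤ × ℤ)) : Bool :=
  (B.all fun q => A.all (fun p => smaller n q p) ||
    (A.contains q && A.all (fun p => !smaller n p q))) && B.any fun q => A.any fun p => smaller n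
        q p

/-- Normals of the edges of the three triangulations, namely `(0, 1)`, `(1, 0)`, `(1, 1)`, `(1, -d)`
and `(1, -(d + 1))`, and five more for the remaining pairs. -/
def directions : List (ℤ × ℤ) :=
  [(1, -8), (0, 1), (1, -13), (1, -3), (1, 0), (1, -14), (1, -2), (1, -7), (1, 7), (1, -11),
    (1, -9), (2, -1), (3, -49), (1, 1)]

/-- Only the relative translation matters. Placing `T` at `(9240, 0)` keeps the coordinates natural
for relative shifts by `-2` to `2` columns. -/
def apart (s : ℕ × ℕ) (T T' : Tri) : Bool :=
  far s T T' || directions.any fun n =>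
    separates n (translate T (9240, 0)) (translate T' s) ||
    separates n (translate T' s) (translate T (9240, 0)) ||
    separates (-n.1, -n.2) (translate T (9240, 0)) (translate T' s) ||
    separates (-n.1, -n.2) (translate T' s) (translate T (9240, 0))

/-- All pairs of triangles of a list are apart. -/
def allApart : List Tri → Bool
  | [] => true
  | T :: l => l.all (apart (9240, 0) T) && allApart l

set_option maxRecDepth 100000

lemma allApart_triTable : allApart triTable = true := by decide +kernel

/-- These are the relative positions within two columns and one row, up to exchange of the
triangles; the null translation is the object of `allApart_triTable`. -/
lemma apart_of_shift : (triTable.all fun T => triTable.all fun T' => apart (13860, 0) T T' &&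
    apart (18480, 0) T T' && apart (0, 9240) T T' && apart (4620, 9240) T T' &&
    apart (9240, 9240) T T' && apart (13860, 9240) T T' && apart (18480, 9240) T T') = true := by
  decide +kernel

def positive (T : Tri) : Bool :=
  Nat.ble (Nat.succ (T.1.2 * T.2.1.1 + T.2.1.2 * T.2.2.1 + T.2.2.2 * T.1.1))
    (T.1.1 * T.2.1.2 + T.2.1.1 * T.2.2.2 + T.2.2.1 * T.1.2)

lemma positive_triTable : triTable.all positive = true := by decide +kernel

/-- Up to translation, the edge from `a` to `b` is the edge from `b'` to `a'`. -/
def reverses (a b a' b' : ℕ × ℕ) : Bool :=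
  Nat.beq (a.1 + a'.1) (b.1 + b'.1) && (Nat.beq (a.2 + a'.2) (b.2 + b'.2) &&
    (Nat.beq (a'.1 % 4620) (b.1 % 4620) && Nat.beq (a'.2 % 9240) (b.2 % 9240)))

def hasReverse (a b : ℕ × ℕ) : Bool :=
  triTable.any fun T => reverses a b T.1 T.2.1 || (reverses a b T.2.1 T.2.2 ||
    reverses a b T.2.2 T.1)

/-- No edge is on a boundary: since the triangles are positively oriented, the one with the reversed
edge is on its other side. -/
lemma hasReverse_triTable : (triTable.all fun T => hasReverse T.1 T.2.1 &&
    (hasReverse T.2.1 T.2.2 && hasReverse T.2.2 T.1)) = true := by decide +kernel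

/-- The height of an edge is at most `4620`, and the edges of this height rise from the lower
boundary. -/
def shortEdge (a b : ℕ × ℕ) : Bool :=
  Nat.ble b.2 (a.2 + 4620) && (!Nat.beq b.2 (a.2 + 4620) || Nat.beq (a.2 % 9240) 0)

lemma shortEdge_triTable : (triTable.all fun T => shortEdge T.1 T.2.1 && shortEdge T.2.1 T.1 &&
    shortEdge T.2.1 T.2.2 && shortEdge T.2.2 T.2.1 && shortEdge T.1 T.2.2 && shortEdge T.2.2 T.1 &&
    Nat.ble (xMax T) 10780 && Nat.ble (yMax T) 9240) = true := by decide +kernel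

/-- The inequalities that place a point in a tile. -/
def inTile (d : ℕ) (k : ℕ) (i : ℕ) (p : ℕ × ℕ) : Bool :=
  match i with
  | 0 => Nat.ble p.2 4620 && Nat.ble (4620 * k) p.1 && Nat.ble (p.1 + p.2) (4620 * k + 4620)
  | 1 => Nat.ble p.2 4620 && Nat.ble (4620 * k + 4620) (p.1 + p.2) && Nat.ble p.1 (4620 * k + 4620)
  | 2 => Nat.ble 4620 p.2 && Nat.ble p.2 9240 && Nat.ble (4620 * k + d * p.2) (p.1 + d * 9240) &&
    Nat.ble (p.1 + d * 9240 + 4620) (4620 * k + d * p.2 + p.2)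
  | _ => Nat.ble 4620 p.2 && Nat.ble p.2 9240 &&
    Nat.ble (4620 * k + d * p.2 + p.2) (p.1 + d * 9240 + 4620) &&
    Nat.ble (p.1 + d * 9240) (4620 * k + 4620 + d * p.2)

def tiled (d : ℕ) (T : Tri) : Bool :=
  (List.range 30).any fun k => [0, 1, 2, 3].any fun i =>
    inTile d k i T.1 && (inTile d k i T.2.1 && inTile d k i T.2.2)

lemma tiled_triTable : (triTable.all fun T => tiled 2 T && tiled 7 T && tiled 13 T) = true := by
  decide +kernel

lemma length_triTable : triTable.length = 116 := by decide +kernel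

attribute [irreducible] triTable

end Tri

end FlatTori
end

/-! ### Separation of the translated triangles -/

noncomputable section
namespace FlatTori
open Set

section Separation

variable {A B : Fin 3 → ℤ × ℤ}

/-- Twice the signed area of a triangle. -/
def det (A : Fin 3 → ℤ × ℤ) : ℤ :=
  ((A 1).1 - (A 0).1) * ((A 2).2 - (A 0).2) - ((A 1).2 - (A 0).2) * ((A 2).1 - (A 0).1)

/-- The vertices of a nondegenerate triangle are affinely independent. -/
lemma eq_zero_of_sum_eq_zero (hA : det A ≠ 0) {u : Fin 3 → ℝ} (h : ∑ i, u i = 0)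
    (hx : ∑ i, u i * (A i).1 = 0) (hy : ∑ i, u i * (A i).2 = 0) : u = 0 := by
  have hd : (det A : ℝ) ≠ 0 := by exact_mod_cast hA
  simp only [Fin.sum_univ_three] at h hx hy
  unfold det at hd
  push_cast at hd
  have h1 : u 1 = 0 := by
    refine (mul_eq_zero.1 (?_ : u 1 * _ = 0)).resolve_right hd
    linear_combination (((A 2).2 : ℝ) - (A 0).2) * hx - (((A 2).1 : ℝ) - (A 0).1) * hy -
      ((A 0).1 * (((A 2).2 : ℝ) - (A 0).2) - (A 0).2 * (((A 2).1 : ℝ) - (A 0).1)) * h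
  have h2 : u 2 = 0 := by
    refine (mul_eq_zero.1 (?_ : u 2 * _ = 0)).resolve_right hd
    linear_combination (((A 1).1 : ℝ) - (A 0).1) * hy - (((A 1).2 : ℝ) - (A 0).2) * hx -
      ((A 0).2 * (((A 1).1 : ℝ) - (A 0).1) - (A 0).1 * (((A 1).2 : ℝ) - (A 0).2)) * h
  have h0 : u 0 = 0 := by linarith
  funext i
  fin_cases i <;> assumption

/-- A point of both triangles is the same combination of common vertices in both, and it is not
in the interior of both. -/
def Separated (A B : Fin 3 → ℤ × ℤ) : Prop :=
  ∀ w w' : Fin 3 → ℝ, (∀ i, 0 ≤ w i) → (∀ i, 0 ≤ w' i) → ∑ i, w i = 1 → ∑ i, w' i = 1 →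
    ∑ i, w i * (A i).1 = ∑ i, w' i * (B i).1 → ∑ i, w i * (A i).2 = ∑ i, w' i * (B i).2 →
    (∀ f : ℤ × ℤ → ℝ, ∑ i, w i * f (A i) = ∑ i, w' i * f (B i)) ∧
      ((∀ i, 0 < w i) → (∀ i, 0 < w' i) → False)

lemma Separated.symm (h : Separated A B) : Separated B A := fun w w' hw hw' h1 h1' hx hy => by
  obtain ⟨h2, h3⟩ := h w' w hw' hw h1' h1 hx.symm hy.symm
  exact ⟨fun f => (h2 f).symm, fun a b => h3 b a⟩

lemma Separated.translate {A' B' : Fin 3 → ℤ × ℤ} (c : ℤ × ℤ) (h : Separated A B)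
    (hA : ∀ i, A i = A' i + c) (hB : ∀ i, B i = B' i + c) : Separated A' B' := by
  intro w w' hw hw' h1 h1' hx hy
  have hx' : ∑ i, w i * ((A i).1 : ℝ) = ∑ i, w' i * ((B i).1 : ℝ) := by
    simp only [hA, hB, Prod.fst_add, Int.cast_add, mul_add, Finset.sum_add_distrib,
      ← Finset.sum_mul, h1, h1', hx]
  have hy' : ∑ i, w i * ((A i).2 : ℝ) = ∑ i, w' i * ((B i).2 : ℝ) := by
    simp only [hA, hB, Prod.snd_add, Int.cast_add, mul_add, Finset.sum_add_distrib,
      ← Finset.sum_mul, h1, h1', hy]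
  obtain ⟨h2, h3⟩ := h w w' hw hw' h1 h1' hx' hy'
  refine ⟨fun f => ?_, h3⟩
  simpa only [hA, hB, add_sub_cancel_right] using h2 fun p => f (p - c)

/-- A linear form separates two triangles, except for common vertices. -/
lemma separated_of_linear {a b : ℤ} (hA : det A ≠ 0)
    (h : ∀ j, (∀ i, a * (B j).1 + b * (B j).2 < a * (A i).1 + b * (A i).2) ∨
      (∃ i, B j = A i) ∧ ∀ i, a * (B j).1 + b * (B j).2 ≤ a * (A i).1 + b * (A i).2)
    (hs : ∃ i j, a * (B j).1 + b * (B j).2 < a * (A i).1 + b * (A i).2) : Separated A B := by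
  intro w w' hw hw' h1 h1' hx hy
  obtain ⟨N, hN⟩ : ∃ N : ℤ × ℤ → ℤ, ∀ p, N p = a * p.1 + b * p.2 := ⟨_, fun _ => rfl⟩
  simp only [← hN] at h hs
  have hle : ∀ i j, N (B j) ≤ N (A i) := fun i j => (h j).elim (fun h => (h i).le) fun h => h.2 i
  have e : ∑ i, w i * (N (A i) : ℝ) = ∑ j, w' j * (N (B j) : ℝ) := by
    simp only [hN]
    push_cast
    have e1 : ∀ (C : Fin 3 → ℤ × ℤ) (v : Fin 3 → ℝ),
        ∑ i, v i * ((a : ℝ) * (C i).1 + b * (C i).2) =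
        a * ∑ i, v i * (C i).1 + b * ∑ i, v i * (C i).2 := fun C v => by
      simp only [Fin.sum_univ_three]; ring
    rw [e1, e1, hx, hy]
  -- The means of `N` on the two sides agree, while no value on `B` exceeds a value on `A`: every
  -- weighted gap vanishes.
  have hz : ∀ i j, w i * w' j * ((N (A i) : ℝ) - N (B j)) = 0 := by
    have h0 : ∑ p : Fin 3 × Fin 3, w p.1 * w' p.2 * ((N (A p.1) : ℝ) - N (B p.2)) = 0 := by
      rw [Fintype.sum_prod_type]
      have e2 : ∀ i, ∑ j, w i * w' j * ((N (A i) : ℝ) - N (B j)) =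
          w i * (N (A i) : ℝ) * ∑ j, w' j - w i * ∑ j, w' j * (N (B j) : ℝ) := fun i => by
        rw [Finset.mul_sum, Finset.mul_sum, ← Finset.sum_sub_distrib]
        exact Finset.sum_congr rfl fun j _ => by ring
      simp only [e2, h1', mul_one, Finset.sum_sub_distrib, ← Finset.sum_mul, h1, e]
      ring
    intro i j
    refine (Finset.sum_eq_zero_iff_of_nonneg (fun p _ => ?_)).1 h0 (i, j) (Finset.mem_univ _)
    have : (N (B p.2) : ℝ) ≤ N (A p.1) := by exact_mod_cast hle p.1 p.2
    exact mul_nonneg (mul_nonneg (hw _) (hw' _)) (sub_nonneg.2 this)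
  refine ⟨?_, fun hp hp' => ?_⟩
  · have hmem : ∀ j, ∃ i, w' j ≠ 0 → B j = A i := by
      intro j
      by_cases hj : w' j = 0
      · exact ⟨0, fun h => absurd hj h⟩
      obtain ⟨i, hi⟩ : ∃ i, w i ≠ 0 := by
        by_contra! hc
        simp [hc] at h1
      have h2 : N (A i) = N (B j) := by
        have := (mul_eq_zero.1 (hz i j)).resolve_left (mul_ne_zero hi hj)
        exact_mod_cast sub_eq_zero.1 this
      rcases h j with h3 | ⟨⟨k, hk⟩, -⟩
      · exact absurd h2 (h3 i).ne'
      · exact ⟨k, fun _ => hk⟩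
    choose g hg using hmem
    -- The vertices of `B` that carry weight are vertices of `A`. Their weights are transported
    -- there, and affine independence identifies them with `w`.
    obtain ⟨v, hv⟩ : ∃ v : Fin 3 → ℝ, v = fun i => ∑ j, if g j = i then w' j else 0 := ⟨_, rfl⟩
    have hsum : ∀ F : Fin 3 → ℝ, ∑ i, v i * F i = ∑ j, w' j * F (g j) := by
      intro F
      simp only [hv, Finset.sum_mul, ite_mul, zero_mul]
      rw [Finset.sum_comm]
      simp
    have hsum' : ∀ f : ℤ × ℤ → ℝ, ∑ i, v i * f (A i) = ∑ j, w' j * f (B j) := by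
      intro f
      rw [hsum]
      refine Finset.sum_congr rfl fun j _ => ?_
      by_cases hj : w' j = 0
      · simp [hj]
      · rw [hg j hj]
    have hwv : w - v = 0 := by
      apply eq_zero_of_sum_eq_zero hA
      · have := hsum fun _ => 1
        simp only [mul_one] at this
        simp [h1, this, h1']
      · have := hsum' fun p => p.1
        simp only [Pi.sub_apply, sub_mul, Finset.sum_sub_distrib, hx, this, sub_self]
      · have := hsum' fun p => p.2
        simp only [Pi.sub_apply, sub_mul, Finset.sum_sub_distrib, hy, this, sub_self]
    intro f
    rw [← hsum', sub_eq_zero.1 hwv]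
  · obtain ⟨i, j, hij⟩ := hs
    have h2 := (mul_eq_zero.1 (hz i j)).resolve_left (mul_pos (hp i) (hp' j)).ne'
    have h3 : N (A i) = N (B j) := by exact_mod_cast sub_eq_zero.1 h2
    omega

lemma separated_of_lt_fst {c : ℤ} (h1 : ∀ i, (A i).1 ≤ c) (h2 : ∀ i, c < (B i).1) :
    Separated A B := by
  intro w w' hw hw' hs hs' hx _
  exfalso
  have e1 : ∑ i, w i * ((A i).1 : ℝ) ≤ ∑ i, w i * (c : ℝ) := Finset.sum_le_sum fun i _ =>
    mul_le_mul_of_nonneg_left (by exact_mod_cast h1 i) (hw i)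
  have e2 : ∑ i, w' i * ((c + 1 : ℤ) : ℝ) ≤ ∑ i, w' i * ((B i).1 : ℝ) :=
    Finset.sum_le_sum fun i _ => mul_le_mul_of_nonneg_left (by exact_mod_cast h2 i) (hw' i)
  rw [← Finset.sum_mul, hs, one_mul] at e1
  rw [← Finset.sum_mul, hs', one_mul] at e2
  push_cast at e2
  linarith

lemma separated_of_lt_snd {c : ℤ} (h1 : ∀ i, (A i).2 ≤ c) (h2 : ∀ i, c < (B i).2) :
    Separated A B := by
  intro w w' hw hw' hs hs' _ hy
  exfalso
  have e1 : ∑ i, w i * ((A i).2 : ℝ) ≤ ∑ i, w i * (c : ℝ) := Finset.sum_le_sum fun i _ =>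
    mul_le_mul_of_nonneg_left (by exact_mod_cast h1 i) (hw i)
  have e2 : ∑ i, w' i * ((c + 1 : ℤ) : ℝ) ≤ ∑ i, w' i * ((B i).2 : ℝ) :=
    Finset.sum_le_sum fun i _ => mul_le_mul_of_nonneg_left (by exact_mod_cast h2 i) (hw' i)
  rw [← Finset.sum_mul, hs, one_mul] at e1
  rw [← Finset.sum_mul, hs', one_mul] at e2
  push_cast at e2
  linarith

end Separation

namespace Tri

lemma natMin_eq (a b : ℕ) : natMin a b = min a b := by
  unfold natMin
  by_cases h : a ≤ b
  · rw [Nat.ble_eq_true_of_le h, cond_true, min_eq_left h]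
  · have : Nat.ble a b = false := by rw [← Bool.not_eq_true, Nat.ble_eq]; exact h
    rw [this, cond_false, min_eq_right (by omega)]

lemma natMax_eq (a b : ℕ) : natMax a b = max a b := by
  unfold natMax
  by_cases h : a ≤ b
  · rw [Nat.ble_eq_true_of_le h, cond_true, max_eq_right h]
  · have : Nat.ble a b = false := by rw [← Bool.not_eq_true, Nat.ble_eq]; exact h
    rw [this, cond_false, max_eq_left (by omega)]

lemma corner_bounds (T : Tri) (i : Fin 3) : T.xMin ≤ (T.corner i).1 ∧ (T.corner i).1 ≤ T.xMax ∧
    T.yMin ≤ (T.corner i).2 ∧ (T.corner i).2 ≤ T.yMax := by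
  simp only [xMin, xMax, yMin, yMax, natMin_eq, natMax_eq]
  fin_cases i <;> simp [corner]

/-- The translate of a triangle. -/
def lift (T : Tri) (k m : ℤ) (i : Fin 3) : ℤ × ℤ :=
  ((T.corner i).1 + 4620 * k, (T.corner i).2 + 9240 * m)

def shifted (T : Tri) (s : ℕ × ℕ) (i : Fin 3) : ℤ × ℤ :=
  (((T.corner i).1 + s.1 : ℕ), ((T.corner i).2 + s.2 : ℕ))

lemma det_shifted_pos {T : Tri} (h : T ∈ triTable) (s : ℕ × ℕ) : 0 < det (T.shifted s) := by
  have := List.all_eq_true.1 positive_triTable T h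
  simp only [positive, Nat.ble_eq, Nat.succ_le_iff] at this
  zify at this
  simp only [det, shifted, corner, Matrix.cons_val_zero, Matrix.cons_val_one, Matrix.cons_val]
  push_cast
  linarith

lemma det_lift_pos {T : Tri} (h : T ∈ triTable) (k m : ℤ) : 0 < det (T.lift k m) := by
  have := List.all_eq_true.1 positive_triTable T h
  simp only [positive, Nat.ble_eq, Nat.succ_le_iff] at this
  zify at this
  simp only [det, lift, corner, Matrix.cons_val_zero, Matrix.cons_val_one, Matrix.cons_val]
  linarith

lemma separated_of_separates {n : ℤ × ℤ} {T T' : Tri} {s s' : ℕ × ℕ} (h : T ∈ triTable)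
    (hs : separates n (translate T s) (translate T' s') = true) :
    Separated (T.shifted s) (T'.shifted s') := by
  have e : ∀ (T : Tri) s, translate T s = [T.shifted s 0, T.shifted s 1, T.shifted s 2] :=
    fun T s => rfl
  rw [e, e] at hs
  rw [separates, Bool.and_eq_true] at hs
  obtain ⟨h1, h2⟩ := hs
  refine separated_of_linear (a := n.1) (b := n.2) (det_shifted_pos h s).ne' ?_ ?_
  · simpa [smaller, Fin.forall_fin_succ, Fin.exists_fin_succ, and_assoc] using h1
  · simp [smaller, Fin.exists_fin_succ] at h2 ⊢
    tauto

lemma separated_of_apart {T T' : Tri} {s : ℕ × ℕ} (h : T ∈ triTable) (h' : T' ∈ triTable)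
    (ha : apart s T T' = true) : Separated (T.shifted (9240, 0)) (T'.shifted s) := by
  have b := corner_bounds T
  have b' := corner_bounds T'
  simp only [apart, Bool.or_eq_true] at ha
  rcases ha with ha | ha
  · simp only [far, Bool.or_eq_true, Nat.ble_eq, Nat.succ_le_iff] at ha
    rcases ha with ha | ha | ha | ha
    · refine separated_of_lt_snd (c := T.yMax) (fun i => ?_) fun i => ?_ <;>
        simp only [shifted] <;> have := b i <;> have := b' i <;> omega
    · refine separated_of_lt_fst (c := T.xMax + 9240) (fun i => ?_) fun i => ?_ <;>
        simp only [shifted] <;> have := b i <;> have := b' i <;> omega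
    · refine (separated_of_lt_fst (c := T'.xMax + s.1) (fun i => ?_) fun i => ?_).symm <;>
        simp only [shifted] <;> have := b i <;> have := b' i <;> omega
    · refine (separated_of_lt_snd (c := T'.yMax + s.2) (fun i => ?_) fun i => ?_).symm <;>
        simp only [shifted] <;> have := b i <;> have := b' i <;> omega
  · obtain ⟨n, -, hn⟩ := List.any_eq_true.1 ha
    simp only [Bool.or_eq_true] at hn
    rcases hn with ((hn | hn) | hn) | hn
    · exact separated_of_separates h hn
    · exact (separated_of_separates h' hn).symm
    · exact separated_of_separates h hn
    · exact (separated_of_separates h' hn).symm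

lemma pairwise_of_allApart : ∀ {l : List Tri}, allApart l = true →
    l.Pairwise fun T T' => apart (9240, 0) T T' = true
  | [], _ => List.Pairwise.nil
  | _ :: _, h => by
    rw [allApart, Bool.and_eq_true, List.all_eq_true] at h
    exact List.Pairwise.cons h.1 (pairwise_of_allApart h.2)

lemma lift_bounds {T : Tri} (h : T ∈ triTable) (k m : ℤ) (i : Fin 3) :
    4620 * k ≤ (T.lift k m i).1 ∧ (T.lift k m i).1 ≤ 4620 * k + 10780 ∧
    9240 * m ≤ (T.lift k m i).2 ∧ (T.lift k m i).2 ≤ 9240 * m + 9240 := by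
  have h1 := List.all_eq_true.1 shortEdge_triTable T h
  simp only [Bool.and_eq_true, Nat.ble_eq] at h1
  have h2 := corner_bounds T i
  simp only [lift]
  omega

lemma separated_lift_of_apart {T T' : Tri} {s : ℕ × ℕ} {k m k' m' : ℤ} (h : T ∈ triTable)
    (h' : T' ∈ triTable) (ha : apart s T T' = true) (h1 : (s.1 : ℤ) = 9240 + 4620 * (k' - k))
    (h2 : (s.2 : ℤ) = 9240 * (m' - m)) : Separated (T.lift k m) (T'.lift k' m') := by
  refine (separated_of_apart h h' ha).translate (9240 - 4620 * k, - 9240 * m)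
    (fun i => ?_) fun i => ?_ <;>
  · apply Prod.ext <;> simp only [shifted, lift, Prod.fst_add,
        Prod.snd_add] <;> push_cast <;> linarith

end Tri

/-- A triangle of the table, and a translation. -/
abbrev TriIndex : Type := Fin triTable.length × ℤ × ℤ

/-- The vertices of a translated triangle. -/
def vertexAt (t : TriIndex) : Fin 3 → ℤ × ℤ := Tri.lift (triTable.get t.1) t.2.1 t.2.2

lemma det_vertexAt_pos (t : TriIndex) : 0 < det (vertexAt t) :=
  Tri.det_lift_pos (List.get_mem _ _) _ _

/-- Bounding boxes have width at most `10780 < 3 * 4620` and stay in one row of height `9240`. They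
settle shifts by three columns or two rows; the others are those verified on the table. -/
theorem separated_vertexAt {t t' : TriIndex} (h : t ≠ t') : Separated (vertexAt t) (vertexAt t')
    := by
  obtain ⟨j, k, m⟩ := t
  obtain ⟨j', k', m'⟩ := t'
  simp only [vertexAt]
  have hj := List.get_mem triTable j
  have hj' := List.get_mem triTable j'
  have hb := Tri.lift_bounds hj k m
  have hb' := Tri.lift_bounds hj' k' m'
  have key := Tri.apart_of_shift
  simp only [List.all_eq_true, Bool.and_eq_true] at key
  have c := key _ hj _ hj'
  have c' := key _ hj' _ hj
  by_cases x1 : k + 3 ≤ k'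
  · exact separated_of_lt_fst (c := 4620 * k + 10780) (fun i => (hb i).2.1) fun i => by
      have := (hb' i).1; omega
  by_cases x2 : k' + 3 ≤ k
  · exact (separated_of_lt_fst (c := 4620 * k' + 10780) (fun i => (hb' i).2.1) fun i => by
      have := (hb i).1; omega).symm
  by_cases y1 : m + 2 ≤ m'
  · exact separated_of_lt_snd (c := 9240 * m + 9240) (fun i => (hb i).2.2.2) fun i => by
      have := (hb' i).2.2.1; omega
  by_cases y2 : m' + 2 ≤ m
  · exact (separated_of_lt_snd (c := 9240 * m' + 9240) (fun i => (hb' i).2.2.2) fun i => by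
      have := (hb i).2.2.1; omega).symm
  obtain ⟨κ, hκ⟩ : ∃ κ, κ = k' - k := ⟨_, rfl⟩
  obtain ⟨μ, hμ⟩ : ∃ μ, μ = m' - m := ⟨_, rfl⟩
  have hk1 : -2 ≤ κ := by omega
  have hk2 : κ ≤ 2 := by omega
  have hm1 : -1 ≤ μ := by omega
  have hm2 : μ ≤ 1 := by omega
  have P := fun {s} (ha : Tri.apart s _ _ = true) => Tri.separated_lift_of_apart (k := k) (m := m)
    (k' := k') (m' := m') hj hj' ha
  have P' := fun {s} (ha : Tri.apart s _ _ = true) h1 h2 => (Tri.separated_lift_of_apart (k := k')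
    (m := m') (k' := k) (m' := m) hj' hj ha h1 h2).symm
  have hpw := Tri.pairwise_of_allApart Tri.allApart_triTable
  interval_cases μ <;> interval_cases κ
  · exact P' c'.2 (by simp; omega) (by simp; omega)
  · exact P' c'.1.2 (by simp; omega) (by simp; omega)
  · exact P' c'.1.1.2 (by simp; omega) (by simp; omega)
  · exact P' c'.1.1.1.2 (by simp; omega) (by simp; omega)
  · exact P' c'.1.1.1.1.2 (by simp; omega) (by simp; omega)
  · exact P' c'.1.1.1.1.1.2 (by simp; omega) (by simp; omega)
  · exact P' c'.1.1.1.1.1.1 (by simp; omega) (by simp; omega)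
  · rcases lt_trichotomy j j' with hlt | rfl | hlt
    · exact P (hpw.rel_get_of_lt hlt) (by simp; omega) (by simp; omega)
    · exact absurd (by rw [show k' = k by omega, show m' = m by omega]) h
    · exact P' (hpw.rel_get_of_lt hlt) (by simp; omega) (by simp; omega)
  · exact P c.1.1.1.1.1.1 (by simp; omega) (by simp; omega)
  · exact P c.1.1.1.1.1.2 (by simp; omega) (by simp; omega)
  · exact P c.1.1.1.1.2 (by simp; omega) (by simp; omega)
  · exact P c.1.1.1.2 (by simp; omega) (by simp; omega)
  · exact P c.1.1.2 (by simp; omega) (by simp; omega)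
  · exact P c.1.2 (by simp; omega) (by simp; omega)
  · exact P c.2 (by simp; omega) (by simp; omega)

end FlatTori
end

/-! ### The triangles cover the plane -/

noncomputable section
namespace FlatTori
open Set Filter Topology

/-- The point of the plane with given integer coordinates. -/
def intPoint (p : ℤ × ℤ) : ℂ := ⟨p.1, p.2⟩

/-- Twice the signed area of the triangle `p`, `q`, `z`. -/
def edgeSide (p q : ℤ × ℤ) (z : ℂ) : ℝ :=
  ((q.1 : ℝ) - p.1) * (z.im - p.2) - ((q.2 : ℝ) - p.2) * (z.re - p.1)

lemma continuous_edgeSide (p q : ℤ × ℤ) : Continuous (edgeSide p q) := by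
  unfold edgeSide
  exact (continuous_const.mul (Complex.continuous_im.sub continuous_const)).sub
    (continuous_const.mul (Complex.continuous_re.sub continuous_const))

lemma edgeSide_swap (p q : ℤ × ℤ) (z : ℂ) : edgeSide q p z = -edgeSide p q z := by
  unfold edgeSide; ring

/-- Near an inner point of a common edge, the plane is covered by the two triangles. -/
lemma eventually_mem_of_edge {a b c c' : ℤ × ℤ} (h : 0 < edgeSide a b (intPoint c))
    (h' : 0 < edgeSide b a (intPoint c')) {z : ℂ} (h0 : edgeSide a b z = 0)
    (h1 : 0 < edgeSide b c z) (h2 : 0 < edgeSide c a z) : ∀ᶠ y in 𝓝 z,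
      0 ≤ edgeSide a b y ∧ 0 ≤ edgeSide b c y ∧ 0 ≤ edgeSide c a y ∨
      0 ≤ edgeSide b a y ∧ 0 ≤ edgeSide a c' y ∧ 0 ≤ edgeSide c' b y := by
  -- On the line `a b`, the areas cut by `z` in the triangle with apex `c'` are proportional to
  -- those with apex `c`, with a positive factor; so `z` is inner to the edge for both.
  have e1 : edgeSide a c' z * edgeSide a b (intPoint c) =
      edgeSide c a z * edgeSide b a (intPoint c') +
      edgeSide a b z * edgeSide a c' (intPoint c) := by
    unfold edgeSide intPoint; ring
  have e2 : edgeSide c' b z * edgeSide a b (intPoint c) =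
      edgeSide b c z * edgeSide b a (intPoint c') +
      edgeSide a b z * edgeSide c' b (intPoint c) := by
    unfold edgeSide intPoint; ring
  rw [h0, zero_mul, add_zero] at e1 e2
  have h3 : 0 < edgeSide a c' z := (pos_iff_pos_of_mul_pos (e1 ▸ mul_pos h2 h')).2 h
  have h4 : 0 < edgeSide c' b z := (pos_iff_pos_of_mul_pos (e2 ▸ mul_pos h1 h')).2 h
  filter_upwards [(continuous_edgeSide b c).continuousAt.eventually_const_lt h1,
    (continuous_edgeSide c a).continuousAt.eventually_const_lt h2,
    (continuous_edgeSide a c').continuousAt.eventually_const_lt h3,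
    (continuous_edgeSide c' b).continuousAt.eventually_const_lt h4] with y y1 y2 y3 y4
  rcases le_total 0 (edgeSide a b y) with hy | hy
  · exact Or.inl ⟨hy, y1.le, y2.le⟩
  · exact Or.inr ⟨by rw [edgeSide_swap]; linarith, y3.le, y4.le⟩

/-- The closed triangle, in the plane of integer coordinates. -/
def closedTri (A : Fin 3 → ℤ × ℤ) : Set ℂ :=
  {z | 0 ≤ edgeSide (A 0) (A 1) z ∧ 0 ≤ edgeSide (A 1) (A 2) z ∧ 0 ≤ edgeSide (A 2) (A 0) z}

lemma mem_closedTri_rotate {A : Fin 3 → ℤ × ℤ} (i : Fin 3) {z : ℂ} : z ∈ closedTri A ↔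
    0 ≤ edgeSide (A i) (A (i + 1)) z ∧ 0 ≤ edgeSide (A (i + 1)) (A (i + 2)) z ∧
      0 ≤ edgeSide (A (i + 2)) (A i) z := by
  unfold closedTri
  fin_cases i
  · exact Iff.rfl
  · change (_ ∧ _ ∧ _) ↔ (_ ∧ 0 ≤ edgeSide (A 2) (A 0) z ∧ 0 ≤ edgeSide (A 0) (A 1) z)
    tauto
  · change (_ ∧ _ ∧ _) ↔ (_ ∧ 0 ≤ edgeSide (A 0) (A 1) z ∧ 0 ≤ edgeSide (A 1) (A 2) z)
    tauto

lemma det_rotate (A : Fin 3 → ℤ × ℤ) (i : Fin 3) :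
    edgeSide (A i) (A (i + 1)) (intPoint (A (i + 2))) = det A := by
  fin_cases i
  · change edgeSide (A 0) (A 1) (intPoint (A 2)) = _
    unfold edgeSide det intPoint; push_cast; ring
  · change edgeSide (A 1) (A 2) (intPoint (A 0)) = _
    unfold edgeSide det intPoint; push_cast; ring
  · change edgeSide (A 2) (A 0) (intPoint (A 1)) = _
    unfold edgeSide det intPoint; push_cast; ring

lemma isClosed_closedTri (A : Fin 3 → ℤ × ℤ) : IsClosed (closedTri A) :=
  (isClosed_le continuous_const (continuous_edgeSide _ _)).inter
    ((isClosed_le continuous_const (continuous_edgeSide _ _)).inter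
      (isClosed_le continuous_const (continuous_edgeSide _ _)))

/-- Barycentric coordinates in a triangle. -/
lemma exists_weights {A : Fin 3 → ℤ × ℤ} (hA : 0 < det A) {z : ℂ} (hz : z ∈ closedTri A) :
    ∃ w : Fin 3 → ℝ, (∀ i, 0 ≤ w i) ∧ ∑ i, w i = 1 ∧ z.re = ∑ i, w i * (A i).1 ∧
      z.im = ∑ i, w i * (A i).2 := by
  have hd : (0 : ℝ) < det A := by exact_mod_cast hA
  obtain ⟨h0, h1, h2⟩ := hz
  have hdet : (det A : ℝ) = edgeSide (A 0) (A 1) z + edgeSide (A 1) (A 2) z +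
      edgeSide (A 2) (A 0) z := by
    unfold edgeSide det; push_cast; ring
  refine ⟨![edgeSide (A 1) (A 2) z / det A, edgeSide (A 2) (A 0) z / det A,
    edgeSide (A 0) (A 1) z / det A], fun i => ?_, ?_, ?_, ?_⟩
  · fin_cases i
    · exact div_nonneg h1 hd.le
    · exact div_nonneg h2 hd.le
    · exact div_nonneg h0 hd.le
  · simp only [Fin.sum_univ_three, Matrix.cons_val_zero, Matrix.cons_val_one, Matrix.cons_val]
    rw [← add_div, ← add_div, div_eq_one_iff_eq hd.ne', hdet]; ring
  · simp only [Fin.sum_univ_three, Matrix.cons_val_zero, Matrix.cons_val_one, Matrix.cons_val]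
    field_simp
    rw [hdet]
    unfold edgeSide; ring
  · simp only [Fin.sum_univ_three, Matrix.cons_val_zero, Matrix.cons_val_one, Matrix.cons_val]
    field_simp
    rw [hdet]
    unfold edgeSide; ring

namespace Tri

lemma exists_reverse_of_reverses {T T' : Tri} {i i' : Fin 3} (k m : ℤ)
    (h : reverses (T.corner i) (T.corner (i + 1)) (T'.corner i') (T'.corner (i' + 1)) = true) :
    ∃ k' m' : ℤ, T'.lift k' m' i' = T.lift k m (i + 1) ∧ T'.lift k' m' (i' + 1) = T.lift k m i := by
  simp only [reverses, Bool.and_eq_true, Nat.beq_eq] at h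
  obtain ⟨h1, h2, h3, h4⟩ := h
  refine ⟨k - (((T'.corner i').1 : ℤ) - (T.corner (i + 1)).1) / 4620,
    m - (((T'.corner i').2 : ℤ) - (T.corner (i + 1)).2) / 9240, ?_, ?_⟩ <;>
  · apply Prod.ext <;> simp only [lift] <;> omega

end Tri

lemma exists_reverse (t : TriIndex) (i : Fin 3) : ∃ (t' : TriIndex) (i' : Fin 3),
    vertexAt t' i' = vertexAt t (i + 1) ∧ vertexAt t' (i' + 1) = vertexAt t i := by
  obtain ⟨j, k, m⟩ := t
  have h := List.all_eq_true.1 Tri.hasReverse_triTable _ (List.get_mem triTable j)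
  obtain ⟨T, hT⟩ : ∃ T, T = triTable.get j := ⟨_, rfl⟩
  rw [← hT] at h
  have h1 : Tri.hasReverse (T.corner i) (T.corner (i + 1)) = true := by
    rw [Bool.and_eq_true, Bool.and_eq_true] at h
    fin_cases i
    · exact h.1
    · exact h.2.1
    · exact h.2.2
  obtain ⟨T', hT', h2⟩ := List.any_eq_true.1 h1
  obtain ⟨j', hj'⟩ := List.mem_iff_get.1 hT'
  obtain ⟨i', hi'⟩ : ∃ i' : Fin 3, Tri.reverses (T.corner i) (T.corner (i + 1)) (T'.corner i')
      (T'.corner (i' + 1)) = true := by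
    rw [Bool.or_eq_true, Bool.or_eq_true] at h2
    rcases h2 with h2 | h2 | h2
    · exact ⟨0, h2⟩
    · exact ⟨1, h2⟩
    · exact ⟨2, h2⟩
  obtain ⟨k', m', h3⟩ := Tri.exists_reverse_of_reverses k m hi'
  refine ⟨(j', k', m'), i', ?_⟩
  simp only [vertexAt, hj', ← hT]
  exact h3

lemma vertexAt_bounds (t : TriIndex) (i : Fin 3) :
    4620 * t.2.1 ≤ (vertexAt t i).1 ∧ (vertexAt t i).1 ≤ 4620 * t.2.1 + 10780 ∧
    9240 * t.2.2 ≤ (vertexAt t i).2 ∧ (vertexAt t i).2 ≤ 9240 * t.2.2 + 9240 :=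
  Tri.lift_bounds (List.get_mem _ _) _ _ _

lemma convex_combination_bounds {w x : Fin 3 → ℝ} (hw : ∀ i, 0 ≤ w i) (h1 : ∑ i, w i = 1) {a b : ℝ}
    (ha : ∀ i, a ≤ x i) (hb : ∀ i, x i ≤ b) : a ≤ ∑ i, w i * x i ∧ ∑ i, w i * x i ≤ b := by
  constructor
  · calc a = ∑ i, w i * a := by rw [← Finset.sum_mul, h1, one_mul]
      _ ≤ _ := Finset.sum_le_sum fun i _ => mul_le_mul_of_nonneg_left (ha i) (hw i)
  · calc _ ≤ ∑ i, w i * b := Finset.sum_le_sum fun i _ => mul_le_mul_of_nonneg_left (hb i) (hw i)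
      _ = b := by rw [← Finset.sum_mul, h1, one_mul]

lemma locallyFinite_closedTri : LocallyFinite fun t : TriIndex => closedTri (vertexAt t) := by
  intro x
  refine ⟨Metric.ball x 1, Metric.ball_mem_nhds x one_pos, ?_⟩
  obtain ⟨N, hN⟩ := exists_nat_ge (‖x‖ + 20000)
  refine Set.Finite.subset (Set.toFinite ((Finset.univ ×ˢ Finset.Icc (-(N : ℤ)) N ×ˢ
    Finset.Icc (-(N : ℤ)) N : Finset TriIndex) : Set TriIndex)) ?_
  rintro t ⟨z, hz, hzx⟩
  obtain ⟨w, hw, h1, hre, him⟩ := exists_weights (det_vertexAt_pos t) hz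
  have b1 := convex_combination_bounds hw h1 (x := fun i => ((vertexAt t i).1 : ℝ))
    (fun i => (by exact_mod_cast (vertexAt_bounds t i).1 : (4620 * t.2.1 : ℝ) ≤ _))
    (fun i => (by exact_mod_cast (vertexAt_bounds t i).2.1 : _ ≤ (4620 * t.2.1 + 10780 : ℝ)))
  have b2 := convex_combination_bounds hw h1 (x := fun i => ((vertexAt t i).2 : ℝ))
    (fun i => (by exact_mod_cast (vertexAt_bounds t i).2.2.1 : (9240 * t.2.2 : ℝ) ≤ _))
    (fun i => (by exact_mod_cast (vertexAt_bounds t i).2.2.2 : _ ≤ (9240 * t.2.2 + 9240 : ℝ)))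
  rw [← hre] at b1
  rw [← him] at b2
  have hn : ‖z‖ ≤ ‖x‖ + 1 := by
    have := norm_le_norm_add_norm_sub x z
    rw [Metric.mem_ball, dist_eq_norm, norm_sub_rev] at hzx
    rw [norm_sub_rev] at this
    linarith [norm_sub_rev x z]
  have r1 := (Complex.abs_re_le_norm z).trans hn
  have r2 := (Complex.abs_im_le_norm z).trans hn
  rw [abs_le] at r1 r2
  have q1 : |(t.2.1 : ℝ)| ≤ N := by
    have := norm_nonneg x
    rw [abs_le]; constructor <;> linarith
  have q2 : |(t.2.2 : ℝ)| ≤ N := by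
    have := norm_nonneg x
    rw [abs_le]; constructor <;> linarith
  simp only [Finset.coe_product, Set.mem_prod, Finset.coe_univ, Set.mem_univ, true_and,
    Finset.mem_coe, Finset.mem_Icc, ← abs_le]
  exact ⟨by exact_mod_cast q1, by exact_mod_cast q2⟩

/-- The union of the triangles contains a neighborhood of each of its points that is not a
vertex. -/
lemma iUnion_closedTri_mem_nhds {t : TriIndex} {z : ℂ} (hz : z ∈ closedTri (vertexAt t))
    (hz' : z ∉ range intPoint) : (⋃ t, closedTri (vertexAt t)) ∈ 𝓝 z := by
  by_cases hi : ∃ i, edgeSide (vertexAt t i) (vertexAt t (i + 1)) z = 0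
  · obtain ⟨i, hi⟩ := hi
    obtain ⟨t', i', h1, h2⟩ := exists_reverse t i
    have hd : (0 : ℝ) < det (vertexAt t) := by exact_mod_cast det_vertexAt_pos t
    have hd' : (0 : ℝ) < det (vertexAt t') := by exact_mod_cast det_vertexAt_pos t'
    have hr := det_rotate (vertexAt t) i
    have hr' := det_rotate (vertexAt t') i'
    rw [h1, h2] at hr'
    obtain ⟨-, p1, p2⟩ := (mem_closedTri_rotate i).1 hz
    generalize hA : vertexAt t i = a at *
    generalize hB : vertexAt t (i + 1) = b at *
    generalize hC : vertexAt t (i + 2) = c at *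
    have hsum : edgeSide b c z + edgeSide c a z = edgeSide a b (intPoint c) := by
      rw [← add_zero (_ + _), ← hi]; unfold edgeSide intPoint; ring
    have hre : edgeSide a b (intPoint c) * z.re = edgeSide b c z * a.1 + edgeSide c a z * b.1 := by
      rw [← add_zero (_ + _), ← zero_mul (c.1 : ℝ), ← hi]; unfold edgeSide intPoint; ring
    have him : edgeSide a b (intPoint c) * z.im = edgeSide b c z * a.2 + edgeSide c a z * b.2 := by
      rw [← add_zero (_ + _), ← zero_mul (c.2 : ℝ), ← hi]; unfold edgeSide intPoint; ring
    have hD : 0 < edgeSide a b (intPoint c) := hr ▸ hd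
    -- If a second area vanished, `z` would be a vertex, hence a point with integer coordinates.
    have hq1 : 0 < edgeSide b c z := by
      refine p1.lt_of_ne' fun h0 => hz' ⟨b, ?_⟩
      rw [h0, zero_add] at hsum
      rw [h0, zero_mul, zero_add, ← hsum] at hre him
      rw [← hsum] at hD
      apply Complex.ext
      · exact (mul_left_cancel₀ hD.ne' hre).symm
      · exact (mul_left_cancel₀ hD.ne' him).symm
    have hq2 : 0 < edgeSide c a z := by
      refine p2.lt_of_ne' fun h0 => hz' ⟨a, ?_⟩
      rw [h0, add_zero] at hsum
      rw [h0, zero_mul, add_zero, ← hsum] at hre him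
      rw [← hsum] at hD
      apply Complex.ext
      · exact (mul_left_cancel₀ hD.ne' hre).symm
      · exact (mul_left_cancel₀ hD.ne' him).symm
    filter_upwards [eventually_mem_of_edge hD (hr' ▸ hd') hi hq1 hq2] with y hy
    rcases hy with hy | hy
    · refine mem_iUnion.2 ⟨t, (mem_closedTri_rotate i).2 ?_⟩
      rwa [hA, hB, hC]
    · refine mem_iUnion.2 ⟨t', (mem_closedTri_rotate i').2 ?_⟩
      rwa [h1, h2]
  · push Not at hi
    obtain ⟨p0, p1, p2⟩ := hz
    filter_upwards [(continuous_edgeSide _ _).continuousAt.eventually_const_lt (p0.lt_of_ne'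
        (hi 0)),
      (continuous_edgeSide _ _).continuousAt.eventually_const_lt (p1.lt_of_ne' (hi 1)),
      (continuous_edgeSide _ _).continuousAt.eventually_const_lt (p2.lt_of_ne' (hi 2))]
      with y y0 y1 y2
    exact mem_iUnion.2 ⟨t, y0.le, y1.le, y2.le⟩

/-- The triangles cover the plane. -/
theorem iUnion_closedTri : ⋃ t, closedTri (vertexAt t) = univ := by
  obtain ⟨S, hS⟩ : ∃ S, S = ⋃ t, closedTri (vertexAt t) := ⟨_, rfl⟩
  have hcl : IsClosed S := hS ▸ locallyFinite_closedTri.isClosed_iUnion fun t =>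
      isClosed_closedTri _
  -- The complement of a countable set of the plane is connected and dense. The union is closed, and
  -- a neighborhood of each of its points in this complement, so it contains the complement and then
  -- everything.
  have hc : (range intPoint).Countable := countable_range _
  have hdense : Dense (range intPoint)ᶜ := hc.dense_compl ℝ
  have hconn : IsPreconnected (range intPoint)ᶜ :=
    (hc.isConnected_compl_of_one_lt_rank (by simp)).isPreconnected
  have hint : ∀ z ∈ S, z ∉ range intPoint → z ∈ interior S := fun z hz hz' => by
    rw [hS] at hz ⊢
    obtain ⟨t, ht⟩ := mem_iUnion.1 hz
    exact mem_interior_iff_mem_nhds.2 (iUnion_closedTri_mem_nhds ht hz')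
  have hne : (interior S).Nonempty := by
    obtain ⟨t⟩ : Nonempty TriIndex := ⟨⟨0, by rw [Tri.length_triTable]; norm_num⟩, 0, 0⟩
    have hd : (0 : ℝ) < det (vertexAt t) := by exact_mod_cast det_vertexAt_pos t
    have h3 : ∃ z : ℂ, ∀ i, 0 < edgeSide (vertexAt t i) (vertexAt t (i + 1)) z := by
      refine ⟨⟨(((vertexAt t 0).1 : ℝ) + (vertexAt t 1).1 + (vertexAt t 2).1) / 3,
        (((vertexAt t 0).2 : ℝ) + (vertexAt t 1).2 + (vertexAt t 2).2) / 3⟩, fun i => ?_⟩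
      have e : ∀ i, edgeSide (vertexAt t i) (vertexAt t (i + 1))
          ⟨(((vertexAt t 0).1 : ℝ) + (vertexAt t 1).1 + (vertexAt t 2).1) / 3,
          (((vertexAt t 0).2 : ℝ) + (vertexAt t 1).2 + (vertexAt t 2).2) / 3⟩ =
          (det (vertexAt t) : ℝ) / 3 := by
        intro i
        fin_cases i
        · change edgeSide (vertexAt t 0) (vertexAt t 1) _ = _
          unfold edgeSide det; push_cast; ring
        · change edgeSide (vertexAt t 1) (vertexAt t 2) _ = _
          unfold edgeSide det; push_cast; ring
        · change edgeSide (vertexAt t 2) (vertexAt t 0) _ = _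
          unfold edgeSide det; push_cast; ring
      rw [e]
      positivity
    obtain ⟨z, hz⟩ := h3
    refine ⟨z, mem_interior_iff_mem_nhds.2 ?_⟩
    rw [hS]
    filter_upwards [(continuous_edgeSide _ _).continuousAt.eventually_const_lt (hz 0),
      (continuous_edgeSide _ _).continuousAt.eventually_const_lt (hz 1),
      (continuous_edgeSide _ _).continuousAt.eventually_const_lt (hz 2)] with y y0 y1 y2
    exact mem_iUnion.2 ⟨t, y0.le, y1.le, y2.le⟩
  have hsub : (range intPoint)ᶜ ⊆ interior S := by
    refine hconn.subset_of_closure_inter_subset isOpen_interior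
      (hdense.inter_open_nonempty _ isOpen_interior hne |>.mono (by rw [inter_comm])) ?_
    rintro z ⟨hz, hz'⟩
    exact hint z (hcl.closure_subset_iff.2 interior_subset hz) hz'
  rw [← hS, ← univ_subset_iff, ← hdense.closure_eq]
  exact hcl.closure_subset_iff.2 (hsub.trans interior_subset)

end FlatTori
end

/-! ### The abstract complex on the torus and its 2204 triangles -/

noncomputable section
namespace FlatTori
open Set

/-! ### The complex -/

/-- The class of a point of integer coordinates in the torus. -/
def torusClass (p : ℤ × ℤ) : ZMod 87780 × ZMod 9240 := (p.1, p.2)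

lemma torusClass_eq_iff {p q : ℤ × ℤ} :
    torusClass p = torusClass q ↔ (87780 : ℤ) ∣ q.1 - p.1 ∧ (9240 : ℤ) ∣ q.2 - p.2 := by
  unfold torusClass
  rw [Prod.mk.injEq, ZMod.intCast_eq_intCast_iff_dvd_sub, ZMod.intCast_eq_intCast_iff_dvd_sub]
  rfl

/-- The vertices of the common refinement. -/
abbrev TorusVertex : Type := range fun p : TriIndex × Fin 3 => torusClass (vertexAt p.1 p.2)

instance : Fintype TorusVertex := Fintype.ofFinite _

instance : DecidableEq TorusVertex := Classical.decEq _

/-- The classes of the vertices of a triangle. -/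
def vertexClass (t : TriIndex) (i : Fin 3) : TorusVertex := ⟨_, (t, i), rfl⟩

lemma vertexClass_eq_iff {t t' : TriIndex} {i i' : Fin 3} :
    vertexClass t i = vertexClass t' i' ↔ (87780 : ℤ) ∣ (vertexAt t' i').1 - (vertexAt t i).1 ∧
      (9240 : ℤ) ∣ (vertexAt t' i').2 - (vertexAt t i).2 := by
  rw [← torusClass_eq_iff]
  exact Subtype.ext_iff

lemma vertexAt_injective (t : TriIndex) : Function.Injective (vertexAt t) := by
  have h := det_vertexAt_pos t
  unfold det at h
  intro i i' hi
  by_contra hne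
  fin_cases i <;> fin_cases i' <;> first | exact hne rfl | skip
  all_goals
    simp only [Fin.zero_eta, Fin.mk_one, Fin.reduceFinMk] at hi
    rw [hi] at h
    ring_nf at h
    exact lt_irrefl _ h

/-- This makes an edge recoverable from its end points modulo the periods. Heights are at most half
the period `9240`; the ambiguity between `4620` and `-4620` is removed since edges of that height
rise from the lower boundary. Widths, at most `10780`, are far below half of `87780`. -/
lemma shortEdge_vertexAt (t : TriIndex) (i i' : Fin 3) :
    (vertexAt t i').2 ≤ (vertexAt t i).2 + 4620 ∧
      ((vertexAt t i').2 = (vertexAt t i).2 + 4620 → (vertexAt t i).2 % 9240 = 0) := by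
  obtain ⟨j, k, m⟩ := t
  obtain ⟨T, hT⟩ : ∃ T, T = triTable.get j := ⟨_, rfl⟩
  have h := List.all_eq_true.1 Tri.shortEdge_triTable _ (List.get_mem triTable j)
  simp only [vertexAt]
  rw [← hT] at h ⊢
  have key : ∀ a b : ℕ × ℕ, Tri.shortEdge a b = true →
      (b.2 : ℤ) + 9240 * m ≤ a.2 + 9240 * m + 4620 ∧
      ((b.2 : ℤ) + 9240 * m = a.2 + 9240 * m + 4620 → ((a.2 : ℤ) + 9240 * m) % 9240 = 0) := by
    intro a b hab
    simp only [Tri.shortEdge, Bool.and_eq_true, Bool.or_eq_true, Nat.ble_eq, Nat.beq_eq,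
      Bool.not_eq_true', ← Bool.not_eq_true] at hab
    omega
  simp only [Bool.and_eq_true] at h
  obtain ⟨⟨⟨⟨⟨⟨⟨h01, h10⟩, h12⟩, h21⟩, h02⟩, h20⟩, -⟩, -⟩ := h
  unfold Tri.lift
  fin_cases i <;> fin_cases i'
  · constructor <;> intros <;> omega
  · exact key _ _ h01
  · exact key _ _ h02
  · exact key _ _ h10
  · constructor <;> intros <;> omega
  · exact key _ _ h12
  · exact key _ _ h20
  · exact key _ _ h21
  · constructor <;> intros <;> omega

/-- Two lifts of the same edge differ by a translation. -/
lemma sub_eq_sub_of_vertexClass_eq {t t' : TriIndex} {i i' j j' : Fin 3}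
    (h : vertexClass t i = vertexClass t' i') (h' : vertexClass t j = vertexClass t' j') :
    vertexAt t' j' - vertexAt t j = vertexAt t' i' - vertexAt t i := by
  rw [vertexClass_eq_iff] at h h'
  have b1 := vertexAt_bounds t i
  have b2 := vertexAt_bounds t j
  have b3 := vertexAt_bounds t' i'
  have b4 := vertexAt_bounds t' j'
  have s1 := shortEdge_vertexAt t i j
  have s2 := shortEdge_vertexAt t j i
  have s3 := shortEdge_vertexAt t' i' j'
  have s4 := shortEdge_vertexAt t' j' i'
  apply Prod.ext <;> simp only [Prod.fst_sub, Prod.snd_sub] <;> omega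

lemma vertexClass_injective (t : TriIndex) : Function.Injective (vertexClass t) := by
  intro i j h
  have := sub_eq_sub_of_vertexClass_eq (t := t) (t' := t) (i := i) (i' := i) (j := i) (j'
      := j) rfl h
  rw [sub_self, sub_eq_zero] at this
  exact (vertexAt_injective t this).symm

/-- The translate of a triangle by a period. -/
def periodShift (t : TriIndex) (a b : ℤ) : TriIndex := (t.1, t.2.1 + 19 * a, t.2.2 + b)

lemma vertexAt_periodShift (t : TriIndex) (a b : ℤ) (i : Fin 3) :
    vertexAt (periodShift t a b) i = vertexAt t i + (87780 * a, 9240 * b) := by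
  apply Prod.ext <;> simp only [vertexAt, periodShift, Tri.lift, Prod.fst_add,
      Prod.snd_add] <;> ring

lemma vertexClass_periodShift (t : TriIndex) (a b : ℤ) :
    vertexClass (periodShift t a b) = vertexClass t := by
  funext i
  rw [vertexClass_eq_iff, vertexAt_periodShift]
  exact ⟨⟨-a, by simp⟩, ⟨-b, by simp⟩⟩

/-- The vertices of a face of dimension two. -/
def faceOf (t : TriIndex) : Finset TorusVertex := Finset.univ.image (vertexClass t)

lemma mem_faceOf {t : TriIndex} {v : TorusVertex} : v ∈ faceOf t ↔ ∃ i, vertexClass t i = v := by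
  simp [faceOf]

lemma card_faceOf (t : TriIndex) : (faceOf t).card = 3 := by
  rw [faceOf, Finset.card_image_of_injective _ (vertexClass_injective t)]
  simp

lemma faceOf_periodShift (t : TriIndex) (a b : ℤ) : faceOf (periodShift t a b) = faceOf t := by
  rw [faceOf, vertexClass_periodShift, faceOf]

/-- The triangles of a fundamental domain. -/
def baseTri (p : Fin triTable.length × Fin 19) : TriIndex := (p.1, (p.2 : ℕ), 0)

lemma exists_baseTri (t : TriIndex) : ∃ p a b, t = periodShift (baseTri p) a b := by
  obtain ⟨j, k, m⟩ := t
  refine ⟨(j, ⟨(k % 19).toNat, by omega⟩), k / 19, m, ?_⟩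
  simp only [periodShift, baseTri, Prod.mk.injEq, true_and]
  omega

lemma exists_faceOf_baseTri (t : TriIndex) : ∃ p, faceOf t = faceOf (baseTri p) := by
  obtain ⟨p, a, b, rfl⟩ := exists_baseTri t
  exact ⟨p, faceOf_periodShift _ a b⟩

/-- The common refinement of the three triangulations of the torus. -/
def refinement : AbstractSimplicialComplex TorusVertex where
  faces := {σ | σ.Nonempty ∧ ∃ t, σ ⊆ faceOf t}
  isRelLowerSet_faces := fun σ hσ => ⟨hσ.1, fun τ hτ hne => ⟨hne, hσ.2.imp fun _ h => hτ.trans h⟩⟩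
  singleton_mem := fun v => by
    obtain ⟨⟨t, i⟩, hv⟩ := v.2
    exact ⟨Finset.singleton_nonempty v, t, Finset.singleton_subset_iff.2
      (mem_faceOf.2 ⟨i, Subtype.ext hv⟩)⟩

/-- Triangles with the same vertices differ by a period. -/
lemma faceOf_baseTri_injective : Function.Injective fun p => faceOf (baseTri p) := by
  intro p p' h
  simp only at h
  obtain ⟨i', hi'⟩ := mem_faceOf.1 (h ▸ mem_faceOf.2 ⟨0, rfl⟩ :
    vertexClass (baseTri p) 0 ∈ faceOf (baseTri p'))
  obtain ⟨⟨a, ha⟩, b, hb⟩ := vertexClass_eq_iff.1 hi'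
  obtain ⟨t, ht⟩ : ∃ t, t = periodShift (baseTri p') a b := ⟨_, rfl⟩
  have h0 : vertexAt t i' = vertexAt (baseTri p) 0 := by
    rw [ht, vertexAt_periodShift]
    apply Prod.ext
    · simp only [Prod.fst_add]; omega
    · simp only [Prod.snd_add]; omega
  have h1 : ∀ i, ∃ j, vertexAt t j = vertexAt (baseTri p) i := by
    intro i
    obtain ⟨j, hj⟩ := mem_faceOf.1 (h ▸ mem_faceOf.2 ⟨i, rfl⟩ :
      vertexClass (baseTri p) i ∈ faceOf (baseTri p'))
    rw [← vertexClass_periodShift _ a b, ← ht] at hi' hj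
    have := sub_eq_sub_of_vertexClass_eq hi'.symm hj.symm
    rw [h0, sub_self, sub_eq_zero] at this
    exact ⟨j, this⟩
  choose g hg using h1
  have hinj : Function.Injective g := fun i j hij => vertexAt_injective (baseTri p) (by
    rw [← hg, ← hg, hij])
  have hbij := Finite.injective_iff_bijective.1 hinj
  -- Distinct triangles with the same three vertices would share their barycenter, interior to both,
  -- against `separated_vertexAt`.
  have htt : baseTri p = t := by
    by_contra hne
    have hs : ∀ f : ℤ × ℤ → ℝ, ∑ i, (1 / 3 : ℝ) * f (vertexAt (baseTri p) i) =
        ∑ i, (1 / 3 : ℝ) * f (vertexAt t i) := fun f => by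
      rw [← hbij.sum_comp fun i => (1 / 3 : ℝ) * f (vertexAt t i)]
      simp only [hg]
    exact (separated_vertexAt hne (fun _ => 1 / 3) (fun _ => 1 / 3) (by intro; positivity)
      (by intro; positivity) (by simp) (by simp) (hs fun p => p.1) (hs fun p => p.2)).2
      (by intro; positivity) (by intro; positivity)
  rw [ht] at htt
  simp only [baseTri, periodShift, Prod.mk.injEq] at htt
  obtain ⟨e1, e2, -⟩ := htt
  refine Prod.ext e1 (Fin.ext ?_)
  have := p.2.2
  have := p'.2.2
  omega

/-- Modulo the periods there remain the 116 triangles of the table in each of the 19 columns. -/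
theorem numTriangles_refinement : numTriangles refinement = 2204 := by
  have h : {σ : Finset TorusVertex | σ ∈ refinement.faces ∧ σ.card = 3} =
      range fun p => faceOf (baseTri p) := by
    ext σ
    constructor
    · rintro ⟨⟨-, t, ht⟩, hc⟩
      obtain ⟨p, hp⟩ := exists_faceOf_baseTri t
      refine ⟨p, ?_⟩
      rw [hp] at ht
      exact (Finset.eq_of_subset_of_card_le ht (by rw [card_faceOf, hc])).symm
    · rintro ⟨p, rfl⟩
      exact ⟨⟨Finset.card_pos.1 (by rw [card_faceOf]; norm_num), baseTri p, Finset.Subset.rfl⟩,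
        card_faceOf _⟩
  unfold numTriangles
  rw [h, Set.ncard_range_of_injective faceOf_baseTri_injective, Nat.card_eq_fintype_card,
    Fintype.card_prod, Fintype.card_fin, Fintype.card_fin, Tri.length_triTable]

end FlatTori
end

/-! ### The homeomorphism with the torus and the subdivision property -/

noncomputable section
namespace FlatTori
open Set

/-! ### The homeomorphism with the torus -/

lemma layout_eq_iff {z z' : ℂ} : (z : LayoutTorus 19) = z' ↔
    ∃ m n : ℤ, z' = z + (m * (19 : ℕ) + n * (2 * Complex.I)) := by
  rw [QuotientAddGroup.eq, mem_lattice_iff]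
  simp only [neg_add_eq_iff_eq_add]

lemma isClosed_layoutLattice : IsClosed (lattice (19 : ℕ) (2 * Complex.I) : Set ℂ) := by
  have h : (lattice (19 : ℕ) (2 * Complex.I) : Set ℂ) =
      (fun z : ℂ => z.re / 19) ⁻¹' range ((↑) : ℤ → ℝ) ∩
        (fun z : ℂ => z.im / 2) ⁻¹' range ((↑) : ℤ → ℝ) := by
    ext z
    rw [SetLike.mem_coe, mem_lattice_iff]
    constructor
    · rintro ⟨m, n, rfl⟩
      exact ⟨⟨m, by simp⟩, n, by simp⟩
    · rintro ⟨⟨m, hm⟩, n, hn⟩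
      refine ⟨m, n, Complex.ext ?_ ?_⟩
      · simp only at hm; simp [hm]
      · simp only at hn; simp [hn]
  rw [h]
  have hr : IsClosed (range ((↑) : ℤ → ℝ)) := Int.isClosedEmbedding_coe_real.isClosed_range
  exact (hr.preimage (Complex.continuous_re.div_const _)).inter
    (hr.preimage (Complex.continuous_im.div_const _))

instance : T2Space (LayoutTorus 19) := by
  have : IsClosed (lattice (19 : ℕ) (2 * Complex.I) : Set ℂ) := isClosed_layoutLattice
  infer_instance

/-- The point of the strip with the given integer coordinates. -/
def stripPoint (p : ℤ × ℤ) : ℂ := ⟨p.1 / 4620, p.2 / 4620 - 1⟩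

/-- The positions of the vertices of a triangle. -/
def facePoint (t : TriIndex) (v : TorusVertex) : ℂ :=
  ∑ i, if vertexClass t i = v then stripPoint (vertexAt t i) else 0

lemma facePoint_vertexClass (t : TriIndex) (i : Fin 3) :
    facePoint t (vertexClass t i) = stripPoint (vertexAt t i) := by
  simp [facePoint, (vertexClass_injective t).eq_iff]

/-- The affine map from the points supported on a triangle to the plane. -/
def chart (t : TriIndex) (w : TorusVertex → ℝ) : ℂ := ∑ v, w v • facePoint t v

lemma continuous_chart (t : TriIndex) : Continuous (chart t) :=
  continuous_finsetSum _ fun v _ => (continuous_apply v).smul continuous_const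

/-- The weights of `w` vanish outside of the vertices of the triangle. -/
def SupportedOn (t : TriIndex) (w : TorusVertex → ℝ) : Prop := ∀ v, v ∉ faceOf t → w v = 0

lemma SupportedOn.sum_eq {t : TriIndex} {w : TorusVertex → ℝ} (h : SupportedOn t w)
    {E : Type*} [AddCommGroup E] [Module ℝ E] (g : TorusVertex → E) :
    ∑ v, w v • g v = ∑ i, w (vertexClass t i) • g (vertexClass t i) := by
  rw [sum_smul_eq_sum_face h, faceOf,
    Finset.sum_image fun i _ j _ hij => vertexClass_injective t hij]

lemma SupportedOn.chart_eq {t : TriIndex} {w : TorusVertex → ℝ} (h : SupportedOn t w) :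
    chart t w = ∑ i, w (vertexClass t i) • stripPoint (vertexAt t i) := by
  rw [chart, h.sum_eq]
  simp only [facePoint_vertexClass]

lemma SupportedOn.sum_eq_one {t : TriIndex} {w : TorusVertex → ℝ} (h : SupportedOn t w)
    (h1 : ∑ v, w v = 1) : ∑ i, w (vertexClass t i) = 1 := by
  have := h.sum_eq fun _ => (1 : ℝ)
  simpa [h1] using this.symm

lemma SupportedOn.exists_vertexClass {t : TriIndex} {w : TorusVertex → ℝ} (h : SupportedOn t w)
    {v : TorusVertex} (hv : w v ≠ 0) : ∃ i, vertexClass t i = v := by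
  by_contra hc
  exact hv (h v fun hm => hc (mem_faceOf.1 hm))

/-- The point of the torus does not depend on the triangle. -/
lemma chart_eq_chart {t t' : TriIndex} {w : TorusVertex → ℝ} (h : SupportedOn t w)
    (h' : SupportedOn t' w) (h1 : ∑ v, w v = 1) :
    (chart t w : LayoutTorus 19) = chart t' w := by
  obtain ⟨v, hv⟩ : ∃ v, w v ≠ 0 := by
    by_contra! hc
    simp [hc] at h1
  obtain ⟨i, hi⟩ := h.exists_vertexClass hv
  obtain ⟨i', hi'⟩ := h'.exists_vertexClass hv
  have hii : vertexClass t i = vertexClass t' i' := hi.trans hi'.symm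
  obtain ⟨⟨a, ha⟩, b, hb⟩ := vertexClass_eq_iff.1 hii
  rw [layout_eq_iff]
  refine ⟨a, b, ?_⟩
  obtain ⟨l, hl⟩ : ∃ l : ℂ, l = a * (19 : ℕ) + b * (2 * Complex.I) := ⟨_, rfl⟩
  rw [← hl]
  -- The positions of a vertex of the support in the two triangles differ by a period, the same for
  -- all these vertices by `sub_eq_sub_of_vertexClass_eq`.
  have hu : ∀ u, w u • facePoint t' u = w u • facePoint t u + w u • l := by
    intro u
    by_cases hu : w u = 0
    · simp [hu]
    obtain ⟨j, hj⟩ := h.exists_vertexClass hu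
    obtain ⟨j', hj'⟩ := h'.exists_vertexClass hu
    have hd := sub_eq_sub_of_vertexClass_eq hii (hj.trans hj'.symm)
    have e1 := congrArg Prod.fst hd
    have e2 := congrArg Prod.snd hd
    simp only [Prod.fst_sub, Prod.snd_sub, ha, hb] at e1 e2
    rw [← smul_add]
    congr 1
    conv_lhs => rw [← hj', facePoint_vertexClass]
    rw [← hj, facePoint_vertexClass, hl]
    have f1 : ((vertexAt t' j').1 : ℝ) = (vertexAt t j).1 + 87780 * a := by
      have : (vertexAt t' j').1 = (vertexAt t j).1 + 87780 * a := by linarith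
      exact_mod_cast this
    have f2 : ((vertexAt t' j').2 : ℝ) = (vertexAt t j).2 + 9240 * b := by
      have : (vertexAt t' j').2 = (vertexAt t j).2 + 9240 * b := by linarith
      exact_mod_cast this
    apply Complex.ext
    · simp [stripPoint, f1]; ring
    · simp [stripPoint, f2]; ring
  rw [chart, chart, Finset.sum_congr rfl fun u _ => hu u, Finset.sum_add_distrib,
    ← Finset.sum_smul, h1, one_smul]

lemma exists_supportedOn (w : realization refinement) : ∃ p, SupportedOn (baseTri p) w.1 := by
  obtain ⟨-, σ, ⟨-, t, ht⟩, hw⟩ := w.2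
  obtain ⟨p, hp⟩ := exists_faceOf_baseTri t
  exact ⟨p, fun v hv => hw v fun h => hv (hp ▸ ht h)⟩

/-- The map from the realization to the torus, linear on each face. -/
def toTorus (w : realization refinement) : LayoutTorus 19 :=
  QuotientAddGroup.mk (chart (baseTri (exists_supportedOn w).choose) w.1)

lemma toTorus_eq (w : realization refinement) {t : TriIndex} (h : SupportedOn t w.1) :
    toTorus w = QuotientAddGroup.mk (chart t w.1) :=
  chart_eq_chart (exists_supportedOn w).choose_spec h w.2.1.2

lemma continuous_toTorus : Continuous toTorus := by
  refine (locallyFinite_of_finite fun p => {w : realization refinement |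
    SupportedOn (baseTri p) w.1}).continuous ?_ (fun p => ?_) fun p => ?_
  · exact eq_univ_of_forall fun w => mem_iUnion.2 (exists_supportedOn w)
  · have : {w : realization refinement | SupportedOn (baseTri p) w.1} =
        ⋂ v, ⋂ _ : v ∉ faceOf (baseTri p), {w : realization refinement | w.1 v = 0} := by
      ext w; simp [SupportedOn]
    rw [this]
    exact isClosed_iInter fun v => isClosed_iInter fun _ =>
      isClosed_eq ((continuous_apply v).comp continuous_subtype_val) continuous_const
  · have hc : Continuous fun w : realization refinement =>
        (QuotientAddGroup.mk (chart (baseTri p) w.1) : LayoutTorus 19) :=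
      continuous_quot_mk.comp ((continuous_chart _).comp continuous_subtype_val)
    exact hc.continuousOn.congr fun w hw => toTorus_eq w hw

lemma SupportedOn.chart_re_im {t : TriIndex} {w : TorusVertex → ℝ} (h : SupportedOn t w)
    (h1 : ∑ v, w v = 1) :
    ∑ i, w (vertexClass t i) * (vertexAt t i).1 = 4620 * (chart t w).re ∧
    ∑ i, w (vertexClass t i) * (vertexAt t i).2 = 4620 * ((chart t w).im + 1) := by
  have h2 := h.sum_eq_one h1
  rw [h.chart_eq, Complex.re_sum, Complex.im_sum]
  simp only [stripPoint, Complex.real_smul, Complex.re_ofReal_mul, Complex.im_ofReal_mul]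
  simp only [Fin.sum_univ_three] at h2 ⊢
  constructor
  · ring
  · linear_combination (4620 : ℝ) * h2

/-- After translation of the second triangle by a period, the two points have the same image in the
plane. Affine independence in one triangle, or separation of two, gives the same combination of
vertices. -/
lemma injective_toTorus : Function.Injective toTorus := by
  intro w w' hww
  obtain ⟨p, hp⟩ := exists_supportedOn w
  obtain ⟨p', hp'⟩ := exists_supportedOn w'
  obtain ⟨t, ht⟩ : ∃ t, t = baseTri p := ⟨_, rfl⟩
  rw [← ht] at hp
  rw [toTorus_eq w hp, toTorus_eq w' hp', layout_eq_iff] at hww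
  obtain ⟨a, b, hab⟩ := hww
  obtain ⟨t', ht'⟩ : ∃ t', t' = periodShift (baseTri p') (-a) (-b) := ⟨_, rfl⟩
  have hw' : SupportedOn t' w'.1 := by
    unfold SupportedOn; rwa [ht', faceOf_periodShift]
  have s := hp.sum_eq_one w.2.1.2
  have s' := hw'.sum_eq_one w'.2.1.2
  obtain ⟨x, y⟩ := hp.chart_re_im w.2.1.2
  obtain ⟨x', y'⟩ := hw'.chart_re_im w'.2.1.2
  have hc : chart t' w'.1 = chart t w.1 := by
    have s'' := hp'.sum_eq_one w'.2.1.2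
    rw [hw'.chart_eq, ← add_right_cancel_iff (a := a * (19 : ℕ) + b * (2 * Complex.I)), ← hab,
      hp'.chart_eq]
    have hz : ∀ i, stripPoint (vertexAt (baseTri p') i) = stripPoint (vertexAt t' i) +
        (a * (19 : ℕ) + b * (2 * Complex.I)) := by
      intro i
      rw [ht', vertexAt_periodShift]
      apply Complex.ext
      · simp [stripPoint]; ring
      · simp [stripPoint]; ring
    simp only [hz, smul_add, Finset.sum_add_distrib, ← Finset.sum_smul, s'', one_smul, ht',
      vertexClass_periodShift]
  have key : ∀ f : ℤ × ℤ → ℝ, ∑ i, w.1 (vertexClass t i) * f (vertexAt t i) =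
      ∑ i, w'.1 (vertexClass t' i) * f (vertexAt t' i) := by
    rcases eq_or_ne t t' with e | e
    · rw [← e] at x' y' s' hc ⊢
      have h0 : (fun i => w.1 (vertexClass t i) - w'.1 (vertexClass t i)) = 0 := by
        apply eq_zero_of_sum_eq_zero (det_vertexAt_pos t).ne'
        · rw [Finset.sum_sub_distrib, s, s', sub_self]
        · simp only [sub_mul, Finset.sum_sub_distrib]
          rw [x, x', hc, sub_self]
        · simp only [sub_mul, Finset.sum_sub_distrib]
          rw [y, y', hc, sub_self]
      intro f
      refine Finset.sum_congr rfl fun i _ => ?_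
      rw [sub_eq_zero.1 (congrFun h0 i)]
    · exact (separated_vertexAt e _ _ (fun i => w.2.1.1 _) (fun i => w'.2.1.1 _) s s'
        (by rw [x, x', hc]) (by rw [y, y', hc])).1
  -- Each barycentric coordinate is the mean of the indicator function of a vertex class, to which
  -- `key` applies.
  have hval : ∀ {t : TriIndex} {w : TorusVertex → ℝ}, SupportedOn t w → ∀ v : TorusVertex,
      ∑ i, w (vertexClass t i) * (if torusClass (vertexAt t i) = v.1 then (1 : ℝ) else 0) = w v
          := by
    intro t w h v
    have h2 := h.sum_eq fun u => if u.1 = v.1 then (1 : ℝ) else 0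
    rw [show w v = ∑ u, w u • (if u.1 = v.1 then (1 : ℝ) else 0) by
      simp [← Subtype.ext_iff], h2]
    rfl
  refine Subtype.ext (funext fun v => ?_)
  rw [← hval hp v, ← hval hw' v]
  exact key fun p => if torusClass p = v.1 then (1 : ℝ) else 0

lemma surjective_toTorus : Function.Surjective toTorus := by
  intro x
  obtain ⟨z, rfl⟩ := QuotientAddGroup.mk_surjective x
  obtain ⟨t, ht⟩ := mem_iUnion.1 (iUnion_closedTri ▸ mem_univ (⟨4620 * z.re,
      4620 * (z.im + 1)⟩ : ℂ))
  obtain ⟨u, hu, h1, hre, him⟩ := exists_weights (det_vertexAt_pos t) ht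
  obtain ⟨w, hw⟩ : ∃ w : TorusVertex → ℝ, w = fun v => ∑ i,
      if vertexClass t i = v then u i else 0 :=
    ⟨_, rfl⟩
  have hwi : ∀ i, w (vertexClass t i) = u i := fun i => by
    simp [hw, (vertexClass_injective t).eq_iff]
  have hsupp : SupportedOn t w := by
    intro v hv
    rw [hw]
    refine Finset.sum_eq_zero fun i _ => if_neg fun h => hv (mem_faceOf.2 ⟨i, h⟩)
  have hsum : ∑ v, w v = 1 := by
    have := hsupp.sum_eq fun _ => (1 : ℝ)
    simpa [hwi, h1] using this
  refine ⟨⟨w, ⟨fun v => ?_, hsum⟩, faceOf t, ⟨Finset.card_pos.1 (by rw [card_faceOf]; norm_num), t,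
    Finset.Subset.rfl⟩, hsupp⟩, ?_⟩
  · rw [hw]
    exact Finset.sum_nonneg fun i _ => by split_ifs; exacts [hu i, le_rfl]
  · rw [toTorus_eq _ hsupp]
    congr 1
    obtain ⟨h2, h3⟩ := hsupp.chart_re_im hsum
    simp only [hwi] at h2 h3
    apply Complex.ext
    · simp only at hre; linarith
    · simp only at him; linarith

/-- The realization of the common refinement is the torus. -/
def torusHomeo : realization refinement ≃ₜ LayoutTorus 19 :=
  Continuous.homeoOfEquivCompactToT2 (f := Equiv.ofBijective toTorus
    ⟨injective_toTorus, surjective_toTorus⟩) continuous_toTorus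

lemma tile_mem_diplotorusTriangles (d : ℤ) (i : Fin 4) (k : ℤ) :
    tile d i k ∈ diplotorusTriangles d := by
  refine ⟨k, ?_⟩
  fin_cases i
  · exact Or.inl rfl
  · exact Or.inr (Or.inl rfl)
  · exact Or.inr (Or.inr (Or.inl rfl))
  · exact Or.inr (Or.inr (Or.inr rfl))

lemma exists_tile_of_inTile {d k i : ℕ} (hi : i ∈ [0, 1, 2, 3]) (l : ℤ) : ∃ j, ∀ p : ℕ × ℕ,
    Tri.inTile d k i p = true → stripPoint (p.1 + 4620 * l, p.2 + 9240 * 0) ∈ tile d j (k + l) := by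
  have c : ∀ {a b : ℕ}, a ≤ b → (a : ℝ) ≤ b := fun h => by exact_mod_cast h
  simp only [List.mem_cons, List.not_mem_nil, or_false] at hi
  rcases hi with rfl | rfl | rfl | rfl
  · refine ⟨0, fun p hp => mem_tile_zero.2 ?_⟩
    simp only [Tri.inTile, Bool.and_eq_true, Nat.ble_eq] at hp
    obtain ⟨⟨h1, h2⟩, h3⟩ := hp
    have h1 := c h1
    have h2 := c h2
    have h3 := c h3
    have h4 : (0 : ℝ) ≤ p.2 := Nat.cast_nonneg _
    simp only [stripPoint]
    push_cast at *
    refine ⟨?_, ?_, ?_, ?_⟩ <;> linarith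
  · refine ⟨1, fun p hp => mem_tile_one.2 ?_⟩
    simp only [Tri.inTile, Bool.and_eq_true, Nat.ble_eq] at hp
    obtain ⟨⟨h1, h2⟩, h3⟩ := hp
    have h1 := c h1
    have h2 := c h2
    have h3 := c h3
    have h4 : (0 : ℝ) ≤ p.2 := Nat.cast_nonneg _
    simp only [stripPoint]
    push_cast at *
    refine ⟨?_, ?_, ?_, ?_⟩ <;> linarith
  · refine ⟨2, fun p hp => mem_tile_two.2 ?_⟩
    simp only [Tri.inTile, Bool.and_eq_true, Nat.ble_eq] at hp
    obtain ⟨⟨⟨h1, h2⟩, h3⟩, h4⟩ := hp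
    have h1 := c h1
    have h2 := c h2
    have h3 := c h3
    have h4 := c h4
    simp only [stripPoint]
    push_cast at *
    refine ⟨?_, ?_, ?_, ?_⟩ <;> linarith
  · refine ⟨3, fun p hp => mem_tile_three.2 ?_⟩
    simp only [Tri.inTile, Bool.and_eq_true, Nat.ble_eq] at hp
    obtain ⟨⟨⟨h1, h2⟩, h3⟩, h4⟩ := hp
    have h1 := c h1
    have h2 := c h2
    have h3 := c h3
    have h4 := c h4
    simp only [stripPoint]
    push_cast at *
    refine ⟨?_, ?_, ?_, ?_⟩ <;> linarith

theorem subdivides_refinement {d : ℤ} (hd : d ∈ ({2, 7, 13} : Set ℤ)) :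
    Subdivides refinement 19 d torusHomeo := by
  rintro σ ⟨-, t, ht⟩
  obtain ⟨p, hp⟩ := exists_faceOf_baseTri t
  rw [hp] at ht
  refine ⟨facePoint (baseTri p), fun w hw => toTorus_eq w fun v hv => hw v fun h => hv (ht h), ?_⟩
  obtain ⟨j, l⟩ := p
  obtain ⟨T, hT⟩ : ∃ T, T = triTable.get j := ⟨_, rfl⟩
  obtain ⟨n, rfl, hn⟩ : ∃ n : ℕ, d = n ∧ Tri.tiled n T = true := by
    have h := List.all_eq_true.1 Tri.tiled_triTable _ (List.get_mem triTable j)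
    rw [← hT, Bool.and_eq_true, Bool.and_eq_true] at h
    rcases hd with rfl | rfl | rfl
    · exact ⟨2, rfl, h.1.1⟩
    · exact ⟨7, rfl, h.1.2⟩
    · exact ⟨13, rfl, h.2⟩
  obtain ⟨k, -, hk⟩ := List.any_eq_true.1 hn
  obtain ⟨i, hi, hk⟩ := List.any_eq_true.1 hk
  rw [Bool.and_eq_true, Bool.and_eq_true] at hk
  -- The verification on the table concerns column `0`; translating by `l` columns shifts the index
  -- of the tile by `l`.
  obtain ⟨i', hi'⟩ := exists_tile_of_inTile (d := n) (k := k) hi (l : ℕ)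
  refine ⟨_, tile_mem_diplotorusTriangles n i' (k + (l : ℕ)), fun v hv => ?_⟩
  obtain ⟨m, rfl⟩ := mem_faceOf.1 (ht hv)
  rw [facePoint_vertexClass]
  have hm : Tri.inTile n k i (T.corner m) = true := by
    fin_cases m
    · exact hk.1
    · exact hk.2.1
    · exact hk.2.2
  have := hi' _ hm
  rw [hT] at this
  exact this

end FlatTori
end

theorem mainTheorem3 :
    ∃ (V : Type) (_ : Fintype V) (K : AbstractSimplicialComplex V),
      FlatTori.numTriangles K = 2204 ∧
      FlatTori.IsCommonRefinement K 19 {2, 7, 13} ∧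
      ∀ τ ∈ FlatTori.shortModuli, FlatTori.AdmitsLinearEmbedding K τ :=
  ⟨FlatTori.TorusVertex, inferInstance, FlatTori.refinement, FlatTori.numTriangles_refinement,
    ⟨FlatTori.torusHomeo, fun _ hd => FlatTori.subdivides_refinement hd⟩,
    fun _ hτ => FlatTori.admitsLinearEmbedding_of_short
      (fun _ hd => FlatTori.subdivides_refinement hd) hτ⟩
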